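/- Let $\Omega\subset\mathbb R^2$ be a bounded polygonal Lipschitz domain, and for $\mathbf F\in \mathbf H^{-1}(\Omega)=(\mathbf H^1_0(\Omega))'$ let $(\mathbf u,p)\in \mathbf H^1_0(\Omega)\times L^2_0(\Omega)$ be the weak solution of the Stokes problem: with $a(\mathbf u,\mathbf v)=\int_\Omega\langle\nabla\mathbf u,\nabla\mathbf v\rangle$ and $b(\mathbf v,q)=\int_\Omega q\operatorname{div}\mathbf v$, $$a(\mathbf u,\mathbf v)-b(\mathbf v,p)=\mathbf F(\mathbf v)\quad\forall \mathbf v\in \mathbf H^1_0(\Omega),\qquad b(\mathbf u,q)=0\quad\forall q\in L^2_0(\Omega).$$ Let $\mathcal T$ be a conforming triangulation of $\Omega$ into closed triangles with shape-regularity constant $\gamma_{\mathcal T}=\max_{K\in\mathcal T}h_K/\rho_K$ ($h_K$ the diameter of $K$, $\rho_K$ the diameter of its largest inscribed ball), and let $\alpha_{\mathcal T}$ be the minimal outer angle of $\Omega$ at the boundary vertices of $\mathcal T$. At every vertex $\mathbf z$ fix a counterclockwise numbering $K_1,\dots,K_{N_{\mathbf z}}$ of the triangles that contain $\mathbf z$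 and let $\theta_i$ be the angle of $K_i$ at $\mathbf z$. Let $\Theta(\mathbf z)$ be the maximum of $|\sin(\theta_i+\theta_{i+1})|$ over $1\le i\le N_{\mathbf z}$ (cyclically) if $\mathbf z\in\Omega$, the maximum over $1\le i\le N_{\mathbf z}-1$ if $\mathbf z\in\partial\Omega$ and $N_{\mathbf z}>1$, and $0$ if $\mathbf z\in\partial\Omega$ and $N_{\mathbf z}=1$. For $\eta\ge 0$ the vertex $\mathbf z$ is called $\eta$-critical if $\Theta(\mathbf z)\le\eta$. For $k\ge1$ let $\mathbf S_{k,0}(\mathcal T)$ be the space of vector fields in $\mathbf H^1_0(\Omega)$ whose components are polynomials of degree at most $k$ on each triangle, and let $M_{\eta,k-1}(\mathcal T)$ be the space of all $q\in L^2_0(\Omega)$ that are polynomials of degree at most $k-1$ on each triangle and satisfy $\sum_{\ell=1}^{N_{\mathbf z}}(-1)^\ell\,(q|_{K_\ell})(\mathbf z)=0$ at every $\eta$-critical vertex $\mathbf z$. Then there is $\eta_0>0$ that depends only on the shape-regularity constant and the minimal outer angle of $\mathcal T$, and a constant $C>0$ that depends only on the shape-regularity constant and on $\Omega$, such that for all $k\ge4$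 and $0\le\eta<\eta_0$ every discrete solution $(\mathbf u_{\mathbf S},p_M)\in \mathbf S_{k,0}(\mathcal T)\times M_{\eta,k-1}(\mathcal T)$ of $$a(\mathbf u_{\mathbf S},\mathbf v)-b(\mathbf v,p_M)=\mathbf F(\mathbf v)\quad\forall \mathbf v\in \mathbf S_{k,0}(\mathcal T),\qquad b(\mathbf u_{\mathbf S},q)=0\quad\forall q\in M_{\eta,k-1}(\mathcal T),$$ satisfies $$\|\nabla(\mathbf u-\mathbf u_{\mathbf S})\|_{L^2(\Omega)}\le C\Big(\min_{\substack{\mathbf v_{\mathbf S}\in \mathbf S_{k,0}(\mathcal T)\\ \operatorname{div}\mathbf v_{\mathbf S}=0}}\|\nabla(\mathbf u-\mathbf v_{\mathbf S})\|_{L^2(\Omega)}+\eta\min_{q_M\in M_{\eta,k-1}(\mathcal T)}\|p-q_M\|_{L^2(\Omega)}\Big),$$ $$\|\operatorname{div}\mathbf u_{\mathbf S}\|_{L^2(\Omega)}\le C\Big(\eta\min_{\substack{\mathbf v_{\mathbf S}\in \mathbf S_{k,0}(\mathcal T)\\ \operatorname{div}\mathbf v_{\mathbf S}=0}}\|\nabla(\mathbf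 u-\mathbf v_{\mathbf S})\|_{L^2(\Omega)}+\eta^2\min_{q_M\in M_{\eta,k-1}(\mathcal T)}\|p-q_M\|_{L^2(\Omega)}\Big),$$ and the minima are attained. In particular $C$ does not depend on the mesh width, the polynomial degree $k$, the smallest positive value of $\Theta$ over the vertices of $\mathcal T$, or $\eta$. -/

import Mathlib

open MeasureTheory Set
open scoped ContDiff NNReal

noncomputable section

namespace Stokes

/-- The Euclidean plane. -/
abbrev Plane : Type := EuclideanSpace ℝ (Fin 2)

/-! ### Domains -/

/-- The boundary of `Ω` is locally, in suitable Cartesian coordinates, the graph of a Lipschitz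
function, with `Ω` strictly above the graph. -/
def HasLipschitzBoundary (Ω : Set Plane) : Prop :=
  ∀ x ∈ frontier Ω, ∃ (φ : Plane ≃ᵃⁱ[ℝ] Plane) (L : ℝ≥0) (g : ℝ → ℝ) (r : ℝ),
    LipschitzWith L g ∧ 0 < r ∧
      ∀ y ∈ Metric.ball x r, y ∈ Ω ↔ g (φ y 0) < φ y 1

/-- Bounded polygonal Lipschitz domains of the plane. -/
structure IsPolygonalLipschitzDomain (Ω : Set Plane) : Prop where
  isOpen : IsOpen Ω
  isConnected : IsConnected Ω
  isBounded : Bornology.IsBounded Ω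
  lipschitz : HasLipschitzBoundary Ω
  polygonal : ∃ S : Finset (Plane × Plane), frontier Ω = ⋃ s ∈ S, segment ℝ s.1 s.2

/-! ### Function spaces and bilinear forms -/

/-- The real Hilbert space `L²(Ω)`. -/
abbrev L2 (Ω : Set Plane) : Type := Lp ℝ 2 ((volume : Measure Plane).restrict Ω)

/-- The pairs `(φ, ∇φ)`, where `φ` is smooth with compact support in `Ω`. -/
def testGraph (Ω : Set Plane) : Submodule ℝ (L2 Ω × (Fin 2 → L2 Ω)) where
  carrier := {U | ∃ φ : Plane → ℝ, ContDiff ℝ ∞ φ ∧ HasCompactSupport φ ∧ tsupport φ ⊆ Ω ∧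
    (U.1 : Plane → ℝ) =ᵐ[volume.restrict Ω] φ ∧
    ∀ j : Fin 2, (U.2 j : Plane → ℝ) =ᵐ[volume.restrict Ω]
      fun x => fderiv ℝ φ x (EuclideanSpace.single j 1)}
  zero_mem' := by
    refine ⟨0, contDiff_const, HasCompactSupport.zero, by simp, Lp.coeFn_zero _ _ _, fun j => ?_⟩
    have h : (fun x : Plane => fderiv ℝ (0 : Plane → ℝ) x (EuclideanSpace.single j (1 : ℝ)))
        = 0 := by
      funext x
      simp
    rw [h]
    exact Lp.coeFn_zero _ _ _
  add_mem' := by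
    rintro U V ⟨φ, hφ, hφc, hφs, hφ0, hφ1⟩ ⟨ψ, hψ, hψc, hψs, hψ0, hψ1⟩
    refine ⟨φ + ψ, hφ.add hψ, hφc.add hψc,
      (tsupport_add φ ψ).trans (union_subset hφs hψs), ?_, fun j => ?_⟩
    · exact (Lp.coeFn_add _ _).trans (hφ0.add hψ0)
    · refine (Lp.coeFn_add _ _).trans (((hφ1 j).add (hψ1 j)).trans (Filter.Eventually.of_forall ?_))
      intro x
      simp only [Pi.add_apply]
      rw [fderiv_add (hφ.differentiable (by simp) x) (hψ.differentiable (by simp) x)]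
      simp
  smul_mem' := by
    rintro c U ⟨φ, hφ, hφc, hφs, hφ0, hφ1⟩
    refine ⟨c • φ, hφ.const_smul c, hφc.smul_left (f := fun _ => c),
      (tsupport_smul_subset_right (fun _ => c) φ).trans hφs, ?_, fun j => ?_⟩
    · exact (Lp.coeFn_smul _ _).trans (hφ0.const_smul c)
    · refine (Lp.coeFn_smul _ _).trans
        (((hφ1 j).const_smul c).trans (Filter.Eventually.of_forall ?_))
      intro x
      simp only [Pi.smul_apply]
      rw [fderiv_const_smul (hφ.differentiable (by simp) x)]
      simp

/-- The space `H₀¹(Ω)`: the closure of the smooth functions with compact support in `Ω` with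
respect to the `H¹` norm. Its elements are stored as pairs `(v, ∇v)` of a function and its weak
gradient, so that convergence in `H¹` is convergence of the pairs in `L² × (L²)²`. -/
abbrev H10 (Ω : Set Plane) : Submodule ℝ (L2 Ω × (Fin 2 → L2 Ω)) :=
  (testGraph Ω).topologicalClosure

/-- Velocity fields: the space `H₀¹(Ω)²`. -/
abbrev Vel (Ω : Set Plane) : Type := Fin 2 → H10 Ω

variable {Ω : Set Plane}

/-- The `i`-th component of a velocity field, as an `L²` function. -/
def comp (v : Vel Ω) (i : Fin 2) : L2 Ω := (v i).1.1

/-- The weak partial derivative `∂ⱼ vᵢ`. -/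
def partialDeriv (v : Vel Ω) (i j : Fin 2) : L2 Ω := (v i).1.2 j

/-- The divergence of a velocity field. -/
def div (v : Vel Ω) : L2 Ω := ∑ i, partialDeriv v i i

/-- `a(u, v) = ∫ ⟨∇u, ∇v⟩`. -/
def a (u v : Vel Ω) : ℝ := ∑ i, ∑ j, inner ℝ (partialDeriv u i j) (partialDeriv v i j)

/-- `b(v, q) = ∫ q div v`. -/
def b (v : Vel Ω) (q : L2 Ω) : ℝ := inner ℝ (div v) q

/-- The norm `‖∇v‖` in `L²`. -/
def gradNorm (v : Vel Ω) : ℝ := Real.sqrt (a v v)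

/-- The space `L₀²(Ω)` of the `L²` functions with integral zero. -/
def L20 (Ω : Set Plane) : Set (L2 Ω) := {q | ∫ x in Ω, q x = 0}

/-- `(u, p)` is the weak solution in `H₀¹(Ω)² × L₀²(Ω)` of the Stokes problem with right-hand side
`F` in the dual space `H⁻¹(Ω)²`. -/
def IsStokesSolution (F : Vel Ω →L[ℝ] ℝ) (u : Vel Ω) (p : L2 Ω) : Prop :=
  p ∈ L20 Ω ∧ (∀ v : Vel Ω, a u v - b v p = F v) ∧ ∀ q ∈ L20 Ω, b u q = 0

/-- `(u, p)` is a Galerkin solution of the Stokes problem in the pair `(S, M)`. -/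
def IsDiscreteSolution (S : Set (Vel Ω)) (M : Set (L2 Ω)) (F : Vel Ω →L[ℝ] ℝ)
    (u : Vel Ω) (p : L2 Ω) : Prop :=
  u ∈ S ∧ p ∈ M ∧ (∀ v ∈ S, a u v - b v p = F v) ∧ ∀ q ∈ M, b u q = 0

/-! ### Triangulations -/

/-- The closed triangle with the given vertices. -/
def tri (K : Finset Plane) : Set Plane := convexHull ℝ (K : Set Plane)

/-- A conforming triangulation of `Ω` into closed triangles, each given by its set of vertices:
the intersection of two different triangles is the convex hull of their common vertices, that is
empty, a common vertex or a common edge. -/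
structure Triangulation (Ω : Set Plane) where
  cells : Finset (Finset Plane)
  card_eq : ∀ K ∈ cells, K.card = 3
  nondegenerate : ∀ K ∈ cells, AffineIndependent ℝ ((↑) : K → Plane)
  conforming : ∀ K ∈ cells, ∀ L ∈ cells,
    tri K ∩ tri L = convexHull ℝ ((K : Set Plane) ∩ (L : Set Plane))
  cover : ⋃ K ∈ cells, tri K = closure Ω

namespace Triangulation

variable (T : Triangulation Ω)

/-- The set of vertices. -/
def vertices : Set Plane := {z | ∃ K ∈ T.cells, z ∈ K}

/-- The set of boundary vertices. -/
def bdryVertices : Set Plane := {z | z ∈ T.vertices ∧ z ∈ frontier Ω}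

/-- The triangles that contain the vertex `z`. -/
def patch (z : Plane) : Set (Finset Plane) := {K | K ∈ T.cells ∧ z ∈ K}

/-- The number `N_z` of triangles that contain the vertex `z`. -/
def N (z : Plane) : ℕ := (T.patch z).ncard

end Triangulation

/-- The diameter `h_K` of a triangle. -/
def hK (K : Finset Plane) : ℝ := Metric.diam (tri K)

/-- The diameter `ρ_K` of the largest ball inscribed in a triangle. -/
def rhoK (K : Finset Plane) : ℝ :=
  sSup {d : ℝ | 0 ≤ d ∧ ∃ c : Plane, Metric.closedBall c (d / 2) ⊆ tri K}

/-- The shape-regularity constant, the maximum of `h_K / ρ_K`. -/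
def Triangulation.shapeRegularity (T : Triangulation Ω) : ℝ :=
  ⨆ K : {K // K ∈ T.cells}, hK K.1 / rhoK K.1

/-- A fixed counterclockwise numbering `K_0, …, K_{N_z - 1}` of the triangles at each vertex `z`:
`K_i` has the vertices `z`, `y_i`, `y_{i+1}` (in counterclockwise order), so consecutive triangles
share the edge from `z` to `y_{i+1}`. For an interior vertex the numbering closes up cyclically,
for a boundary vertex it runs from one boundary edge to the other. -/
structure Numbering (T : Triangulation Ω) where
  cell : Plane → ℕ → Finset Plane
  point : Plane → ℕ → Plane
  bijOn : ∀ z ∈ T.vertices, Set.BijOn (cell z) (Set.Iio (T.N z)) (T.patch z)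
  coe_cell : ∀ z ∈ T.vertices, ∀ i < T.N z,
    (cell z i : Set Plane) = {z, point z i, point z (i + 1)}
  ccw : ∀ z ∈ T.vertices, ∀ i < T.N z,
    0 < (point z i - z) 0 * (point z (i + 1) - z) 1
      - (point z i - z) 1 * (point z (i + 1) - z) 0

namespace Numbering

variable {T : Triangulation Ω} (e : Numbering T)

/-- The angle at `z` in the `i`-th triangle of its patch. -/
def angle (z : Plane) (i : ℕ) : ℝ := EuclideanGeometry.angle (e.point z i) z (e.point z (i + 1))

/-- The outer angle `α_z` at a boundary vertex, measured in the complement of `Ω`. -/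
def outerAngle (z : Plane) : ℝ := 2 * Real.pi - ∑ i ∈ Finset.range (T.N z), e.angle z i

/-- The minimal outer angle `α_T` at the boundary vertices. -/
def minOuterAngle : ℝ := ⨅ z : {z // z ∈ T.bdryVertices}, e.outerAngle z.1

open Classical in
/-- The measure of singularity `Θ(z)`: the maximum of `|sin (θ_i + θ_{i+1})|` over all pairs of
consecutive triangles at `z` (cyclically for an interior vertex), and `0` for a boundary vertex
that belongs to a single triangle. -/
def Theta (z : Plane) : ℝ :=
  if z ∈ Ω then
    ⨆ i : Fin (T.N z), |Real.sin (e.angle z i + e.angle z ((i + 1) % T.N z))|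
  else if 1 < T.N z then
    ⨆ i : Fin (T.N z - 1), |Real.sin (e.angle z i + e.angle z (i + 1))|
  else 0

/-- The set of `η`-critical vertices. -/
def critical (η : ℝ) : Set Plane := {z | z ∈ T.vertices ∧ e.Theta z ≤ η}

end Numbering

/-! ### Piecewise polynomials and the pressure-wired Stokes element -/

/-- `q` coincides on the interior of the triangle `K` with the polynomial `P`. -/
def IsPolyOn (q : L2 Ω) (K : Finset Plane) (P : MvPolynomial (Fin 2) ℝ) : Prop :=
  ∀ᵐ x ∂((volume : Measure Plane).restrict (interior (tri K))),
    q x = MvPolynomial.eval (fun i => x i) P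

open Classical in
/-- The polynomial that `q` coincides with on the triangle `K` (unique if it exists). -/
def polyOn (q : L2 Ω) (K : Finset Plane) : MvPolynomial (Fin 2) ℝ :=
  if h : ∃ P, IsPolyOn q K P then h.choose else 0

/-- The space of piecewise polynomials of degree at most `k`. -/
def Pk (T : Triangulation Ω) (k : ℕ) : Set (L2 Ω) :=
  {q | ∀ K ∈ T.cells, ∃ P : MvPolynomial (Fin 2) ℝ, P.totalDegree ≤ k ∧ IsPolyOn q K P}

/-- The velocity space `S_{k,0}(T)²`, where `S_{k,0}(T)` consists of the piecewise polynomials of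
degree at most `k` in `H₀¹(Ω)`. -/
def Sk0 (T : Triangulation Ω) (k : ℕ) : Set (Vel Ω) := {v | ∀ i, comp v i ∈ Pk T k}

/-- The alternating sum `A_{T,z}(q)` of the values at `z` of `q` on the triangles `K_1, …, K_N` of
the patch (the numbering here starts at zero). -/
def altSum {T : Triangulation Ω} (e : Numbering T) (z : Plane) (q : L2 Ω) : ℝ :=
  ∑ i ∈ Finset.range (T.N z),
    (-1 : ℝ) ^ (i + 1) * MvPolynomial.eval (fun j => z j) (polyOn q (e.cell z i))

/-- The pressure space `M_{η,k}(T)`: piecewise polynomials of degree at most `k` with integral zero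
whose alternating sums vanish at all `η`-critical vertices. -/
def pressureSpace {T : Triangulation Ω} (e : Numbering T) (η : ℝ) (k : ℕ) : Set (L2 Ω) :=
  {q | q ∈ Pk T k ∧ q ∈ L20 Ω ∧ ∀ z ∈ e.critical η, altSum e z q = 0}

/-! ### Best approximation errors -/

/-- The errors `‖∇(u - v)‖` over all divergence-free discrete velocities `v`. -/
def velErrors (T : Triangulation Ω) (k : ℕ) (u : Vel Ω) : Set ℝ :=
  {r | ∃ v ∈ Sk0 T k, div v = 0 ∧ r = gradNorm (u - v)}

/-- The errors `‖p - q‖` over all discrete pressures `q`. -/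
def presErrors {T : Triangulation Ω} (e : Numbering T) (η : ℝ) (k : ℕ) (p : L2 Ω) : Set ℝ :=
  {r | ∃ q ∈ pressureSpace e η k, r = ‖p - q‖}

end Stokes

end

/-! # Pressure-wired Stokes elements: the error does not see nearly singular vertices

The constants are explicit: with `s = sinBound γ`, a lower bound for the sines of the angles of the
triangles, `η < s² / 4` suffices and `C = 2 + c + c²` with `c = 105 / s³`. No inf-sup condition is
used. The argument has an abstract and a local part.

*Abstract part* (`galerkin_error_le`). Suppose that every discrete velocity `v` admits an `r` with
`div v - r` a discrete pressure and `‖r‖ ≤ c η ‖∇v‖`. Let `w = uS - vS` with `vS` discrete and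
divergence free. Then `div w = div uS` is orthogonal to the discrete pressures, hence
`‖div w‖² = ⟨div w, r⟩` and `‖div w‖ ≤ c η ‖∇w‖`. Testing the two Stokes problems with `w` gives
`‖∇w‖² = a (u - vS, w) - b (w, p - qM)` for every discrete pressure `qM`, since `div w` is
orthogonal to both `pM` and `qM`. So the pressure error enters only with the factor `c η`, and both
estimates follow. The minima are attained because the discrete spaces have finite dimension.

*Local part* (`exists_div_sub_mem_pressureSpace`). The divergence of `v` is a piecewise polynomial
with mean zero; it misses the pressure space only because its alternating sum `A` at a critical
vertex `z` need not vanish. Around `z` the gradients of `v` on consecutive triangles agree in the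
direction of their common edge (and vanish in the direction of boundary edges). At a vertex where
all `θ_i + θ_{i+1}` are multiples of `π`, this forces `A = 0`; in general it gives
`|A| ≤ η / s² * ∑ |∇v|(z)`, a sum over the patch (`Numbering.abs_alternating_div_le`). For an
interior vertex this uses that the number of triangles is even (`Numbering.even_N`): for an odd
number, twice the sum of the angles would be close to an odd multiple of `π`, but it is `4π`.

The function `r` is a sum of multiples of bubbles: `vertexBubble` is a polynomial with value `1` at
one vertex of a triangle, value `0` at the others, and mean zero. It remains to control its size
independently of the degree `k`. A polynomial `P` of degree `m` on a triangle `K` satisfies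
`P(z)² |K| ≲ m⁴ ∫ P²` (`IsCcw.sq_polyEval_le`), while the bubble of degree `k - 1` can be chosen
with `∫ B² ≲ |K| / k⁴` (`IsCcw.setIntegral_sq_vertexBubble_le`): both come from the polynomial
`pointKernel m` that represents the evaluation at the vertex for the weight `t` on `[0, 1]`. The
powers of `k` cancel. Putting the bubble on the smallest triangle of the patch makes comparisons of
the areas of neighbouring triangles unnecessary.
-/

noncomputable section

namespace Stokes

/-! ### Point evaluation of polynomials in one variable -/

/-- The numerator of the rational function `s ↦ ∑ⱼ cⱼ / (s + j + 2)`, where the `cⱼ` are the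
coefficients of `pointKernel m`: it has the zeros `1, …, m`, and its constant normalizes the value
of that function at `0` to be `1`. -/
def kernelNumerator (m : ℕ) : Polynomial ℝ :=
  Polynomial.C ((-1) ^ m * ((m : ℝ) + 1) * (m + 2)) *
    ∏ l ∈ Finset.range m, (Polynomial.X - Polynomial.C ((l : ℝ) + 1))

/-- The poles of that rational function. -/
def kernelNode (j : ℕ) : ℝ := -((j : ℝ) + 2)

/-- The polynomial of degree at most `m` that represents `f ↦ f 0` on the polynomials of degree at
most `m` in the inner product `∫₀¹ f g x dx`. -/
def pointKernel (m : ℕ) : Polynomial ℝ :=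
  ∑ j ∈ Finset.range (m + 1),
    Polynomial.C (Lagrange.nodalWeight (Finset.range (m + 1)) kernelNode j *
      (kernelNumerator m).eval (kernelNode j)) * Polynomial.X ^ j

lemma kernelNode_injective : Function.Injective kernelNode := by
  intro i j h
  simpa [kernelNode] using h

lemma degree_kernelNumerator_lt (m : ℕ) :
    (kernelNumerator m).degree < (Finset.range (m + 1)).card := by
  rw [Finset.card_range]
  refine lt_of_le_of_lt (Polynomial.degree_mul_le _ _) ?_
  have h1 : (∏ l ∈ Finset.range m, (Polynomial.X - Polynomial.C ((l : ℝ) + 1))).degree =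
      (m : WithBot ℕ) := by
    rw [Polynomial.degree_prod]
    simp only [Polynomial.degree_X_sub_C]
    simp
  rw [h1]
  refine lt_of_le_of_lt (add_le_add_left Polynomial.degree_C_le _) ?_
  rw [zero_add]
  exact_mod_cast Nat.lt_succ_self m

lemma prod_range_add_one (m : ℕ) : ∏ l ∈ Finset.range m, ((l : ℝ) + 1) = m.factorial := by
  rw [← Finset.prod_range_add_one_eq_factorial]
  push_cast
  rfl

lemma prod_range_add_three (m : ℕ) :
    ∏ l ∈ Finset.range m, ((l : ℝ) + 3) = (m.factorial : ℝ) * (m + 1) * (m + 2) / 2 := by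
  induction m with
  | zero => simp
  | succ m ih =>
    rw [Finset.prod_range_succ, ih, Nat.factorial_succ]
    push_cast
    ring

lemma prod_range_add_two (m : ℕ) :
    ∏ l ∈ Finset.range (m + 1), ((l : ℝ) + 2) = (m.factorial : ℝ) * (m + 1) * (m + 2) := by
  induction m with
  | zero => simp
  | succ m ih =>
    rw [Finset.prod_range_succ, ih, Nat.factorial_succ]
    push_cast
    ring

lemma prod_range_neg (m : ℕ) (f : ℕ → ℝ) :
    ∏ l ∈ Finset.range m, (-f l) = (-1) ^ m * ∏ l ∈ Finset.range m, f l := by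
  rw [Finset.prod_neg, Finset.card_range]

lemma sum_coeff_pointKernel_div (m i : ℕ) (hi : i ≤ m) :
    ∑ j ∈ Finset.range (m + 1), (Lagrange.nodalWeight (Finset.range (m + 1)) kernelNode j *
      (kernelNumerator m).eval (kernelNode j)) / ((i : ℝ) + j + 2) = if i = 0 then 1 else 0 := by
  have hne : ∀ j ∈ Finset.range (m + 1), (i : ℝ) ≠ kernelNode j := by
    intro j _ h
    have : (0 : ℝ) ≤ i := Nat.cast_nonneg i
    have : (0 : ℝ) ≤ j := Nat.cast_nonneg j
    simp only [kernelNode] at h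
    linarith
  have h1 := Lagrange.eval_interpolate_not_at_node
    (fun j => (kernelNumerator m).eval (kernelNode j)) hne
  rw [← Lagrange.eq_interpolate kernelNode_injective.injOn (degree_kernelNumerator_lt m)] at h1
  have h2 : ∑ j ∈ Finset.range (m + 1), (Lagrange.nodalWeight (Finset.range (m + 1)) kernelNode j *
      (kernelNumerator m).eval (kernelNode j)) / ((i : ℝ) + j + 2) =
      ∑ j ∈ Finset.range (m + 1), Lagrange.nodalWeight (Finset.range (m + 1)) kernelNode j *
        ((i : ℝ) - kernelNode j)⁻¹ * (kernelNumerator m).eval (kernelNode j) := by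
    refine Finset.sum_congr rfl fun j _ => ?_
    rw [kernelNode, div_eq_mul_inv, sub_neg_eq_add, ← add_assoc]
    ring
  rw [h2]
  have h3 : Polynomial.eval (i : ℝ) (Lagrange.nodal (Finset.range (m + 1)) kernelNode) ≠ 0 := by
    rw [Lagrange.eval_nodal, Finset.prod_ne_zero_iff]
    intro j hj
    exact sub_ne_zero.mpr (hne j hj)
  rw [← mul_right_inj' h3, ← h1]
  split_ifs with h0
  · subst h0
    rw [Lagrange.eval_nodal, kernelNumerator]
    simp only [Polynomial.eval_mul, Polynomial.eval_C, Polynomial.eval_prod, Polynomial.eval_sub,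
      Polynomial.eval_X, Nat.cast_zero, zero_sub, kernelNode, neg_neg]
    rw [prod_range_neg, prod_range_add_one, prod_range_add_two]
    have : ((-1 : ℝ) ^ m) * (-1) ^ m = 1 := by rw [← mul_pow]; simp
    linear_combination ((m : ℝ) + 1) * (m + 2) * m.factorial * this
  · rw [mul_zero, kernelNumerator, Polynomial.eval_mul, Polynomial.eval_prod]
    rw [Finset.prod_eq_zero (i := i - 1) (by simp; omega), mul_zero]
    simp only [Polynomial.eval_sub, Polynomial.eval_X, Polynomial.eval_C]
    rw [Nat.cast_sub (by omega)]
    simp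

lemma eval_zero_pointKernel (m : ℕ) :
    (pointKernel m).eval 0 = (((m : ℝ) + 1) * (m + 2)) ^ 2 / 2 := by
  rw [pointKernel, Polynomial.eval_finsetSum, Finset.sum_range_succ', Finset.sum_eq_zero]
  swap
  · intro j _
    simp
  simp only [zero_add, Polynomial.eval_C, pow_zero, mul_one]
  rw [Lagrange.nodalWeight, Finset.range_eq_Ico, ← Finset.Ioo_insert_left (Nat.succ_pos m),
    Finset.erase_insert (by simp)]
  have h1 : ∏ j ∈ Finset.Ioo 0 (m + 1), (kernelNode 0 - kernelNode j)⁻¹ = (m.factorial : ℝ)⁻¹ := by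
    rw [← prod_range_add_one, ← Finset.prod_inv_distrib]
    have : Finset.Ioo 0 (m + 1) = Finset.image (fun l => l + 1) (Finset.range m) := by
      ext j
      simp only [Finset.mem_Ioo, Finset.mem_image, Finset.mem_range]
      constructor
      · rintro ⟨h, h'⟩
        exact ⟨j - 1, by omega, by omega⟩
      · rintro ⟨l, h, rfl⟩
        omega
    rw [this, Finset.prod_image (by intro _ _ _ _ h; simpa using h)]
    refine Finset.prod_congr rfl fun l _ => ?_
    simp only [kernelNode]
    push_cast
    ring_nf
  rw [h1, kernelNumerator]
  simp only [Polynomial.eval_mul, Polynomial.eval_C, Polynomial.eval_prod, Polynomial.eval_sub,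
      Polynomial.eval_X]
  have h2 : ∏ l ∈ Finset.range m, (kernelNode 0 - ((l : ℝ) + 1)) =
      ∏ l ∈ Finset.range m, (-((l : ℝ) + 3)) := by
    refine Finset.prod_congr rfl fun l _ => ?_
    simp only [kernelNode]
    push_cast
    ring
  rw [h2, prod_range_neg, prod_range_add_three]
  have h3 : ((-1 : ℝ) ^ m) * (-1) ^ m = 1 := by rw [← mul_pow]; simp
  have h4 : (m.factorial : ℝ) ≠ 0 := by exact_mod_cast Nat.factorial_ne_zero m
  field_simp
  linear_combination h3

lemma natDegree_pointKernel_le (m : ℕ) : (pointKernel m).natDegree ≤ m := by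
  refine Polynomial.natDegree_sum_le_of_forall_le _ _ fun j hj => ?_
  refine (Polynomial.natDegree_C_mul_X_pow_le _ _).trans ?_
  simpa [Nat.lt_succ_iff] using hj

lemma intervalIntegrable_polynomial_mul_id (f : Polynomial ℝ) (u v : ℝ) :
    IntervalIntegrable (fun x => f.eval x * x) volume u v :=
  (f.continuous.mul continuous_id).intervalIntegrable _ _

lemma integral_monomial_mul_pointKernel (m i : ℕ) (hi : i ≤ m) (c : ℝ) :
    ∫ x in (0 : ℝ)..1, (Polynomial.C c * Polynomial.X ^ i * pointKernel m).eval x * x =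
      (Polynomial.C c * Polynomial.X ^ i).eval 0 := by
  have h : ∀ x : ℝ, (Polynomial.C c * Polynomial.X ^ i * pointKernel m).eval x * x =
      ∑ j ∈ Finset.range (m + 1), c * (Lagrange.nodalWeight (Finset.range (m + 1)) kernelNode j *
      (kernelNumerator m).eval (kernelNode j)) * x ^ (i + j + 1) := by
    intro x
    rw [pointKernel]
    simp only [Polynomial.eval_mul, Polynomial.eval_finsetSum, Polynomial.eval_C,
      Polynomial.eval_pow, Polynomial.eval_X]
    rw [Finset.mul_sum, Finset.sum_mul]
    exact Finset.sum_congr rfl fun j _ => by ring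
  simp only [h]
  rw [intervalIntegral.integral_finsetSum]
  · have h2 : ∀ j ∈ Finset.range (m + 1), (∫ x in (0 : ℝ)..1,
        c * (Lagrange.nodalWeight (Finset.range (m + 1)) kernelNode j *
        (kernelNumerator m).eval (kernelNode j)) * x ^ (i + j + 1)) =
        c * ((Lagrange.nodalWeight (Finset.range (m + 1)) kernelNode j *
        (kernelNumerator m).eval (kernelNode j)) / ((i : ℝ) + j + 2)) := by
      intro j _
      rw [intervalIntegral.integral_const_mul, integral_pow]
      push_cast
      simp only [one_pow, ne_eq, Nat.add_eq_zero_iff, one_ne_zero, and_false, not_false_eq_true,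
        zero_pow, sub_zero]
      ring
    rw [Finset.sum_congr rfl h2, ← Finset.mul_sum, sum_coeff_pointKernel_div m i hi]
    rcases Nat.eq_zero_or_pos i with rfl | hi
    · simp
    · simp [hi.ne']
  · intro j _
    exact (by fun_prop : Continuous fun x : ℝ =>
      c * (Lagrange.nodalWeight (Finset.range (m + 1)) kernelNode j *
        (kernelNumerator m).eval (kernelNode j)) * x ^ (i + j + 1)).intervalIntegrable _ _

/-- The reproducing property of the kernel. -/
lemma integral_mul_pointKernel (m : ℕ) (f : Polynomial ℝ) (hf : f.natDegree ≤ m) :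
    ∫ x in (0 : ℝ)..1, (f * pointKernel m).eval x * x = f.eval 0 := by
  conv_lhs => rw [f.as_sum_range_C_mul_X_pow]
  conv_rhs => rw [f.as_sum_range_C_mul_X_pow]
  simp only [Finset.sum_mul, Polynomial.eval_finsetSum]
  rw [intervalIntegral.integral_finsetSum]
  · refine Finset.sum_congr rfl fun i hi => integral_monomial_mul_pointKernel m i ?_ _
    rw [Finset.mem_range] at hi
    omega
  · intro i _
    exact intervalIntegrable_polynomial_mul_id _ _ _

lemma eval_zero_pointKernel_pos (m : ℕ) : 0 < (pointKernel m).eval 0 := by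
  rw [eval_zero_pointKernel]
  positivity

/-- The value of a polynomial of degree at most `m` at the end point `0` in terms of its weighted
`L²` norm, with the best constant. -/
lemma sq_eval_zero_le (m : ℕ) (f : Polynomial ℝ) (hf : f.natDegree ≤ m) :
    f.eval 0 ^ 2 ≤ (pointKernel m).eval 0 * ∫ x in (0 : ℝ)..1, f.eval x ^ 2 * x := by
  set K := pointKernel m with hK
  have hpos : 0 < K.eval 0 := eval_zero_pointKernel_pos m
  set t := f.eval 0 / K.eval 0 with ht
  have h0 : 0 ≤ ∫ x in (0 : ℝ)..1, (f.eval x - t * K.eval x) ^ 2 * x := by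
    refine intervalIntegral.integral_nonneg zero_le_one fun x hx => ?_
    exact mul_nonneg (sq_nonneg _) hx.1
  have h1 : ∫ x in (0 : ℝ)..1, (f.eval x - t * K.eval x) ^ 2 * x =
      (∫ x in (0 : ℝ)..1, f.eval x ^ 2 * x) - 2 * t * f.eval 0 + t ^ 2 * K.eval 0 := by
    rw [← integral_mul_pointKernel m f hf, ← integral_mul_pointKernel m K
      (natDegree_pointKernel_le m), ← intervalIntegral.integral_const_mul,
      ← intervalIntegral.integral_const_mul, ← intervalIntegral.integral_sub,
      ← intervalIntegral.integral_add]
    · refine intervalIntegral.integral_congr fun x _ => ?_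
      simp only [Polynomial.eval_mul, ← hK]
      ring
    all_goals
      apply Continuous.intervalIntegrable
      fun_prop
  rw [h1] at h0
  have h2 : t * K.eval 0 = f.eval 0 := by
    rw [ht]
    field_simp
  have h3 : 0 ≤ K.eval 0 * ((∫ x in (0 : ℝ)..1, f.eval x ^ 2 * x) - 2 * t * f.eval 0
      + t ^ 2 * K.eval 0) := mul_nonneg hpos.le h0
  nlinarith [h2, h3]

/-- A polynomial with the value `1` at `0`, the value `0` at `1` and vanishing weighted mean, whose
weighted `L²` norm is as small as the order of growth of point evaluations permits. The mean
vanishes because both `pointKernel n` and `12 x` have integral `1` against the weight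
`x (1 - x)`. -/
def bubbleProfile (n : ℕ) : Polynomial ℝ :=
  Polynomial.C ((pointKernel n).eval 0)⁻¹ * ((1 - Polynomial.X) *
    (pointKernel n - Polynomial.C 12 * Polynomial.X))

lemma eval_bubbleProfile (n : ℕ) (x : ℝ) : (bubbleProfile n).eval x =
    ((pointKernel n).eval 0)⁻¹ * ((1 - x) * ((pointKernel n).eval x - 12 * x)) := by
  simp [bubbleProfile]

lemma bubbleProfile_zero (n : ℕ) : (bubbleProfile n).eval 0 = 1 := by
  rw [eval_bubbleProfile]
  have := (eval_zero_pointKernel_pos n).ne'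
  field_simp
  ring

lemma bubbleProfile_one (n : ℕ) : (bubbleProfile n).eval 1 = 0 := by
  rw [eval_bubbleProfile]
  ring

lemma natDegree_bubbleProfile_le (n : ℕ) (hn : 1 ≤ n) : (bubbleProfile n).natDegree ≤ n + 1 := by
  refine (Polynomial.natDegree_C_mul_le _ _).trans ?_
  refine Polynomial.natDegree_mul_le.trans ?_
  have h1 : (1 - Polynomial.X : Polynomial ℝ).natDegree ≤ 1 :=
    (Polynomial.natDegree_sub_le _ _).trans (by simp)
  have h2 : (pointKernel n - Polynomial.C 12 * Polynomial.X : Polynomial ℝ).natDegree ≤ n := by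
    refine (Polynomial.natDegree_sub_le _ _).trans (max_le (natDegree_pointKernel_le n) ?_)
    exact (Polynomial.natDegree_C_mul_le _ _).trans (by simpa using hn)
  omega

lemma integral_bubbleProfile (n : ℕ) (hn : 1 ≤ n) :
    ∫ x in (0 : ℝ)..1, (bubbleProfile n).eval x * x = 0 := by
  have h1 := integral_mul_pointKernel n (1 - Polynomial.X)
    ((Polynomial.natDegree_sub_le _ _).trans (by simpa using hn))
  have h2 : ∫ x in (0 : ℝ)..1, (12 * x ^ 2 - 12 * x ^ 3) = 1 := by
    rw [intervalIntegral.integral_sub, intervalIntegral.integral_const_mul,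
      intervalIntegral.integral_const_mul, integral_pow, integral_pow]
    · norm_num
    all_goals
      apply Continuous.intervalIntegrable
      fun_prop
  have h3 : ∀ x : ℝ, (bubbleProfile n).eval x * x = ((pointKernel n).eval 0)⁻¹ *
      (((1 - Polynomial.X) * pointKernel n).eval x * x - (12 * x ^ 2 - 12 * x ^ 3)) := by
    intro x
    rw [eval_bubbleProfile]
    simp only [Polynomial.eval_mul, Polynomial.eval_sub, Polynomial.eval_one, Polynomial.eval_X]
    ring
  simp only [h3]
  rw [intervalIntegral.integral_const_mul, intervalIntegral.integral_sub, h1, h2]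
  · simp
  all_goals
    apply Continuous.intervalIntegrable
    fun_prop

lemma integral_sq_bubbleProfile_le (n : ℕ) :
    ∫ x in (0 : ℝ)..1, (bubbleProfile n).eval x ^ 2 * x ≤ 38 / (pointKernel n).eval 0 := by
  have hK := integral_mul_pointKernel n (pointKernel n) (natDegree_pointKernel_le n)
  set K0 := (pointKernel n).eval 0 with hK0
  have hpos : 0 < K0 := eval_zero_pointKernel_pos n
  have h2 : 2 ≤ K0 := by
    rw [hK0, eval_zero_pointKernel]
    have : (0 : ℝ) ≤ n := Nat.cast_nonneg n
    nlinarith [sq_nonneg (n : ℝ), mul_nonneg this this,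
      mul_nonneg (mul_nonneg this this) this]
  have h1 : ∫ x in (0 : ℝ)..1, (bubbleProfile n).eval x ^ 2 * x ≤ ∫ x in (0 : ℝ)..1,
      (2 * K0⁻¹ ^ 2 * ((pointKernel n * pointKernel n).eval x * x)
        + 2 * K0⁻¹ ^ 2 * (144 * x ^ 3)) := by
    refine intervalIntegral.integral_mono_on zero_le_one ?_ ?_ fun x hx => ?_
    · apply Continuous.intervalIntegrable
      fun_prop
    · apply Continuous.intervalIntegrable
      fun_prop
    · rw [eval_bubbleProfile, Polynomial.eval_mul, ← hK0]
      set y := (pointKernel n).eval x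
      have e1 : (1 - x) ^ 2 * (y - 12 * x) ^ 2 ≤ 1 * (2 * (y * y) + 2 * (144 * x ^ 2)) := by
        refine mul_le_mul ?_ ?_ (sq_nonneg _) zero_le_one
        · have := hx.1
          have := hx.2
          nlinarith
        · nlinarith [sq_nonneg (y + 12 * x)]
      calc (K0⁻¹ * ((1 - x) * (y - 12 * x))) ^ 2 * x
          = (K0⁻¹ ^ 2 * x) * ((1 - x) ^ 2 * (y - 12 * x) ^ 2) := by ring
        _ ≤ (K0⁻¹ ^ 2 * x) * (1 * (2 * (y * y) + 2 * (144 * x ^ 2))) :=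
            mul_le_mul_of_nonneg_left e1 (mul_nonneg (sq_nonneg _) hx.1)
        _ = _ := by ring
  refine h1.trans ?_
  rw [intervalIntegral.integral_add, intervalIntegral.integral_const_mul, hK,
    intervalIntegral.integral_const_mul, intervalIntegral.integral_const_mul, integral_pow]
  · have : 2 * K0⁻¹ ^ 2 * K0 + 2 * K0⁻¹ ^ 2 * (144 * ((1 ^ (3 + 1) - 0 ^ (3 + 1)) / ((3 : ℕ) + 1)))
        = (2 * K0 + 72) / K0 ^ 2 := by
      push_cast
      field_simp
      norm_num
      ring
    rw [this, div_le_div_iff₀ (by positivity) hpos]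
    nlinarith
  all_goals
    apply Continuous.intervalIntegrable
    fun_prop

/-! ### Triangles in barycentric coordinates -/

/-- The determinant of two vectors of the plane. -/
def cross (v w : Plane) : ℝ := v 0 * w 1 - v 1 * w 0

/-- The affine parametrization of the plane with origin `z` and frame `v`, `w`. -/
def affParam (z v w : Plane) (p : ℝ × ℝ) : Plane := z + p.1 • v + p.2 • w

lemma affParam_apply (z v w : Plane) (p : ℝ × ℝ) (i : Fin 2) :
    affParam z v w p i = z i + p.1 * v i + p.2 * w i := by
  simp [affParam]

lemma plane_ext {x y : Plane} (h0 : x 0 = y 0) (h1 : x 1 = y 1) : x = y := by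
  ext i
  fin_cases i
  · exact h0
  · exact h1

lemma continuous_cross {α : Type*} [TopologicalSpace α] {f g : α → Plane} (hf : Continuous f)
    (hg : Continuous g) : Continuous fun x => cross (f x) (g x) := by
  unfold cross
  fun_prop

lemma cross_swap (v w : Plane) : cross v w = -cross w v := by
  unfold cross
  ring

lemma cross_self (v : Plane) : cross v v = 0 := by
  unfold cross
  ring

lemma continuous_affParam (z v w : Plane) : Continuous (affParam z v w) := by
  unfold affParam
  fun_prop

lemma cross_left_affParam (z v w : Plane) (p : ℝ × ℝ) :
    cross v (affParam z v w p - z) = p.2 * cross v w := by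
  simp only [cross, PiLp.sub_apply, affParam_apply]
  ring

lemma cross_right_affParam (z v w : Plane) (p : ℝ × ℝ) :
    cross (affParam z v w p - z) w = p.1 * cross v w := by
  simp only [cross, PiLp.sub_apply, affParam_apply]
  ring

lemma affParam_coords {z v w : Plane} (h : cross v w ≠ 0) (x : Plane) :
    affParam z v w (cross (x - z) w / cross v w, cross v (x - z) / cross v w) = x := by
  have h' : v 0 * w 1 - v 1 * w 0 ≠ 0 := h
  have h1 := mul_inv_cancel₀ h'
  apply plane_ext
  · simp only [cross, PiLp.sub_apply, affParam_apply, div_eq_mul_inv]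
    linear_combination (x 0 - z 0) * h1
  · simp only [cross, PiLp.sub_apply, affParam_apply, div_eq_mul_inv]
    linear_combination (x 1 - z 1) * h1

lemma affParam_bijective {z v w : Plane} (h : cross v w ≠ 0) :
    Function.Bijective (affParam z v w) := by
  constructor
  · intro p q hpq
    have h1 := cross_left_affParam z v w p
    have h2 := cross_right_affParam z v w p
    rw [hpq, cross_left_affParam] at h1
    rw [hpq, cross_right_affParam] at h2
    exact Prod.ext (mul_right_cancel₀ h h2).symm (mul_right_cancel₀ h h1).symm
  · intro x
    exact ⟨_, affParam_coords h x⟩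

lemma measurableEmbedding_affParam {z v w : Plane} (h : cross v w ≠ 0) :
    MeasurableEmbedding (affParam z v w) :=
  (continuous_affParam z v w).measurableEmbedding (affParam_bijective h).1

lemma measurePreserving_affParam_std :
    MeasurePreserving (affParam 0 (EuclideanSpace.single 0 1) (EuclideanSpace.single 1 1))
      volume volume := by
  have h1 := (volume_preserving_finTwoArrow ℝ).symm
  have h2 := (PiLp.volume_preserving_toLp (Fin 2)).comp h1
  have h3 : affParam 0 (EuclideanSpace.single 0 1) (EuclideanSpace.single 1 1) =
      WithLp.toLp 2 ∘ (MeasurableEquiv.finTwoArrow (α := ℝ)).symm := by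
    funext p
    apply plane_ext <;> simp [affParam_apply, MeasurableEquiv.finTwoArrow]
  rw [h3]
  exact h2

/-- The linear map with the columns `v` and `w`. -/
def frameMap (v w : Plane) : Plane →ₗ[ℝ] Plane :=
  Matrix.toLin (EuclideanSpace.basisFun (Fin 2) ℝ).toBasis
    (EuclideanSpace.basisFun (Fin 2) ℝ).toBasis !![v 0, w 0; v 1, w 1]

lemma det_frameMap (v w : Plane) : LinearMap.det (frameMap v w) = cross v w := by
  rw [frameMap, LinearMap.det_toLin, Matrix.det_fin_two_of, cross]
  ring

lemma frameMap_apply (v w x : Plane) : frameMap v w x = x 0 • v + x 1 • w := by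
  rw [frameMap, Matrix.toLin_apply]
  apply plane_ext <;> simp [Fin.sum_univ_two, Matrix.mulVec, dotProduct] <;> ring

lemma map_affParam {z v w : Plane} (h : 0 < cross v w) :
    Measure.map (affParam z v w) volume = ENNReal.ofReal (cross v w)⁻¹ • volume := by
  have hcomp : affParam z v w = (fun y => z + y) ∘ (frameMap v w) ∘
      (affParam 0 (EuclideanSpace.single 0 1) (EuclideanSpace.single 1 1)) := by
    funext p
    simp only [Function.comp_apply, frameMap_apply]
    apply plane_ext <;> simp [affParam_apply] <;> ring
  have hc : Continuous (frameMap v w) := LinearMap.continuous_of_finiteDimensional _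
  rw [hcomp, ← Measure.map_map (by fun_prop)
    (hc.measurable.comp measurePreserving_affParam_std.measurable),
    ← Measure.map_map hc.measurable measurePreserving_affParam_std.measurable,
    measurePreserving_affParam_std.map_eq,
    Measure.map_linearMap_addHaar_eq_smul_addHaar _ (by rw [det_frameMap]; exact h.ne'),
    det_frameMap, Measure.map_smul, abs_of_pos (inv_pos.mpr h)]
  congr 1
  exact (measurePreserving_add_left volume z).map_eq

lemma setIntegral_preimage_affParam {z v w : Plane} (h : 0 < cross v w) (s : Set Plane)
    (f : Plane → ℝ) :
    ∫ x in s, f x = cross v w * ∫ p in affParam z v w ⁻¹' s, f (affParam z v w p) := by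
  rw [← (measurableEmbedding_affParam h.ne').setIntegral_map (μ := volume) f s, map_affParam h,
    Measure.restrict_smul, integral_smul_measure, smul_eq_mul,
    ENNReal.toReal_ofReal (inv_pos.mpr h).le, ← mul_assoc, mul_inv_cancel₀ h.ne', one_mul]

/-- The reference triangle. -/
def refTri : Set (ℝ × ℝ) := {p | 0 ≤ p.1 ∧ 0 ≤ p.2 ∧ p.1 + p.2 ≤ 1}

lemma convexHull_triple_eq_image (z y w : Plane) :
    convexHull ℝ {z, y, w} = affParam z (y - z) (w - z) '' refTri := by
  apply Subset.antisymm
  · refine convexHull_min ?_ ?_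
    · rintro x (rfl | rfl | rfl)
      · exact ⟨(0, 0), by simp [refTri], by simp [affParam]⟩
      · exact ⟨(1, 0), by simp [refTri], by simp [affParam]⟩
      · exact ⟨(0, 1), by simp [refTri], by simp [affParam]⟩
    · rintro _ ⟨p, ⟨hp1, hp2, hp3⟩, rfl⟩ _ ⟨q, ⟨hq1, hq2, hq3⟩, rfl⟩ α β hα hβ hαβ
      refine ⟨(α * p.1 + β * q.1, α * p.2 + β * q.2), ⟨by positivity, by positivity, ?_⟩, ?_⟩
      · nlinarith
      · obtain rfl : β = 1 - α := by linarith
        apply plane_ext <;> simp [affParam_apply] <;> ring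
  · rintro _ ⟨p, ⟨hp1, hp2, hp3⟩, rfl⟩
    have hz : z ∈ convexHull ℝ ({z, y, w} : Set Plane) := subset_convexHull ℝ _ (by simp)
    have hy : y ∈ convexHull ℝ ({z, y, w} : Set Plane) := subset_convexHull ℝ _ (by simp)
    have hw : w ∈ convexHull ℝ ({z, y, w} : Set Plane) := subset_convexHull ℝ _ (by simp)
    have key := (convex_convexHull ℝ ({z, y, w} : Set Plane)).sum_mem
      (t := Finset.univ) (w := ![1 - p.1 - p.2, p.1, p.2]) (z := ![z, y, w])
      (by intro i _; fin_cases i <;> simp <;> linarith)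
      (by simp only [Fin.sum_univ_three, Matrix.cons_val]; ring)
      (by intro i _; fin_cases i <;> simp [hz, hy, hw])
    convert key using 1
    apply plane_ext <;> simp [affParam_apply, Fin.sum_univ_three] <;> ring

/-- A triangle in counterclockwise order. -/
structure IsCcw (K : Finset Plane) (z y w : Plane) : Prop where
  coe_eq : (K : Set Plane) = {z, y, w}
  pos : 0 < cross (y - z) (w - z)

namespace IsCcw

variable {K : Finset Plane} {z y w : Plane}

lemma rotate (h : IsCcw K z y w) : IsCcw K y w z where
  coe_eq := by
    rw [h.coe_eq]
    ext x
    simp only [mem_insert_iff, mem_singleton_iff]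
    tauto
  pos := by
    have := h.pos
    simp only [cross, PiLp.sub_apply] at this ⊢
    linarith

lemma cross_rotate (_ : IsCcw K z y w) :
    cross (w - y) (z - y) = cross (y - z) (w - z) := by
  simp only [cross, PiLp.sub_apply]
  ring

lemma tri_eq (h : IsCcw K z y w) : tri K = affParam z (y - z) (w - z) '' refTri := by
  rw [tri, h.coe_eq, convexHull_triple_eq_image]

lemma preimage_tri (h : IsCcw K z y w) : affParam z (y - z) (w - z) ⁻¹' tri K = refTri := by
  rw [h.tri_eq, preimage_image_eq _ (affParam_bijective h.pos.ne').1]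

lemma affParam_mem_tri (h : IsCcw K z y w) (p : ℝ × ℝ) :
    affParam z (y - z) (w - z) p ∈ tri K ↔ p ∈ refTri := by
  rw [← mem_preimage, h.preimage_tri]

lemma mem_tri (h : IsCcw K z y w) (x : Plane) : x ∈ tri K ↔
    0 ≤ cross (x - z) (w - z) ∧ 0 ≤ cross (y - z) (x - z) ∧
      cross (x - z) (w - z) + cross (y - z) (x - z) ≤ cross (y - z) (w - z) := by
  have hX := h.pos
  conv_lhs => rw [← affParam_coords (z := z) hX.ne' x, h.affParam_mem_tri]
  simp only [refTri, mem_ofPred_eq]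
  rw [← add_div, div_le_one hX, le_div_iff₀ hX, le_div_iff₀ hX, zero_mul]

end IsCcw

lemma isCompact_tri (K : Finset Plane) : IsCompact (tri K) :=
  K.finite_toSet.isCompact_convexHull ℝ

lemma measurableSet_tri (K : Finset Plane) : MeasurableSet (tri K) :=
  (isCompact_tri K).measurableSet

lemma isCompact_refTri : IsCompact refTri := by
  have h : IsClosed refTri := by
    have h1 : IsClosed {p : ℝ × ℝ | 0 ≤ p.1} := isClosed_le continuous_const continuous_fst
    have h2 : IsClosed {p : ℝ × ℝ | 0 ≤ p.2} := isClosed_le continuous_const continuous_snd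
    have h3 : IsClosed {p : ℝ × ℝ | p.1 + p.2 ≤ 1} :=
      isClosed_le (continuous_fst.add continuous_snd) continuous_const
    exact h1.inter (h2.inter h3)
  refine (isCompact_Icc (a := ((0 : ℝ), (0 : ℝ))) (b := (1, 1))).of_isClosed_subset h ?_
  rintro ⟨s, t⟩ ⟨h1, h2, h3⟩
  simp only at h1 h2 h3
  exact ⟨⟨h1, h2⟩, ⟨by simp only; linarith, by simp only; linarith⟩⟩

lemma setIntegral_refTri (g : ℝ × ℝ → ℝ) (hg : Continuous g) :
    ∫ p in refTri, g p = ∫ s in (0 : ℝ)..1, ∫ t in (0 : ℝ)..(1 - s), g (s, t) := by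
  have hm := isCompact_refTri.measurableSet
  have hint : Integrable (refTri.indicator g) (volume.prod volume) :=
    (hg.continuousOn.integrableOn_compact isCompact_refTri).integrable_indicator hm
  rw [← integral_indicator hm, Measure.volume_eq_prod, integral_prod _ hint,
    intervalIntegral.integral_of_le zero_le_one, ← integral_Icc_eq_integral_Ioc,
    ← integral_indicator measurableSet_Icc]
  congr 1
  funext s
  by_cases hs : s ∈ Icc (0 : ℝ) 1
  · rw [indicator_of_mem hs, intervalIntegral.integral_of_le (by linarith [hs.2]),
      ← integral_Icc_eq_integral_Ioc, ← integral_indicator measurableSet_Icc]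
    congr 1
    funext t
    by_cases ht : t ∈ Icc 0 (1 - s)
    · rw [indicator_of_mem ht, indicator_of_mem]
      exact ⟨hs.1, ht.1, by simp only; linarith [ht.2]⟩
    · rw [indicator_of_notMem ht, indicator_of_notMem]
      rintro ⟨h1, h2, h3⟩
      exact ht ⟨h2, by simp only at h3; linarith⟩
  · rw [indicator_of_notMem hs]
    refine (integral_congr_ae (Filter.Eventually.of_forall fun t => ?_)).trans (integral_zero _ _)
    rw [indicator_of_notMem]
    rintro ⟨h1, h2, h3⟩
    simp only at h1 h2 h3
    exact hs ⟨h1, by linarith⟩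

lemma integral_interval_swap (h : ℝ → ℝ → ℝ) (hh : Continuous (Function.uncurry h)) :
    ∫ x in (0 : ℝ)..1, ∫ t in (0 : ℝ)..1, h x t = ∫ t in (0 : ℝ)..1, ∫ x in (0 : ℝ)..1, h x t := by
  simp only [intervalIntegral.integral_of_le (zero_le_one (α := ℝ))]
  apply integral_integral_swap
  rw [Measure.prod_restrict]
  refine (hh.continuousOn.integrableOn_compact (isCompact_Icc.prod isCompact_Icc :
    IsCompact (Icc (0 : ℝ) 1 ×ˢ Icc (0 : ℝ) 1))).mono_set ?_
  exact prod_mono Ioc_subset_Icc_self Ioc_subset_Icc_self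

/-- Integration over a triangle along the segments from the vertex `z` to the opposite side. -/
lemma IsCcw.setIntegral_tri {K : Finset Plane} {z y w : Plane} (h : IsCcw K z y w)
    (f : Plane → ℝ) (hf : Continuous f) :
    ∫ x in tri K, f x = cross (y - z) (w - z) * ∫ t in (0 : ℝ)..1, ∫ x in (0 : ℝ)..1,
      f (z + x • ((1 - t) • (y - z) + t • (w - z))) * x := by
  -- the frame is centered at `y`, so that the vertex `z` has the coordinates `(0, 1)`
  have h' := h.rotate.rotate
  rw [setIntegral_preimage_affParam (z := w) h'.pos, h'.preimage_tri,
    h.rotate.cross_rotate, h.cross_rotate]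
  congr 1
  rw [setIntegral_refTri (fun p => f (affParam w (z - w) (y - w) p))
    (hf.comp (continuous_affParam _ _ _))]
  have e1 := intervalIntegral.integral_comp_sub_left (a := 0) (b := 1)
    (fun s : ℝ => ∫ t in (0 : ℝ)..(1 - s), f (affParam w (z - w) (y - w) (s, t))) 1
  rw [sub_self, sub_zero] at e1
  rw [← e1]
  have e2 : ∀ x : ℝ, ∫ t in (0 : ℝ)..(1 - (1 - x)), f (affParam w (z - w) (y - w) (1 - x, t)) =
      ∫ t in (0 : ℝ)..1, f (affParam w (z - w) (y - w) (1 - x, x * (1 - t))) * x := by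
    intro x
    rw [sub_sub_cancel]
    have e3 := intervalIntegral.integral_comp_sub_left (a := 0) (b := 1)
      (fun t : ℝ => f (affParam w (z - w) (y - w) (1 - x, x * t)) * x) 1
    rw [sub_self, sub_zero] at e3
    rw [e3, intervalIntegral.integral_mul_const, mul_comm,
      intervalIntegral.mul_integral_comp_mul_left
        (f := fun t => f (affParam w (z - w) (y - w) (1 - x, t))), mul_zero, mul_one]
  simp only [e2]
  rw [integral_interval_swap]
  · refine intervalIntegral.integral_congr fun t _ => intervalIntegral.integral_congr fun x _ => ?_
    congr 2
    apply plane_ext <;> simp [affParam_apply] <;> ring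
  · simp only [Function.uncurry_def]
    refine (hf.comp ((continuous_affParam _ _ _).comp ?_)).mul ?_ <;> fun_prop

/-- The area of a triangle. -/
lemma IsCcw.volume_real_tri {K : Finset Plane} {z y w : Plane} (h : IsCcw K z y w) :
    volume.real (tri K) = cross (y - z) (w - z) / 2 := by
  have h1 := h.setIntegral_tri (fun _ => 1) continuous_const
  rw [setIntegral_const, smul_eq_mul, mul_one] at h1
  rw [h1]
  simp only [one_mul, integral_id]
  simp
  ring

lemma IsCcw.volume_real_pos {K : Finset Plane} {z y w : Plane} (h : IsCcw K z y w) :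
    0 < volume.real (tri K) := by
  rw [h.volume_real_tri]
  have := h.pos
  positivity

/-! ### Polynomials on a triangle -/

/-- The polynomial function of the plane given by `P`. -/
def polyEval (P : MvPolynomial (Fin 2) ℝ) (x : Plane) : ℝ := MvPolynomial.eval (fun i => x i) P

@[simp] lemma polyEval_add (P Q : MvPolynomial (Fin 2) ℝ) (x : Plane) :
    polyEval (P + Q) x = polyEval P x + polyEval Q x := map_add _ _ _

@[simp] lemma polyEval_sub (P Q : MvPolynomial (Fin 2) ℝ) (x : Plane) :
    polyEval (P - Q) x = polyEval P x - polyEval Q x := map_sub _ _ _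

@[simp] lemma polyEval_mul (P Q : MvPolynomial (Fin 2) ℝ) (x : Plane) :
    polyEval (P * Q) x = polyEval P x * polyEval Q x := map_mul _ _ _

@[simp] lemma polyEval_zero (x : Plane) : polyEval 0 x = 0 := map_zero _

@[simp] lemma polyEval_C (c : ℝ) (x : Plane) : polyEval (MvPolynomial.C c) x = c :=
  MvPolynomial.eval_C _

@[simp] lemma polyEval_X (i : Fin 2) (x : Plane) : polyEval (MvPolynomial.X i) x = x i :=
  MvPolynomial.eval_X _

@[simp] lemma polyEval_sum {ι : Type*} (s : Finset ι) (P : ι → MvPolynomial (Fin 2) ℝ)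
    (x : Plane) : polyEval (∑ i ∈ s, P i) x = ∑ i ∈ s, polyEval (P i) x := map_sum _ _ _

lemma polyEval_smul (c : ℝ) (P : MvPolynomial (Fin 2) ℝ) (x : Plane) :
    polyEval (c • P) x = c * polyEval P x := by
  rw [polyEval, MvPolynomial.smul_eval, polyEval]

lemma contDiff_polyEval (P : MvPolynomial (Fin 2) ℝ) : ContDiff ℝ ∞ (polyEval P) := by
  induction P using MvPolynomial.induction_on with
  | C c =>
    have : polyEval (MvPolynomial.C c) = fun _ => c := by
      funext x
      simp
    rw [this]
    exact contDiff_const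
  | add P Q hP hQ =>
    have : polyEval (P + Q) = fun x => polyEval P x + polyEval Q x := by
      funext x
      simp
    rw [this]
    exact hP.add hQ
  | mul_X P i hP =>
    have : polyEval (P * MvPolynomial.X i) = fun x => polyEval P x * x i := by
      funext x
      simp
    rw [this]
    exact hP.mul (by fun_prop)

lemma continuous_polyEval (P : MvPolynomial (Fin 2) ℝ) : Continuous (polyEval P) :=
  (contDiff_polyEval P).continuous

lemma differentiable_polyEval (P : MvPolynomial (Fin 2) ℝ) : Differentiable ℝ (polyEval P) :=
  (contDiff_polyEval P).differentiable (by simp)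

lemma fderiv_polyEval (P : MvPolynomial (Fin 2) ℝ) (x v : Plane) :
    fderiv ℝ (polyEval P) x v = ∑ j, polyEval (MvPolynomial.pderiv j P) x * v j := by
  induction P using MvPolynomial.induction_on with
  | C c =>
    have : polyEval (MvPolynomial.C c) = fun _ => c := by
      funext x
      simp
    rw [this]
    simp
  | add P Q hP hQ =>
    have : polyEval (P + Q) = polyEval P + polyEval Q := by
      funext x
      simp
    rw [this, fderiv_add (differentiable_polyEval P x) (differentiable_polyEval Q x)]
    simp only [add_apply, hP, hQ, map_add, polyEval_add]
    rw [← Finset.sum_add_distrib]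
    exact Finset.sum_congr rfl fun j _ => by ring
  | mul_X P i hP =>
    have : polyEval (P * MvPolynomial.X i) = polyEval P * fun x => x i := by
      funext x
      simp
    have h2 : HasFDerivAt (fun x : Plane => x i) (EuclideanSpace.proj i : Plane →L[ℝ] ℝ) x :=
      (EuclideanSpace.proj i : Plane →L[ℝ] ℝ).hasFDerivAt
    rw [this, fderiv_mul (differentiable_polyEval P x) h2.differentiableAt, h2.fderiv]
    simp only [add_apply, smul_apply, hP, smul_eq_mul,
      Derivation.leibniz, MvPolynomial.pderiv_X, polyEval_add, polyEval_mul, polyEval_X]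
    fin_cases i <;> simp [Fin.sum_univ_two, polyEval] <;> ring

lemma hasDerivAt_polyEval_line (P : MvPolynomial (Fin 2) ℝ) (x v : Plane) :
    HasDerivAt (fun t : ℝ => polyEval P (x + t • v))
      (∑ j, polyEval (MvPolynomial.pderiv j P) x * v j) 0 := by
  rw [← fderiv_polyEval]
  have h1 : HasDerivAt (fun t : ℝ => x + t • v) v 0 := by
    simpa using ((hasDerivAt_id (0 : ℝ)).smul_const v).const_add x
  have h2 := (differentiable_polyEval P (x + (0 : ℝ) • v)).hasFDerivAt
  have h3 := h2.comp_hasDerivAt (0 : ℝ) h1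
  rw [zero_smul, add_zero] at h3
  exact h3

/-- A polynomial that vanishes along a segment has a vanishing derivative in its direction. -/
lemma sum_pderiv_eq_zero_of_segment (P : MvPolynomial (Fin 2) ℝ) (x v : Plane)
    (h : ∀ t ∈ Ioo (0 : ℝ) 1, polyEval P (x + t • v) = 0) :
    ∑ j, polyEval (MvPolynomial.pderiv j P) x * v j = 0 := by
  have h0 : polyEval P x = 0 := by
    have hc : Continuous fun t : ℝ => polyEval P (x + t • v) :=
      (continuous_polyEval P).comp (by fun_prop)
    have h1 : Filter.Tendsto (fun t : ℝ => polyEval P (x + t • v)) (nhdsWithin 0 (Ioi 0))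
        (nhds (polyEval P (x + (0 : ℝ) • v))) := (hc.tendsto 0).mono_left nhdsWithin_le_nhds
    have h2 : Filter.Tendsto (fun t : ℝ => polyEval P (x + t • v)) (nhdsWithin 0 (Ioi 0))
        (nhds 0) := by
      refine tendsto_const_nhds.congr' ?_
      filter_upwards [Ioo_mem_nhdsGT (zero_lt_one' ℝ)] with t ht
      exact (h t ht).symm
    simpa using tendsto_nhds_unique h1 h2
  have h1 := (hasDerivAt_polyEval_line P x v).hasDerivWithinAt (s := Ici 0)
  have h2 : HasDerivWithinAt (fun t : ℝ => polyEval P (x + t • v)) 0 (Ici 0) 0 := by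
    refine (hasDerivWithinAt_const (0 : ℝ) (Ici 0) (0 : ℝ)).congr_of_eventuallyEq ?_ (by simp [h0])
    filter_upwards [Ico_mem_nhdsGE (zero_lt_one' ℝ)] with t ht
    rcases ht.1.eq_or_lt with rfl | h'
    · simp [h0]
    · exact h t ⟨h', ht.2⟩
  exact (uniqueDiffWithinAt_Ici (0 : ℝ)).eq_deriv _ h1 h2

lemma polyEval_eq_of_ae_eq {P Q : MvPolynomial (Fin 2) ℝ} {U : Set Plane} (hU : IsOpen U)
    (hne : U.Nonempty) (h : ∀ᵐ x ∂((volume : Measure Plane).restrict U),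
      polyEval P x = polyEval Q x) : P = Q := by
  have h1 : EqOn (polyEval P) (polyEval Q) U :=
    Measure.eqOn_open_of_ae_eq h hU (continuous_polyEval P).continuousOn
      (continuous_polyEval Q).continuousOn
  obtain ⟨x, hx⟩ := hne
  have hcont : Continuous (fun y : Fin 2 → ℝ => (WithLp.toLp 2 y : Plane)) :=
    PiLp.continuous_toLp 2 _
  have hV : IsOpen ((fun y : Fin 2 → ℝ => (WithLp.toLp 2 y : Plane)) ⁻¹' U) := hU.preimage hcont
  obtain ⟨ε, hε, hball⟩ := Metric.isOpen_iff.mp hV (fun i => x i) hx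
  refine MvPolynomial.funext_set (fun i => Metric.ball (x i) ε) (fun i => ?_) fun y hy => ?_
  · rw [Real.ball_eq_Ioo]
    exact Ioo_infinite (by linarith)
  · rw [← ball_pi _ hε] at hy
    exact h1 (hball hy)

lemma restrict_interior_tri (K : Finset Plane) :
    (volume : Measure Plane).restrict (interior (tri K)) = volume.restrict (tri K) :=
  Measure.restrict_congr_set
    (interior_ae_eq_of_null_frontier ((convex_convexHull ℝ _).addHaar_frontier volume))

lemma IsCcw.interior_nonempty {K : Finset Plane} {z y w : Plane} (h : IsCcw K z y w) :
    (interior (tri K)).Nonempty := by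
  rw [nonempty_iff_ne_empty]
  intro h0
  have h1 := restrict_interior_tri K
  rw [h0, Measure.restrict_empty] at h1
  have h2 := h.volume_real_pos
  rw [measureReal_def, ← Measure.restrict_apply_self, ← h1] at h2
  simp at h2

/-- The restriction of `P` to a line. -/
def linePoly (P : MvPolynomial (Fin 2) ℝ) (z v : Plane) : Polynomial ℝ :=
  MvPolynomial.aeval (fun i => Polynomial.C (z i) + Polynomial.C (v i) * Polynomial.X) P

lemma eval_linePoly (P : MvPolynomial (Fin 2) ℝ) (z v : Plane) (x : ℝ) :
    (linePoly P z v).eval x = polyEval P (z + x • v) := by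
  induction P using MvPolynomial.induction_on with
  | C c => simp [linePoly]
  | add P Q hP hQ =>
    rw [linePoly, map_add, Polynomial.eval_add, polyEval_add, ← hP, ← hQ, linePoly, linePoly]
  | mul_X P i hP =>
    rw [linePoly, map_mul, Polynomial.eval_mul, polyEval_mul, ← hP, linePoly]
    simp only [MvPolynomial.aeval_X, Polynomial.eval_mul, Polynomial.eval_add,
      Polynomial.eval_C, Polynomial.eval_X, polyEval_X, PiLp.add_apply, PiLp.smul_apply,
      smul_eq_mul]
    ring

lemma natDegree_linePoly_le {P : MvPolynomial (Fin 2) ℝ} {m : ℕ} (hP : P.totalDegree ≤ m)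
    (z v : Plane) : (linePoly P z v).natDegree ≤ m := by
  have := MvPolynomial.aeval_natDegree_le P hP
    (fun i => Polynomial.C (z i) + Polynomial.C (v i) * Polynomial.X) (n := 1) fun i => by
      refine Polynomial.natDegree_add_le_of_degree_le (by simp) ?_
      exact (Polynomial.natDegree_C_mul_le _ _).trans (by simp)
  rwa [mul_one] at this

/-- Inverse inequality: the value of a polynomial of degree at most `m` at a vertex of a triangle
in terms of its `L²` norm on the triangle. -/
lemma IsCcw.sq_polyEval_le {K : Finset Plane} {z y w : Plane} (h : IsCcw K z y w) {m : ℕ}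
    {P : MvPolynomial (Fin 2) ℝ} (hP : P.totalDegree ≤ m) :
    cross (y - z) (w - z) * polyEval P z ^ 2 ≤
      (pointKernel m).eval 0 * ∫ x in tri K, polyEval P x ^ 2 := by
  have hc := continuous_polyEval P
  rw [h.setIntegral_tri (fun x => polyEval P x ^ 2) (hc.pow 2), mul_left_comm]
  refine mul_le_mul_of_nonneg_left ?_ h.pos.le
  rw [← intervalIntegral.integral_const_mul]
  have h1 : polyEval P z ^ 2 = ∫ _t in (0 : ℝ)..1, polyEval P z ^ 2 := by simp
  rw [h1]
  refine intervalIntegral.integral_mono_on zero_le_one ?_ ?_ fun t _ => ?_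
  · exact continuous_const.intervalIntegrable _ _
  · apply Continuous.intervalIntegrable
    refine continuous_const.mul ?_
    apply intervalIntegral.continuous_parametric_intervalIntegral_of_continuous'
    simp only [Function.uncurry_def]
    exact ((hc.comp (by fun_prop)).pow 2).mul (by fun_prop)
  · have := sq_eval_zero_le m _
      (natDegree_linePoly_le hP z ((1 - t) • (y - z) + t • (w - z)))
    simpa only [eval_linePoly, zero_smul, add_zero] using this

lemma totalDegree_aeval_le (f : Polynomial ℝ) (n : ℕ) (hf : f.natDegree ≤ n)
    (Q : MvPolynomial (Fin 2) ℝ) (hQ : Q.totalDegree ≤ 1) :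
    (Polynomial.aeval Q f).totalDegree ≤ n := by
  rw [Polynomial.aeval_eq_sum_range]
  refine (MvPolynomial.totalDegree_finsetSum _ _).trans (Finset.sup_le fun i hi => ?_)
  refine (MvPolynomial.totalDegree_smul_le _ _).trans
    ((MvPolynomial.totalDegree_pow _ _).trans ?_)
  rw [Finset.mem_range] at hi
  calc i * Q.totalDegree ≤ i * 1 := Nat.mul_le_mul_left _ hQ
    _ ≤ n := by omega

lemma polyEval_aeval (f : Polynomial ℝ) (Q : MvPolynomial (Fin 2) ℝ) (x : Plane) :
    polyEval (Polynomial.aeval Q f) x = f.eval (polyEval Q x) := by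
  rw [Polynomial.aeval_eq_sum_range, polyEval_sum, Polynomial.eval_eq_sum_range]
  refine Finset.sum_congr rfl fun i _ => ?_
  rw [polyEval_smul, polyEval, map_pow, polyEval]

/-- The affine function that is `0` at `z` and `1` at `y` and `w`. -/
def oppositeCoord (z y w : Plane) : MvPolynomial (Fin 2) ℝ :=
  MvPolynomial.C (cross (y - z) (w - z))⁻¹ *
    (MvPolynomial.C (w 1 - y 1) * (MvPolynomial.X 0 - MvPolynomial.C (z 0)) -
      MvPolynomial.C (w 0 - y 0) * (MvPolynomial.X 1 - MvPolynomial.C (z 1)))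

lemma totalDegree_oppositeCoord_le (z y w : Plane) : (oppositeCoord z y w).totalDegree ≤ 1 := by
  have h : ∀ (c d : ℝ) (i : Fin 2), (MvPolynomial.C c * (MvPolynomial.X i - MvPolynomial.C d) :
      MvPolynomial (Fin 2) ℝ).totalDegree ≤ 1 := by
    intro c d i
    refine (MvPolynomial.totalDegree_mul _ _).trans ?_
    have := MvPolynomial.totalDegree_sub (MvPolynomial.X i : MvPolynomial (Fin 2) ℝ)
      (MvPolynomial.C d)
    simpa using this
  refine (MvPolynomial.totalDegree_mul _ _).trans ?_
  rw [MvPolynomial.totalDegree_C, zero_add]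
  exact (MvPolynomial.totalDegree_sub _ _).trans (max_le (h _ _ _) (h _ _ _))

lemma polyEval_oppositeCoord {z y w : Plane} (h : cross (y - z) (w - z) ≠ 0) (t x : ℝ) :
    polyEval (oppositeCoord z y w) (z + x • ((1 - t) • (y - z) + t • (w - z))) = x := by
  rw [oppositeCoord]
  simp only [polyEval_mul, polyEval_sub, polyEval_C, polyEval_X, PiLp.add_apply, PiLp.smul_apply,
    PiLp.sub_apply, smul_eq_mul]
  rw [inv_mul_eq_div, div_eq_iff h, cross]
  simp only [PiLp.sub_apply]
  ring

/-- The bubble polynomial of the vertex `z` on the triangle with the vertices `z`, `y`, `w`. -/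
def vertexBubble (n : ℕ) (z y w : Plane) : MvPolynomial (Fin 2) ℝ :=
  Polynomial.aeval (oppositeCoord z y w) (bubbleProfile n)

lemma totalDegree_vertexBubble_le {n : ℕ} (hn : 1 ≤ n) (z y w : Plane) :
    (vertexBubble n z y w).totalDegree ≤ n + 1 :=
  totalDegree_aeval_le _ _ (natDegree_bubbleProfile_le n hn) _ (totalDegree_oppositeCoord_le z y w)

namespace IsCcw

variable {K : Finset Plane} {z y w : Plane}

lemma vertexBubble_self (h : IsCcw K z y w) (n : ℕ) : polyEval (vertexBubble n z y w) z = 1 := by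
  have := polyEval_oppositeCoord h.pos.ne' 0 0
  rw [zero_smul, add_zero] at this
  rw [vertexBubble, polyEval_aeval, this, bubbleProfile_zero]

lemma vertexBubble_of_ne (h : IsCcw K z y w) (n : ℕ) {x : Plane} (hx : x ∈ K) (hne : x ≠ z) :
    polyEval (vertexBubble n z y w) x = 0 := by
  have hx' : x ∈ (K : Set Plane) := hx
  rw [h.coe_eq] at hx'
  rw [vertexBubble, polyEval_aeval]
  rcases hx' with rfl | rfl | hx'
  · exact absurd rfl hne
  · have := polyEval_oppositeCoord h.pos.ne' 0 1
    simp only [sub_zero, one_smul, zero_smul, add_zero, add_sub_cancel] at this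
    rw [this, bubbleProfile_one]
  · rw [mem_singleton_iff.mp hx']
    have := polyEval_oppositeCoord h.pos.ne' 1 1
    simp only [sub_self, one_smul, zero_smul, zero_add, add_sub_cancel] at this
    rw [this, bubbleProfile_one]

lemma setIntegral_vertexBubble (h : IsCcw K z y w) {n : ℕ} (hn : 1 ≤ n) :
    ∫ x in tri K, polyEval (vertexBubble n z y w) x = 0 := by
  rw [h.setIntegral_tri _ (continuous_polyEval _)]
  simp only [vertexBubble, polyEval_aeval, polyEval_oppositeCoord h.pos.ne',
    integral_bubbleProfile n hn]
  simp

lemma setIntegral_sq_vertexBubble_le (h : IsCcw K z y w) (n : ℕ) :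
    ∫ x in tri K, polyEval (vertexBubble n z y w) x ^ 2 ≤
      cross (y - z) (w - z) * (38 / (pointKernel n).eval 0) := by
  rw [h.setIntegral_tri (fun x => polyEval (vertexBubble n z y w) x ^ 2)
    ((continuous_polyEval _).pow 2)]
  refine mul_le_mul_of_nonneg_left ?_ h.pos.le
  simp only [vertexBubble, polyEval_aeval, polyEval_oppositeCoord h.pos.ne']
  simpa using integral_sq_bubbleProfile_le n

end IsCcw

lemma totalDegree_pderiv_le {P : MvPolynomial (Fin 2) ℝ} {k : ℕ} (hP : P.totalDegree ≤ k)
    (j : Fin 2) : (MvPolynomial.pderiv j P).totalDegree ≤ k - 1 := by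
  rw [P.as_sum, map_sum]
  refine (MvPolynomial.totalDegree_finsetSum _ _).trans (Finset.sup_le fun s hs => ?_)
  rw [MvPolynomial.pderiv_monomial]
  by_cases h0 : s j = 0
  · simp [h0]
  refine (MvPolynomial.totalDegree_monomial_le _ _).trans ?_
  have h1 : (s.sum fun _ e => e) ≤ k := (MvPolynomial.le_totalDegree hs).trans hP
  have h2 : (s - Finsupp.single j 1) + Finsupp.single j 1 = s := by
    apply tsub_add_cancel_of_le
    rw [Finsupp.single_le_iff]
    omega
  have h3 : ((s - Finsupp.single j 1).sum fun _ e => e) + 1 = s.sum fun _ e => e := by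
    conv_rhs => rw [← h2, Finsupp.sum_add_index' (by simp) (by simp)]
    simp
  have h4 : ((s - Finsupp.single j 1).sum fun _ => id) =
    ((s - Finsupp.single j 1).sum fun _ e => e) := rfl
  omega

variable {Ω : Set Plane}

/-! ### Integration by parts in `H₀¹` -/

lemma L2_inner_eq (f g : L2 Ω) : inner ℝ f g = ∫ x in Ω, f x * g x := by
  rw [L2.inner_def]
  refine integral_congr_ae (Filter.Eventually.of_forall fun x => ?_)
  simp [mul_comm]

lemma integrable_mul_L2 (f g : L2 Ω) : IntegrableOn (fun x => f x * g x) Ω :=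
  (Lp.memLp f).integrable_mul (Lp.memLp g)

lemma sum_smul_single (v : Plane) : ∑ j, v j • (EuclideanSpace.single j (1 : ℝ)) = v := by
  apply plane_ext <;> simp [Fin.sum_univ_two]

lemma map_plane_eq_sum (L : Plane →L[ℝ] ℝ) (v : Plane) :
    L v = ∑ j, L (EuclideanSpace.single j 1) * v j := by
  conv_lhs => rw [← sum_smul_single v, map_sum]
  exact Finset.sum_congr rfl fun j _ => by rw [map_smul, smul_eq_mul, mul_comm]

/-- Functions of `H₀¹(Ω)` can be integrated by parts against all smooth functions of compact
support in the plane, no matter whether they vanish near the boundary of `Ω`: the extension by zero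
of such a function is weakly differentiable in the plane. -/
lemma integral_by_parts {U : L2 Ω × (Fin 2 → L2 Ω)} (hU : U ∈ H10 Ω) {ψ : Plane → ℝ}
    (hψ : ContDiff ℝ ∞ ψ) (hψc : HasCompactSupport ψ) (j : Fin 2) :
    (∫ x in Ω, U.1 x * fderiv ℝ ψ x (EuclideanSpace.single j 1)) +
      ∫ x in Ω, U.2 j x * ψ x = 0 := by
  have hd : Continuous fun x => fderiv ℝ ψ x (EuclideanSpace.single j 1) :=
    (hψ.continuous_fderiv (by simp)).clm_apply continuous_const
  have hdc : HasCompactSupport fun x => fderiv ℝ ψ x (EuclideanSpace.single j 1) :=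
    hψc.fderiv_apply (𝕜 := ℝ) _
  have m1 : MemLp (fun x => fderiv ℝ ψ x (EuclideanSpace.single j 1)) 2
      ((volume : Measure Plane).restrict Ω) :=
    (hd.memLp_of_hasCompactSupport hdc).restrict Ω
  have m2 : MemLp ψ 2 ((volume : Measure Plane).restrict Ω) :=
    (hψ.continuous.memLp_of_hasCompactSupport hψc).restrict Ω
  have key : ∀ V : L2 Ω × (Fin 2 → L2 Ω), inner ℝ V.1 m1.toLp + inner ℝ (V.2 j) m2.toLp =
      (∫ x in Ω, V.1 x * fderiv ℝ ψ x (EuclideanSpace.single j 1)) +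
      ∫ x in Ω, V.2 j x * ψ x := by
    intro V
    rw [L2_inner_eq, L2_inner_eq]
    congr 1
    · refine integral_congr_ae ?_
      filter_upwards [m1.coeFn_toLp] with x hx
      rw [hx]
    · refine integral_congr_ae ?_
      filter_upwards [m2.coeFn_toLp] with x hx
      rw [hx]
  rw [← key]
  have hclosed : IsClosed {V : L2 Ω × (Fin 2 → L2 Ω) |
      inner ℝ V.1 m1.toLp + inner ℝ (V.2 j) m2.toLp = 0} :=
    isClosed_eq (by fun_prop) continuous_const
  refine closure_minimal ?_ hclosed hU
  rintro V ⟨φ, hφ, hφc, hφs, hV0, hV1⟩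
  rw [mem_ofPred_eq, key]
  have e1 : ∫ x in Ω, V.1 x * fderiv ℝ ψ x (EuclideanSpace.single j 1) =
      ∫ x, φ x * fderiv ℝ ψ x (EuclideanSpace.single j 1) := by
    refine (integral_congr_ae (g := fun x => φ x * fderiv ℝ ψ x (EuclideanSpace.single j 1))
      ?_).trans (setIntegral_eq_integral_of_forall_compl_eq_zero (s := Ω) ?_)
    · filter_upwards [hV0] with x hx
      rw [hx]
    · intro x hx
      rw [image_eq_zero_of_notMem_tsupport fun h => hx (hφs h), zero_mul]
  have e2 : ∫ x in Ω, V.2 j x * ψ x =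
      ∫ x, fderiv ℝ φ x (EuclideanSpace.single j 1) * ψ x := by
    refine (integral_congr_ae (g := fun x => fderiv ℝ φ x (EuclideanSpace.single j 1) * ψ x)
      ?_).trans (setIntegral_eq_integral_of_forall_compl_eq_zero (s := Ω) ?_)
    · filter_upwards [hV1 j] with x hx
      rw [hx]
    · intro x hx
      have : x ∉ tsupport (fderiv ℝ φ) := fun h => hx (hφs (tsupport_fderiv_subset ℝ h))
      rw [image_eq_zero_of_notMem_tsupport this]
      simp
  have hφd : Continuous fun x => fderiv ℝ φ x (EuclideanSpace.single j 1) :=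
    (hφ.continuous_fderiv (by simp)).clm_apply continuous_const
  rw [e1, e2, integral_mul_fderiv_eq_neg_fderiv_mul_of_integrable, neg_add_cancel]
  · exact (hφd.mul hψ.continuous).integrable_of_hasCompactSupport hψc.mul_left
  · exact (hφ.continuous.mul hd).integrable_of_hasCompactSupport hφc.mul_right
  · exact (hφ.continuous.mul hψ.continuous).integrable_of_hasCompactSupport hφc.mul_right
  · exact fun x _ => hφ.differentiable (by simp) x
  · exact fun x _ => hψ.differentiable (by simp) x

/-- The directional form of `integral_by_parts`. -/
lemma integral_by_parts_dir {U : L2 Ω × (Fin 2 → L2 Ω)} (hU : U ∈ H10 Ω) {ψ : Plane → ℝ}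
    (hψ : ContDiff ℝ ∞ ψ) (hψc : HasCompactSupport ψ) (v : Plane) :
    ∫ x in Ω, (U.1 x * fderiv ℝ ψ x v + (∑ j, U.2 j x * v j) * ψ x) = 0 := by
  have m0 : MemLp ψ 2 ((volume : Measure Plane).restrict Ω) :=
    (hψ.continuous.memLp_of_hasCompactSupport hψc).restrict Ω
  have m1 : ∀ j : Fin 2, MemLp (fun x => fderiv ℝ ψ x (EuclideanSpace.single j 1)) 2
      ((volume : Measure Plane).restrict Ω) := fun j =>
    (((hψ.continuous_fderiv (by simp)).clm_apply
      continuous_const).memLp_of_hasCompactSupport (hψc.fderiv_apply (𝕜 := ℝ) _)).restrict Ω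
  have i1 : ∀ j : Fin 2, Integrable (fun x => U.1 x * fderiv ℝ ψ x (EuclideanSpace.single j 1))
      ((volume : Measure Plane).restrict Ω) := fun j => (Lp.memLp U.1).integrable_mul (m1 j)
  have i2 : ∀ j : Fin 2, Integrable (fun x => U.2 j x * ψ x)
      ((volume : Measure Plane).restrict Ω) := fun j => (Lp.memLp (U.2 j)).integrable_mul m0
  have h : ∀ x, U.1 x * fderiv ℝ ψ x v + (∑ j, U.2 j x * v j) * ψ x =
      ∑ j, (v j * (U.1 x * fderiv ℝ ψ x (EuclideanSpace.single j 1)) +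
        v j * (U.2 j x * ψ x)) := by
    intro x
    rw [map_plane_eq_sum (fderiv ℝ ψ x) v, Finset.mul_sum, Finset.sum_mul,
      ← Finset.sum_add_distrib]
    exact Finset.sum_congr rfl fun j _ => by ring
  simp only [h]
  rw [integral_finsetSum]
  · refine Finset.sum_eq_zero fun j _ => ?_
    rw [integral_add ((i1 j).const_mul _) ((i2 j).const_mul _), integral_const_mul,
      integral_const_mul, ← mul_add, integral_by_parts hU hψ hψc j, mul_zero]
  · intro j _
    exact ((i1 j).const_mul _).add ((i2 j).const_mul _)

/-- Weak derivatives have mean zero. -/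
lemma integral_weakDeriv_eq_zero (hΩ : Bornology.IsBounded Ω) (hΩm : MeasurableSet Ω)
    {U : L2 Ω × (Fin 2 → L2 Ω)}
    (hU : U ∈ H10 Ω) (j : Fin 2) : ∫ x in Ω, U.2 j x = 0 := by
  obtain ⟨R, hR⟩ := hΩ.subset_ball (0 : Plane)
  let f : ContDiffBump (0 : Plane) := ⟨max R 1, max R 1 + 1, by positivity, by simp⟩
  have h1 : ∀ x ∈ Ω, f =ᶠ[nhds x] fun _ => (1 : ℝ) := by
    intro x hx
    refine Filter.eventuallyEq_of_mem (Metric.isOpen_ball.mem_nhds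
      (Metric.ball_subset_ball (le_max_left R 1) (hR hx))) fun y hy => ?_
    exact f.one_of_mem_closedBall (Metric.ball_subset_closedBall hy)
  have h2 := integral_by_parts hU f.contDiff f.hasCompactSupport j
  rw [setIntegral_congr_fun (g := fun _ => (0 : ℝ)) hΩm, integral_zero, zero_add] at h2
  · rw [← h2]
    refine setIntegral_congr_fun hΩm fun x hx => ?_
    rw [(h1 x hx).self_of_nhds, mul_one]
  · intro x hx
    simp only
    rw [(h1 x hx).fderiv_eq]
    simp

/-- Where a function of `H₀¹(Ω)` is a polynomial, its weak gradient is the classical one. -/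
lemma weakDeriv_eq_pderiv {U : L2 Ω × (Fin 2 → L2 Ω)} (hU : U ∈ H10 Ω) {W : Set Plane}
    (hW : IsOpen W) (hWΩ : W ⊆ Ω) {P : MvPolynomial (Fin 2) ℝ}
    (hP : ∀ᵐ x ∂((volume : Measure Plane).restrict W), U.1 x = polyEval P x) (j : Fin 2) :
    ∀ᵐ x ∂((volume : Measure Plane).restrict W),
      U.2 j x = polyEval (MvPolynomial.pderiv j P) x := by
  have hc := continuous_polyEval (MvPolynomial.pderiv j P)
  have hW' : (volume : Measure Plane).restrict W = ((volume : Measure Plane).restrict Ω).restrict W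
    := by rw [Measure.restrict_restrict hW.measurableSet, inter_eq_left.mpr hWΩ]
  have key : ∀ᵐ x ∂((volume : Measure Plane).restrict Ω), x ∈ W →
      U.2 j x - polyEval (MvPolynomial.pderiv j P) x = 0 := by
    refine hW.ae_eq_zero_of_integral_contDiff_smul_eq_zero ?_ fun ψ hψ hψc hψs => ?_
    · exact (((Lp.memLp (U.2 j)).locallyIntegrable (by norm_num)).sub
        hc.locallyIntegrable).locallyIntegrableOn W
    · have h1 := integral_by_parts hU hψ hψc j
      have hd : Continuous fun x => fderiv ℝ ψ x (EuclideanSpace.single j 1) :=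
        (hψ.continuous_fderiv (by simp)).clm_apply continuous_const
      have hdc : HasCompactSupport fun x => fderiv ℝ ψ x (EuclideanSpace.single j 1) :=
        hψc.fderiv_apply (𝕜 := ℝ) _
      have hloc : ∀ f : Plane → ℝ, (∀ x, x ∉ W → f x = 0) → ∫ x in Ω, f x = ∫ x in W, f x := by
        intro f hf
        rw [hW', setIntegral_eq_integral_of_forall_compl_eq_zero hf]
      have hz0 : ∀ x, x ∉ W → ψ x = 0 := fun x hx =>
        image_eq_zero_of_notMem_tsupport fun h => hx (hψs h)
      have hz1 : ∀ x, x ∉ W → fderiv ℝ ψ x (EuclideanSpace.single j 1) = 0 := by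
        intro x hx
        have : x ∉ tsupport (fderiv ℝ ψ) :=
          fun h => hx (hψs (tsupport_fderiv_subset ℝ (f := ψ) h))
        rw [image_eq_zero_of_notMem_tsupport this]
        simp
      have e1 : ∫ x in Ω, U.1 x * fderiv ℝ ψ x (EuclideanSpace.single j 1) =
          ∫ x, polyEval P x * fderiv ℝ ψ x (EuclideanSpace.single j 1) := by
        rw [hloc _ fun x hx => by rw [hz1 x hx, mul_zero],
          ← setIntegral_eq_integral_of_forall_compl_eq_zero (s := W)
            (f := fun x => polyEval P x * fderiv ℝ ψ x (EuclideanSpace.single j 1))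
            fun x hx => by rw [hz1 x hx, mul_zero]]
        refine integral_congr_ae ?_
        filter_upwards [hP] with x hx
        rw [hx]
      have e2 : ∫ x in Ω, polyEval (MvPolynomial.pderiv j P) x * ψ x =
          ∫ x, polyEval (MvPolynomial.pderiv j P) x * ψ x := by
        rw [hloc _ fun x hx => by rw [hz0 x hx, mul_zero],
          setIntegral_eq_integral_of_forall_compl_eq_zero fun x hx => by rw [hz0 x hx, mul_zero]]
      have hfd : ∀ x, fderiv ℝ (polyEval P) x (EuclideanSpace.single j 1) =
          polyEval (MvPolynomial.pderiv j P) x := by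
        intro x
        rw [fderiv_polyEval]
        simp
      have e3 : ∫ x, polyEval P x * fderiv ℝ ψ x (EuclideanSpace.single j 1) =
          -∫ x, fderiv ℝ (polyEval P) x (EuclideanSpace.single j 1) * ψ x := by
        apply integral_mul_fderiv_eq_neg_fderiv_mul_of_integrable
        · simp only [hfd]
          exact (hc.mul hψ.continuous).integrable_of_hasCompactSupport hψc.mul_left
        · exact ((continuous_polyEval P).mul hd).integrable_of_hasCompactSupport hdc.mul_left
        · exact ((continuous_polyEval P).mul
            hψ.continuous).integrable_of_hasCompactSupport hψc.mul_left
        · exact fun x _ => differentiable_polyEval P x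
        · exact fun x _ => hψ.differentiable (by simp) x
      simp only [hfd] at e3
      have i1 : Integrable (fun x => U.2 j x * ψ x) ((volume : Measure Plane).restrict Ω) :=
        (Lp.memLp (U.2 j)).integrable_mul
          ((hψ.continuous.memLp_of_hasCompactSupport (p := 2) hψc).restrict Ω)
      have i2 : Integrable (fun x => polyEval (MvPolynomial.pderiv j P) x * ψ x)
          ((volume : Measure Plane).restrict Ω) :=
        ((hc.mul hψ.continuous).integrable_of_hasCompactSupport hψc.mul_left).restrict
      have e4 : ∫ x in Ω, ψ x • (U.2 j x - polyEval (MvPolynomial.pderiv j P) x) =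
          (∫ x in Ω, U.2 j x * ψ x) - ∫ x in Ω, polyEval (MvPolynomial.pderiv j P) x * ψ x := by
        rw [← integral_sub i1 i2]
        refine integral_congr_ae (Filter.Eventually.of_forall fun x => ?_)
        simp only [smul_eq_mul]
        ring
      rw [e4, e2]
      rw [e1, e3] at h1
      linarith
  rw [hW', ae_restrict_iff' hW.measurableSet]
  filter_upwards [key] with x hx hxW
  exact sub_eq_zero.mp (hx hxW)

/-- `affParam` as a homeomorphism. -/
def affHomeo (z : Plane) {v w : Plane} (h : cross v w ≠ 0) : ℝ × ℝ ≃ₜ Plane where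
  toFun := affParam z v w
  invFun x := (cross (x - z) w / cross v w, cross v (x - z) / cross v w)
  left_inv _ := (affParam_bijective h).1 (affParam_coords h _)
  right_inv x := affParam_coords h x
  continuous_toFun := continuous_affParam z v w
  continuous_invFun :=
    ((continuous_cross (continuous_id.sub continuous_const) continuous_const).div_const _).prodMk
      ((continuous_cross continuous_const (continuous_id.sub continuous_const)).div_const _)

/-- The boundary integral in the divergence theorem for a half plane. -/
lemma setIntegral_halfPlane {x₀ v w : Plane} (h : 0 < cross v w) {F : Plane → ℝ}
    (hF : ContDiff ℝ ∞ F) (hFc : HasCompactSupport F) :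
    ∫ x in {x | 0 < cross v (x - x₀)}, fderiv ℝ F x w =
      -(cross v w * ∫ s : ℝ, F (x₀ + s • v)) := by
  have hpre : affParam x₀ v w ⁻¹' {x | 0 < cross v (x - x₀)} = univ ×ˢ Ioi 0 := by
    ext p
    simp only [mem_preimage, mem_ofPred_eq, cross_left_affParam, mem_prod, mem_univ, true_and,
      mem_Ioi]
    exact mul_pos_iff_of_pos_right h
  have hd : Continuous fun x => fderiv ℝ F x w :=
    (hF.continuous_fderiv (by simp)).clm_apply continuous_const
  have hdc : HasCompactSupport fun x => fderiv ℝ F x w := hFc.fderiv_apply (𝕜 := ℝ) _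
  have hemb : Topology.IsClosedEmbedding (affParam x₀ v w) :=
    (affHomeo x₀ h.ne').isClosedEmbedding
  rw [setIntegral_preimage_affParam h, hpre, Measure.volume_eq_prod, setIntegral_prod]
  · rw [← mul_neg, ← integral_neg, Measure.restrict_univ]
    congr 1
    refine integral_congr_ae (Filter.Eventually.of_forall fun s => ?_)
    have hderiv : ∀ t : ℝ, HasDerivAt (fun t => F (affParam x₀ v w (s, t)))
        (fderiv ℝ F (affParam x₀ v w (s, t)) w) t := by
      intro t
      have h1 : HasDerivAt (fun t : ℝ => affParam x₀ v w (s, t)) w t := by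
        simpa [affParam] using ((hasDerivAt_id t).smul_const w).const_add (x₀ + s • v)
      exact ((hF.differentiable (by simp) _).hasFDerivAt).comp_hasDerivAt t h1
    have hcd : ContDiff ℝ 1 (fun t => F (affParam x₀ v w (s, t))) := by
      refine (hF.of_le (by simp)).comp ?_
      unfold affParam
      fun_prop
    have hcs : HasCompactSupport (fun t => F (affParam x₀ v w (s, t))) := by
      refine (hFc.comp_isClosedEmbedding hemb).comp_isClosedEmbedding
        (⟨isEmbedding_prodMkRight s, ?_⟩ : Topology.IsClosedEmbedding (Prod.mk s : ℝ → ℝ × ℝ))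
      have : range (Prod.mk s : ℝ → ℝ × ℝ) = {s} ×ˢ univ := by
        ext ⟨p, q⟩
        simp [eq_comm]
      rw [this]
      exact isClosed_singleton.prod isClosed_univ
    have := hcs.integral_Ioi_deriv_eq hcd 0
    simp only [(hderiv _).deriv] at this
    simp only [this]
    simp [affParam]
  · refine Integrable.integrableOn ?_
    exact (hd.comp hemb.continuous).integrable_of_hasCompactSupport
      (hdc.comp_isClosedEmbedding hemb)

lemma volume_line {x₀ v w : Plane} (h : 0 < cross v w) :
    volume {x | cross v (x - x₀) = 0} = 0 := by
  have h1 : Measure.map (affParam x₀ v w) volume {x | cross v (x - x₀) = 0} = 0 := by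
    rw [(measurableEmbedding_affParam h.ne').map_apply]
    have hpre : affParam x₀ v w ⁻¹' {x | cross v (x - x₀) = 0} = univ ×ˢ {0} := by
      ext p
      simp [cross_left_affParam, h.ne']
    rw [hpre, Measure.volume_eq_prod, Measure.prod_prod]
    simp
  rw [map_affParam h] at h1
  simpa [h] using h1

lemma setIntegral_halfPlane_neg {x₀ v w : Plane} (h : 0 < cross v w) {F : Plane → ℝ}
    (hF : ContDiff ℝ ∞ F) (hFc : HasCompactSupport F) :
    ∫ x in {x | cross v (x - x₀) < 0}, fderiv ℝ F x w =
      cross v w * ∫ s : ℝ, F (x₀ + s • v) := by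
  have hc : cross (-v) (-w) = cross v w := by
    simp [cross]
  have h1 := setIntegral_halfPlane (x₀ := x₀) (v := -v) (w := -w) (hc ▸ h) hF hFc
  have hs : {x | 0 < cross (-v) (x - x₀)} = {x | cross v (x - x₀) < 0} := by
    ext x
    have : cross (-v) (x - x₀) = -cross v (x - x₀) := by
      simp [cross]
      ring
    simp only [mem_ofPred_eq, this, Left.neg_pos_iff]
  have h2 : ∫ s : ℝ, F (x₀ + s • (-v)) = ∫ s : ℝ, F (x₀ + s • v) := by
    rw [← integral_neg_eq_self (fun s : ℝ => F (x₀ + s • v))]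
    simp
  rw [hs, hc, h2] at h1
  simp only [map_neg, integral_neg, neg_inj] at h1
  exact h1

/-- A function of `H₀¹(Ω)`, extended by zero, that is a polynomial on either side of a line near
one of its points `x₀` has no jump at `x₀`. -/
lemma polyEval_eq_of_sides {U : L2 Ω × (Fin 2 → L2 Ω)} (hU : U ∈ H10 Ω) (hΩ : MeasurableSet Ω)
    {x₀ v w : Plane} (h : 0 < cross v w) {B : Set Plane} (hB : B ∈ nhds x₀)
    {P Q : MvPolynomial (Fin 2) ℝ}
    (hP : ∀ᵐ x ∂(volume : Measure Plane), x ∈ B → 0 < cross v (x - x₀) →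
      Ω.indicator U.1 x = polyEval P x ∧
        ∀ j, Ω.indicator (U.2 j) x = polyEval (MvPolynomial.pderiv j P) x)
    (hQ : ∀ᵐ x ∂(volume : Measure Plane), x ∈ B → cross v (x - x₀) < 0 →
      Ω.indicator U.1 x = polyEval Q x ∧
        ∀ j, Ω.indicator (U.2 j) x = polyEval (MvPolynomial.pderiv j Q) x) :
    polyEval P x₀ = polyEval Q x₀ := by
  -- all test functions supported in `B` annihilate the jump along the line
  have key : ∀ ψ : Plane → ℝ, ContDiff ℝ ∞ ψ → HasCompactSupport ψ → tsupport ψ ⊆ B →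
      ∫ s : ℝ, polyEval (P - Q) (x₀ + s • v) * ψ (x₀ + s • v) = 0 := by
    intro ψ hψ hψc hψB
    have hsm : ∀ R : MvPolynomial (Fin 2) ℝ, ContDiff ℝ ∞ (fun x => polyEval R x * ψ x) :=
      fun R => (contDiff_polyEval R).mul hψ
    have hcs : ∀ R : MvPolynomial (Fin 2) ℝ, HasCompactSupport (fun x => polyEval R x * ψ x) :=
      fun R => hψc.mul_left
    have hfd : ∀ (R : MvPolynomial (Fin 2) ℝ) (x : Plane),
        fderiv ℝ (fun x => polyEval R x * ψ x) x w = polyEval R x * fderiv ℝ ψ x w +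
          (∑ j, polyEval (MvPolynomial.pderiv j R) x * w j) * ψ x := by
      intro R x
      rw [fderiv_fun_mul (differentiable_polyEval R x) (hψ.differentiable (by simp) x), add_apply,
        smul_apply, smul_apply, fderiv_polyEval, smul_eq_mul, smul_eq_mul]
      ring
    have hint : ∀ R : MvPolynomial (Fin 2) ℝ,
        Integrable (fun x => fderiv ℝ (fun x => polyEval R x * ψ x) x w) := fun R =>
      (((hsm R).continuous_fderiv (by simp)).clm_apply
        continuous_const).integrable_of_hasCompactSupport ((hcs R).fderiv_apply (𝕜 := ℝ) _)
    have hpos : MeasurableSet {x : Plane | 0 < cross v (x - x₀)} :=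
      measurableSet_lt measurable_const
        (continuous_cross continuous_const (continuous_id.sub continuous_const)).measurable
    have hneg : MeasurableSet {x : Plane | cross v (x - x₀) < 0} :=
      measurableSet_lt
        (continuous_cross continuous_const (continuous_id.sub continuous_const)).measurable
        measurable_const
    have h0 := integral_by_parts_dir hU hψ hψc w
    rw [← integral_indicator hΩ] at h0
    have hae : Ω.indicator (fun x => U.1 x * fderiv ℝ ψ x w + (∑ j, U.2 j x * w j) * ψ x)
        =ᵐ[volume] fun x =>
        {x : Plane | 0 < cross v (x - x₀)}.indicator
          (fun x => fderiv ℝ (fun x => polyEval P x * ψ x) x w) x +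
        {x : Plane | cross v (x - x₀) < 0}.indicator
          (fun x => fderiv ℝ (fun x => polyEval Q x * ψ x) x w) x := by
      have hline : ∀ᵐ x ∂(volume : Measure Plane), cross v (x - x₀) ≠ 0 := by
        rw [ae_iff]
        simpa using volume_line (x₀ := x₀) h
      filter_upwards [hP, hQ, hline] with x hPx hQx hx
      have hl : Ω.indicator (fun x => U.1 x * fderiv ℝ ψ x w + (∑ j, U.2 j x * w j) * ψ x) x =
          Ω.indicator U.1 x * fderiv ℝ ψ x w + (∑ j, Ω.indicator (U.2 j) x * w j) * ψ x := by
        by_cases hxΩ : x ∈ Ω <;> simp [hxΩ]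
      rw [hl]
      by_cases hxB : x ∈ B
      · rcases lt_or_gt_of_ne hx with hx | hx
        · rw [(hQx hxB hx).1]
          simp only [(hQx hxB hx).2]
          rw [indicator_of_notMem (by simpa using hx.le), indicator_of_mem (by simpa using hx),
            hfd, zero_add]
        · rw [(hPx hxB hx).1]
          simp only [(hPx hxB hx).2]
          rw [indicator_of_notMem (s := {x : Plane | cross v (x - x₀) < 0}) (by simpa using hx.le),
            indicator_of_mem (by simpa using hx), hfd, add_zero]
      · have z0 : ψ x = 0 := image_eq_zero_of_notMem_tsupport fun h => hxB (hψB h)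
        have z1 : fderiv ℝ ψ x = 0 := by
          refine image_eq_zero_of_notMem_tsupport fun h => hxB (hψB ?_)
          exact tsupport_fderiv_subset ℝ (f := ψ) h
        have hz : ∀ (R : MvPolynomial (Fin 2) ℝ) (s : Set Plane),
            s.indicator (fun x => fderiv ℝ (fun x => polyEval R x * ψ x) x w) x = 0 := by
          intro R s
          refine indicator_apply_eq_zero.mpr fun _ => ?_
          rw [hfd, z0, z1]
          simp
        rw [hz, hz, z0, z1]
        simp
    rw [integral_congr_ae hae, integral_add ((hint P).indicator hpos) ((hint Q).indicator hneg),
      integral_indicator hpos, integral_indicator hneg, setIntegral_halfPlane h (hsm P) (hcs P),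
      setIntegral_halfPlane_neg h (hsm Q) (hcs Q), neg_add_eq_zero] at h0
    have h1 := mul_left_cancel₀ h.ne' h0
    have hv : v ≠ 0 := by
      rintro rfl
      simp [cross] at h
    have hline : Topology.IsClosedEmbedding (fun s : ℝ => x₀ + s • v) :=
      (Homeomorph.addLeft x₀).isClosedEmbedding.comp (isClosedEmbedding_smul_left hv)
    have hintl : ∀ R : MvPolynomial (Fin 2) ℝ,
        Integrable (fun s : ℝ => polyEval R (x₀ + s • v) * ψ (x₀ + s • v)) := fun R =>
      ((hsm R).continuous.comp hline.continuous).integrable_of_hasCompactSupport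
        ((hcs R).comp_isClosedEmbedding hline)
    simp only [polyEval_sub, sub_mul]
    rw [integral_sub (hintl P) (hintl Q), h1, sub_self]
  by_contra hne
  set c := polyEval (P - Q) x₀ with hc
  have hc0 : c ≠ 0 := by
    rw [hc, polyEval_sub]
    exact sub_ne_zero.mpr hne
  -- a bump function at `x₀`, supported where the jump has the sign of its value at `x₀`
  have hopen : {x | 0 < c * polyEval (P - Q) x} ∈ nhds x₀ := by
    refine (isOpen_lt continuous_const
      (continuous_const.mul (continuous_polyEval (P - Q)))).mem_nhds ?_
    rw [mem_ofPred_eq, ← hc]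
    exact mul_self_pos.mpr hc0
  obtain ⟨ε, hε, hsub⟩ := Metric.mem_nhds_iff.mp (Filter.inter_mem hB hopen)
  let f : ContDiffBump x₀ := ⟨ε / 4, ε / 2, by positivity, by linarith⟩
  have hts : tsupport f ⊆ Metric.ball x₀ ε := by
    rw [f.tsupport_eq]
    exact Metric.closedBall_subset_ball (by change ε / 2 < ε; linarith)
  have h1 := key f f.contDiff f.hasCompactSupport (hts.trans (hsub.trans inter_subset_left))
  have hv : v ≠ 0 := by
    rintro rfl
    simp [cross] at h
  have hline : Topology.IsClosedEmbedding (fun s : ℝ => x₀ + s • v) :=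
    (Homeomorph.addLeft x₀).isClosedEmbedding.comp (isClosedEmbedding_smul_left hv)
  have h2 : 0 < ∫ s : ℝ, c * (polyEval (P - Q) (x₀ + s • v) * f (x₀ + s • v)) := by
    have hcont : Continuous fun s : ℝ => c * (polyEval (P - Q) (x₀ + s • v) * f (x₀ + s • v)) :=
      continuous_const.mul (((continuous_polyEval (P - Q)).comp hline.continuous).mul
        (f.continuous.comp hline.continuous))
    refine hcont.integral_pos_of_hasCompactSupport_nonneg_nonzero (x := 0) ?_ (fun s => ?_) ?_
    · exact ((f.hasCompactSupport.comp_isClosedEmbedding hline).mul_left).mul_left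
    · by_cases hs : x₀ + s • v ∈ Metric.ball x₀ ε
      · have : 0 < c * polyEval (P - Q) (x₀ + s • v) := (hsub hs).2
        simp only [Pi.zero_apply, ← mul_assoc]
        exact mul_nonneg this.le f.nonneg
      · have : f (x₀ + s • v) = 0 := image_eq_zero_of_notMem_tsupport fun h => hs (hts h)
        simp [this]
    · have : f x₀ = 1 := f.one_of_mem_closedBall (by simpa using f.rIn_pos.le)
      simp only [zero_smul, add_zero, this, mul_one, ← hc]
      exact mul_ne_zero hc0 hc0
  rw [integral_const_mul, h1, mul_zero] at h2
  exact lt_irrefl _ h2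

/-! ### The domain and its triangulation -/

/-- A Lipschitz domain lies on one side of its boundary. -/
lemma interior_closure_eq (hΩ : IsPolygonalLipschitzDomain Ω) : interior (closure Ω) = Ω := by
  refine Subset.antisymm (fun x hx => ?_) (interior_maximal subset_closure hΩ.isOpen)
  by_contra hxΩ
  have hfr : x ∈ frontier Ω := by
    rw [frontier, hΩ.isOpen.interior_eq]
    exact ⟨interior_subset hx, hxΩ⟩
  obtain ⟨φ, L, g, r, hg, hr, hy⟩ := hΩ.lipschitz x hfr
  have hxg : φ x 1 ≤ g (φ x 0) := by
    rw [hy x (Metric.mem_ball_self hr)] at hxΩ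
    exact not_lt.mp hxΩ
  have hcont : Continuous fun t : ℝ => φ.symm (φ x - t • EuclideanSpace.single 1 1) :=
    φ.symm.continuous.comp (by fun_prop)
  have h0 : φ.symm (φ x - (0 : ℝ) • EuclideanSpace.single 1 1) = x := by simp
  have hev : ∀ᶠ t in nhdsWithin (0 : ℝ) (Ioi 0),
      φ.symm (φ x - t • EuclideanSpace.single 1 1) ∈ interior (closure Ω) ∩ Metric.ball x r := by
    refine (hcont.tendsto 0).mono_left nhdsWithin_le_nhds ?_
    rw [h0]
    exact Filter.inter_mem (isOpen_interior.mem_nhds hx) (Metric.ball_mem_nhds x hr)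
  obtain ⟨t, ⟨ht1, ht2⟩, ht⟩ := (hev.and self_mem_nhdsWithin).exists
  set p := φ.symm (φ x - t • EuclideanSpace.single 1 1) with hp
  have hφp : φ p = φ x - t • EuclideanSpace.single 1 1 := by rw [hp, φ.apply_symm_apply]
  have hopen : IsOpen (Metric.ball x r ∩ {y | φ y 1 < g (φ y 0)}) := by
    refine Metric.isOpen_ball.inter (isOpen_lt ?_ (hg.continuous.comp ?_))
    · exact (EuclideanSpace.proj 1 : Plane →L[ℝ] ℝ).continuous.comp φ.continuous
    · exact (EuclideanSpace.proj 0 : Plane →L[ℝ] ℝ).continuous.comp φ.continuous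
  have hpV : p ∈ Metric.ball x r ∩ {y | φ y 1 < g (φ y 0)} := by
    refine ⟨ht2, ?_⟩
    rw [mem_ofPred_eq, hφp]
    simp only [PiLp.sub_apply, PiLp.smul_apply, PiLp.single_apply, smul_eq_mul]
    simp only [if_true, Fin.isValue, zero_ne_one, if_false, mul_zero, sub_zero, mul_one]
    have : 0 < t := ht
    linarith
  obtain ⟨q, ⟨hq1, hq2⟩, hqΩ⟩ := mem_closure_iff.mp (interior_subset ht1) _ hopen hpV
  rw [hy q hq1] at hqΩ
  exact lt_asymm hq2 hqΩ

lemma exists_cross_pos {v : Plane} (hv : v ≠ 0) : ∃ w, 0 < cross v w := by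
  refine ⟨!₂[-v 1, v 0], ?_⟩
  have h : v 0 ≠ 0 ∨ v 1 ≠ 0 := by
    by_contra! h
    exact hv (plane_ext h.1 h.2)
  simp only [cross, Matrix.cons_val_zero, Matrix.cons_val_one]
  rcases h with h | h
  · have := mul_self_pos.mpr h
    nlinarith [mul_self_nonneg (v 1)]
  · have := mul_self_pos.mpr h
    nlinarith [mul_self_nonneg (v 0)]

lemma convex_setOf_cross (v x₀ : Plane) (c : ℝ) : Convex ℝ {x | cross v (x - x₀) = c} := by
  intro x hx y hy α β _ _ hαβ
  simp only [mem_ofPred_eq, cross, PiLp.sub_apply, PiLp.add_apply, PiLp.smul_apply,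
    smul_eq_mul] at hx hy ⊢
  obtain rfl : β = 1 - α := by linarith
  linear_combination α * hx + (1 - α) * hy

lemma volume_convexHull_pair (p q : Plane) : volume (convexHull ℝ {p, q}) = 0 := by
  obtain ⟨v, hv, hq⟩ : ∃ v : Plane, v ≠ 0 ∧ cross v (q - p) = 0 := by
    by_cases h : q = p
    · refine ⟨EuclideanSpace.single 0 1, by simp, ?_⟩
      simp [h, cross]
    · exact ⟨q - p, sub_ne_zero.mpr h, cross_self _⟩
  obtain ⟨w, hw⟩ := exists_cross_pos hv
  refine measure_mono_null (convexHull_min ?_ (convex_setOf_cross v p 0)) (volume_line hw)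
  rintro x (rfl | hx)
  · simp [cross]
  · rw [mem_singleton_iff.mp hx]
    exact hq

namespace Triangulation

variable (T : Triangulation Ω)

lemma volume_tri_inter_tri {K L : Finset Plane} (hK : K ∈ T.cells) (hL : L ∈ T.cells)
    (hne : K ≠ L) : volume (tri K ∩ tri L) = 0 := by
  rw [T.conforming K hK L hL]
  have hsub : ∃ p q : Plane, (K : Set Plane) ∩ L ⊆ {p, q} := by
    have hKL : ¬ K ⊆ L := fun h => hne (Finset.eq_of_subset_of_card_le h
      (by rw [T.card_eq K hK, T.card_eq L hL]))
    obtain ⟨x, hxK, hxL⟩ := Finset.not_subset.mp hKL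
    classical
    have hcard : (K.erase x).card = 2 := by
      rw [Finset.card_erase_of_mem hxK, T.card_eq K hK]
    obtain ⟨p, q, -, hpq⟩ := Finset.card_eq_two.mp hcard
    refine ⟨p, q, fun y hy => ?_⟩
    have : y ∈ K.erase x := Finset.mem_erase.mpr ⟨by rintro rfl; exact hxL hy.2, hy.1⟩
    rw [hpq] at this
    simpa using this
  obtain ⟨p, q, hpq⟩ := hsub
  exact measure_mono_null (convexHull_mono hpq) (volume_convexHull_pair p q)

lemma tri_subset_closure {K : Finset Plane} (hK : K ∈ T.cells) : tri K ⊆ closure Ω := by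
  rw [← T.cover]
  exact subset_biUnion_of_mem (u := fun K => tri K) hK

lemma interior_tri_subset (hΩ : IsPolygonalLipschitzDomain Ω) {K : Finset Plane}
    (hK : K ∈ T.cells) : interior (tri K) ⊆ Ω := by
  rw [← interior_closure_eq hΩ]
  exact interior_mono (T.tri_subset_closure hK)

end Triangulation

namespace IsCcw

variable {K L : Finset Plane} {z y w w' : Plane}

/-- Near an inner point `x` of the edge `[z, y]` the triangle is the half plane on the left. -/
lemma eventually_mem_tri (h : IsCcw K z y w) {s : ℝ} (hs : s ∈ Ioo (0 : ℝ) 1) :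
    ∀ᶠ p in nhds (z + s • (y - z)),
      (p ∈ tri K ↔ 0 ≤ cross (y - z) (p - (z + s • (y - z)))) := by
  have c1 : Continuous fun p : Plane => cross (p - z) (w - z) :=
    continuous_cross (by fun_prop) (by fun_prop)
  have c2 : Continuous fun p : Plane => cross (p - z) (w - z) + cross (y - z) (p - z) :=
    c1.add (continuous_cross (by fun_prop) (by fun_prop))
  have hX := h.pos
  have e1 : cross (z + s • (y - z) - z) (w - z) = s * cross (y - z) (w - z) := by
    simp only [cross, PiLp.sub_apply, PiLp.add_apply, PiLp.smul_apply, smul_eq_mul]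
    ring
  have e2 : cross (y - z) (z + s • (y - z) - z) = 0 := by
    simp only [cross, PiLp.sub_apply, PiLp.add_apply, PiLp.smul_apply, smul_eq_mul]
    ring
  have h1 := c1.tendsto (z + s • (y - z))
  have h2 := c2.tendsto (z + s • (y - z))
  rw [e1] at h1
  rw [e1, e2, add_zero] at h2
  filter_upwards [h1.eventually_const_lt (mul_pos hs.1 hX), h2.eventually_lt_const
    (show s * cross (y - z) (w - z) < cross (y - z) (w - z) by nlinarith [hs.2])] with p hp1 hp2
  have e3 : cross (y - z) (p - (z + s • (y - z))) = cross (y - z) (p - z) := by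
    simp only [cross, PiLp.sub_apply, PiLp.add_apply, PiLp.smul_apply, smul_eq_mul]
    ring
  rw [h.mem_tri, e3]
  exact ⟨fun h => h.2.1, fun h => ⟨hp1.le, h, hp2.le⟩⟩

lemma eventually_mem_tri_right (h : IsCcw K z w y) {s : ℝ} (hs : s ∈ Ioo (0 : ℝ) 1) :
    ∀ᶠ p in nhds (z + s • (y - z)),
      (p ∈ tri K ↔ cross (y - z) (p - (z + s • (y - z))) ≤ 0) := by
  have h1 := h.rotate.rotate.eventually_mem_tri (s := 1 - s)
    ⟨by linarith [hs.2], by linarith [hs.1]⟩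
  have e : y + (1 - s) • (z - y) = z + s • (y - z) := by
    module
  rw [e] at h1
  filter_upwards [h1] with p hp
  rw [hp]
  have : cross (z - y) (p - (z + s • (y - z))) = -cross (y - z) (p - (z + s • (y - z))) := by
    simp only [cross, PiLp.sub_apply]
    ring
  rw [this, Left.nonneg_neg_iff]

lemma eventually_mem_interior_tri (h : IsCcw K z y w) {s : ℝ} (hs : s ∈ Ioo (0 : ℝ) 1) :
    ∀ᶠ p in nhds (z + s • (y - z)),
      0 < cross (y - z) (p - (z + s • (y - z))) → p ∈ interior (tri K) := by
  filter_upwards [(h.eventually_mem_tri hs).eventually_nhds] with p hp hpos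
  rw [mem_interior_iff_mem_nhds]
  have c : Continuous fun p : Plane => cross (y - z) (p - (z + s • (y - z))) :=
    continuous_cross (by fun_prop) (by fun_prop)
  filter_upwards [hp, (c.tendsto p).eventually_const_lt hpos] with q hq1 hq2
  exact hq1.mpr hq2.le

lemma eventually_mem_interior_tri_right (h : IsCcw K z w y) {s : ℝ} (hs : s ∈ Ioo (0 : ℝ) 1) :
    ∀ᶠ p in nhds (z + s • (y - z)),
      cross (y - z) (p - (z + s • (y - z))) < 0 → p ∈ interior (tri K) := by
  filter_upwards [(h.eventually_mem_tri_right hs).eventually_nhds] with p hp hneg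
  rw [mem_interior_iff_mem_nhds]
  have c : Continuous fun p : Plane => cross (y - z) (p - (z + s • (y - z))) :=
    continuous_cross (by fun_prop) (by fun_prop)
  filter_upwards [hp, (c.tendsto p).eventually_lt_const hneg] with q hq1 hq2
  exact hq1.mpr hq2.le

end IsCcw

/-- Either side of a line contains points close to any point of the line. -/
lemma exists_side_mem {x v w : Plane} {p : Plane → Prop}
    (hp : ∀ᶠ q in nhds x, p q) {σ : ℝ} (hσ : 0 < σ * cross v w) :
    ∃ q, p q ∧ 0 < σ * cross v (q - x) := by
  have hc : Continuous fun t : ℝ => x + t • w := by fun_prop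
  have h0 : x + (0 : ℝ) • w = x := by simp
  have hev : ∀ᶠ t in nhdsWithin (0 : ℝ) (Ioi 0), p (x + t • w) := by
    refine (hc.tendsto 0).mono_left nhdsWithin_le_nhds ?_
    rw [h0]
    exact hp
  obtain ⟨t, ht1, ht2⟩ := (hev.and self_mem_nhdsWithin).exists
  refine ⟨_, ht1, ?_⟩
  have e : cross v (x + t • w - x) = t * cross v w := by
    simp only [cross, PiLp.sub_apply, PiLp.add_apply, PiLp.smul_apply, smul_eq_mul]
    ring
  rw [e, mul_left_comm]
  exact mul_pos ht2 hσ

namespace Triangulation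

variable (T : Triangulation Ω)

/-- There is only one triangle on either side of an edge. -/
lemma eq_of_isCcw_left {K L : Finset Plane} (hK : K ∈ T.cells) (hL : L ∈ T.cells)
    {z y w w' : Plane} (h : IsCcw K z y w) (h' : IsCcw L z y w') : K = L := by
  by_contra hne
  have hnull := T.volume_tri_inter_tri hK hL hne
  have hs : (1 / 2 : ℝ) ∈ Ioo (0 : ℝ) 1 := by constructor <;> norm_num
  obtain ⟨q, ⟨hq1, hq2⟩, hq3⟩ := exists_side_mem
    ((h.eventually_mem_interior_tri hs).and (h'.eventually_mem_interior_tri hs)) (σ := 1)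
    (by simpa using h.pos)
  rw [one_mul] at hq3
  have hint : q ∈ interior (tri K ∩ tri L) := by
    rw [interior_inter]
    exact ⟨hq1 hq3, hq2 hq3⟩
  rw [Measure.interior_eq_empty_of_null hnull] at hint
  exact hint

lemma eq_of_isCcw_right {K L : Finset Plane} (hK : K ∈ T.cells) (hL : L ∈ T.cells)
    {z y w w' : Plane} (h : IsCcw K z w y) (h' : IsCcw L z w' y) : K = L :=
  T.eq_of_isCcw_left hK hL h.rotate.rotate h'.rotate.rotate

end Triangulation

lemma IsCcw.mem_of_mem_convexHull {K : Finset Plane} {z y w : Plane} (h : IsCcw K z y w) {s : ℝ}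
    (hs : s ∈ Ioo (0 : ℝ) 1) {S : Set Plane} (hS : S ⊆ K)
    (hx : z + s • (y - z) ∈ convexHull ℝ S) : z ∈ S ∧ y ∈ S := by
  have hX := h.pos
  rw [h.coe_eq] at hS
  constructor
  · by_contra hz
    have hsub : S ⊆ {p | cross (w - y) (p - y) = 0} := by
      intro p hp
      rcases hS hp with rfl | rfl | hpw
      · exact absurd hp hz
      · simp [cross]
      · rw [mem_singleton_iff.mp hpw]
        exact cross_self _
    have h1 := convexHull_min hsub (convex_setOf_cross _ _ _) hx
    have e : cross (w - y) (z + s • (y - z) - y) = (1 - s) * cross (y - z) (w - z) := by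
      simp only [cross, PiLp.sub_apply, PiLp.add_apply, PiLp.smul_apply, smul_eq_mul]
      ring
    rw [mem_ofPred_eq, e] at h1
    have : 0 < (1 - s) * cross (y - z) (w - z) := mul_pos (by linarith [hs.2]) hX
    linarith
  · by_contra hy
    have hsub : S ⊆ {p | cross (w - z) (p - z) = 0} := by
      intro p hp
      rcases hS hp with rfl | rfl | hpw
      · simp [cross]
      · exact absurd hp hy
      · rw [mem_singleton_iff.mp hpw]
        exact cross_self _
    have h1 := convexHull_min hsub (convex_setOf_cross _ _ _) hx
    have e : cross (w - z) (z + s • (y - z) - z) = -(s * cross (y - z) (w - z)) := by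
      simp only [cross, PiLp.sub_apply, PiLp.add_apply, PiLp.smul_apply, smul_eq_mul]
      ring
    rw [mem_ofPred_eq, e] at h1
    have : 0 < s * cross (y - z) (w - z) := mul_pos hs.1 hX
    linarith

lemma Triangulation.mem_of_mem_tri {T : Triangulation Ω} {K M : Finset Plane} (hK : K ∈ T.cells)
    (hM : M ∈ T.cells) {z y w : Plane} (h : IsCcw K z y w) {s : ℝ} (hs : s ∈ Ioo (0 : ℝ) 1)
    (hx : z + s • (y - z) ∈ tri M) : z ∈ M ∧ y ∈ M := by
  have hxK : z + s • (y - z) ∈ tri K := by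
    have := (h.eventually_mem_tri hs).self_of_nhds
    rw [this]
    simp [cross]
  have h1 : z + s • (y - z) ∈ tri K ∩ tri M := ⟨hxK, hx⟩
  rw [T.conforming K hK M hM] at h1
  have := h.mem_of_mem_convexHull hs inter_subset_left h1
  exact ⟨this.1.2, this.2.2⟩

namespace Numbering

variable {T : Triangulation Ω} (e : Numbering T) {z : Plane}

lemma cell_mem (hz : z ∈ T.vertices) {i : ℕ} (hi : i < T.N z) : e.cell z i ∈ T.cells :=
  ((e.bijOn z hz).mapsTo hi).1

lemma isCcw (hz : z ∈ T.vertices) {i : ℕ} (hi : i < T.N z) :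
    IsCcw (e.cell z i) z (e.point z i) (e.point z (i + 1)) :=
  ⟨e.coe_cell z hz i hi, by simpa only [cross] using e.ccw z hz i hi⟩

lemma cell_inj (hz : z ∈ T.vertices) {i j : ℕ} (hi : i < T.N z) (hj : j < T.N z)
    (h : e.cell z i = e.cell z j) : i = j := (e.bijOn z hz).injOn hi hj h

lemma exists_cell_eq (hz : z ∈ T.vertices) {K : Finset Plane} (hK : K ∈ T.cells) (hzK : z ∈ K) :
    ∃ i < T.N z, e.cell z i = K := by
  obtain ⟨i, hi, h⟩ := (e.bijOn z hz).surjOn (show K ∈ T.patch z from ⟨hK, hzK⟩)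
  exact ⟨i, hi, h⟩

include e in
lemma N_pos (hz : z ∈ T.vertices) : 0 < T.N z := by
  obtain ⟨K, hK, hzK⟩ := hz
  obtain ⟨i, hi, -⟩ := e.exists_cell_eq ⟨K, hK, hzK⟩ hK hzK
  omega

/-- If the fan of triangles at `z` does not close up, then `Ω` lies on one side of its first
edge. -/
lemma eventually_notMem_first (hz : z ∈ T.vertices) (hop : e.point z (T.N z) ≠ e.point z 0) {s : ℝ}
    (hs : s ∈ Ioo (0 : ℝ) 1) :
    ∀ᶠ p in nhds (z + s • (e.point z 0 - z)),
      cross (e.point z 0 - z) (p - (z + s • (e.point z 0 - z))) < 0 → p ∉ closure Ω := by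
  have hN := e.N_pos hz
  have h0 := e.isCcw hz hN
  set x := z + s • (e.point z 0 - z) with hxdef
  -- the first triangle is the only one that contains `x`
  have huniq : ∀ M ∈ T.cells, x ∈ tri M → M = e.cell z 0 := by
    intro M hM hxM
    obtain ⟨hzM, hyM⟩ := T.mem_of_mem_tri (e.cell_mem hz hN) hM h0 hs hxM
    obtain ⟨j, hj, rfl⟩ := e.exists_cell_eq hz hM hzM
    have hyM' : e.point z 0 ∈ (e.cell z j : Set Plane) := hyM
    rw [e.coe_cell z hz j hj] at hyM'
    rcases hyM' with h | h | h
    · have := h0.pos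
      rw [h] at this
      simp [cross] at this
    · have h1 := e.isCcw hz hj
      rw [← h] at h1
      exact T.eq_of_isCcw_left hM (e.cell_mem hz hN) h1 h0
    · rw [mem_singleton_iff] at h
      rcases Nat.lt_or_ge (j + 1) (T.N z) with hj1 | hj1
      · have h1 := e.isCcw hz hj1
        rw [← h] at h1
        have := e.cell_inj hz hj1 hN
          (T.eq_of_isCcw_left (e.cell_mem hz hj1) (e.cell_mem hz hN) h1 h0)
        omega
      · have : j + 1 = T.N z := by omega
        rw [this] at h
        exact absurd h.symm hop
  have hother : ∀ᶠ p in nhds x, ∀ M ∈ T.cells, M ≠ e.cell z 0 → p ∉ tri M := by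
    rw [Filter.eventually_all_finset]
    intro M hM
    by_cases hne : M = e.cell z 0
    · exact Filter.Eventually.of_forall fun _ h => absurd hne h
    · filter_upwards [(isCompact_tri M).isClosed.isOpen_compl.mem_nhds
        (show x ∈ (tri M)ᶜ from fun h => hne (huniq M hM h))] with p hp _
      exact hp
  filter_upwards [hother, h0.eventually_mem_tri hs] with p hp1 hp2 hneg hpΩ
  rw [← T.cover] at hpΩ
  obtain ⟨M, hM, hpM⟩ := mem_iUnion₂.mp hpΩ
  by_cases hne : M = e.cell z 0
  · rw [hne, hp2] at hpM
    exact absurd hneg (not_lt.mpr hpM)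
  · exact hp1 M hM hne hpM

/-- The same for the last edge. -/
lemma eventually_notMem_last (hz : z ∈ T.vertices) (hop : e.point z (T.N z) ≠ e.point z 0) {s : ℝ}
    (hs : s ∈ Ioo (0 : ℝ) 1) :
    ∀ᶠ p in nhds (z + s • (e.point z (T.N z) - z)),
      0 < cross (e.point z (T.N z) - z) (p - (z + s • (e.point z (T.N z) - z))) →
        p ∉ closure Ω := by
  have hN := e.N_pos hz
  obtain ⟨n, hn⟩ : ∃ n, T.N z = n + 1 := ⟨T.N z - 1, by omega⟩
  have hnN : n < T.N z := by omega
  have h0 := e.isCcw hz hnN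
  rw [hn] at hop ⊢
  set x := z + s • (e.point z (n + 1) - z) with hxdef
  have huniq : ∀ M ∈ T.cells, x ∈ tri M → M = e.cell z n := by
    intro M hM hxM
    have hx' : x = e.point z (n + 1) + (1 - s) • (z - e.point z (n + 1)) := by
      rw [hxdef]
      module
    rw [hx'] at hxM
    obtain ⟨hyM, hzM⟩ := T.mem_of_mem_tri (e.cell_mem hz hnN) hM h0.rotate.rotate
      (s := 1 - s)
        ⟨by linarith [hs.2], by linarith [hs.1]⟩ hxM
    obtain ⟨j, hj, rfl⟩ := e.exists_cell_eq hz hM hzM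
    have hyM' : e.point z (n + 1) ∈ (e.cell z j : Set Plane) := hyM
    rw [e.coe_cell z hz j hj] at hyM'
    rcases hyM' with h | h | h
    · have := h0.pos
      rw [h] at this
      simp [cross] at this
    · rcases Nat.eq_zero_or_pos j with rfl | hj0
      · exact absurd h hop
      · obtain ⟨i, rfl⟩ : ∃ i, j = i + 1 := ⟨j - 1, by omega⟩
        have hi : i < T.N z := by omega
        have h1 := e.isCcw hz hi
        rw [← h] at h1
        have := e.cell_inj hz hi hnN
          (T.eq_of_isCcw_right (e.cell_mem hz hi) (e.cell_mem hz hnN) h1 h0)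
        omega
    · rw [mem_singleton_iff] at h
      have h1 := e.isCcw hz hj
      rw [← h] at h1
      exact T.eq_of_isCcw_right hM (e.cell_mem hz hnN) h1 h0
  have hother : ∀ᶠ p in nhds x, ∀ M ∈ T.cells, M ≠ e.cell z n → p ∉ tri M := by
    rw [Filter.eventually_all_finset]
    intro M hM
    by_cases hne : M = e.cell z n
    · exact Filter.Eventually.of_forall fun _ h => absurd hne h
    · filter_upwards [(isCompact_tri M).isClosed.isOpen_compl.mem_nhds
        (show x ∈ (tri M)ᶜ from fun h => hne (huniq M hM h))] with p hp _
      exact hp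
  filter_upwards [hother, h0.eventually_mem_tri_right hs] with p hp1 hp2 hpos hpΩ
  rw [← T.cover] at hpΩ
  obtain ⟨M, hM, hpM⟩ := mem_iUnion₂.mp hpΩ
  by_cases hne : M = e.cell z n
  · rw [hne, hp2] at hpM
    exact absurd hpos (not_lt.mpr hpM)
  · exact hp1 M hM hne hpM

lemma notMem_of_open (hΩ : IsPolygonalLipschitzDomain Ω) (hz : z ∈ T.vertices)
    (hop : e.point z (T.N z) ≠ e.point z 0) : z ∉ Ω := by
  intro hzΩ
  have hc : Continuous fun s : ℝ => z + s • (e.point z 0 - z) := by fun_prop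
  have hev : ∀ᶠ s in nhdsWithin (0 : ℝ) (Ioi 0), z + s • (e.point z 0 - z) ∈ Ω := by
    refine (hc.tendsto 0).mono_left nhdsWithin_le_nhds ?_
    simpa using hΩ.isOpen.mem_nhds hzΩ
  obtain ⟨s, hs1, hs2⟩ := (hev.and (Ioo_mem_nhdsGT (zero_lt_one' ℝ))).exists
  have hX := (e.isCcw hz (e.N_pos hz)).pos
  have hneg : cross (e.point z 0 - z) (-(e.point z (0 + 1) - z)) =
      -cross (e.point z 0 - z) (e.point z (0 + 1) - z) := by
    simp only [cross, PiLp.neg_apply]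
    ring
  obtain ⟨q, ⟨hq1, hq2⟩, hq3⟩ := exists_side_mem
    (v := e.point z 0 - z) (w := -(e.point z (0 + 1) - z))
    ((e.eventually_notMem_first hz hop hs2).and (hΩ.isOpen.mem_nhds hs1)) (σ := -1)
    (by rw [hneg]; simpa using hX)
  exact hq1 (by linarith) (subset_closure hq2)

lemma cross_smul_eq (v w p : Plane) : cross v w • p = cross p w • v + cross v p • w := by
  apply plane_ext <;>
  · simp only [cross, PiLp.add_apply, PiLp.smul_apply, smul_eq_mul]
    ring

/-- The cone spanned by two vectors in counterclockwise order. -/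
def cone (v w : Plane) : Set Plane := {p | 0 ≤ cross p w ∧ 0 ≤ cross v p}

lemma isClosed_cone (v w : Plane) : IsClosed (cone v w) :=
  (isClosed_le continuous_const (continuous_cross continuous_id continuous_const)).inter
    (isClosed_le continuous_const (continuous_cross continuous_const continuous_id))

/-- Two adjacent cones cover a neighbourhood of their common ray without its origin. -/
lemma cone_union_mem_nhds {u v w p : Plane} (huv : 0 < cross u v) (hvw : 0 < cross v w)
    (h1 : 0 < cross p w) (h2 : cross v p = 0) : cone u v ∪ cone v w ∈ nhds p := by
  have c1 : Continuous fun q : Plane => cross q w := continuous_cross continuous_id continuous_const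
  have c2 : Continuous fun q : Plane => cross u q := continuous_cross continuous_const continuous_id
  have h3 : 0 < cross u p := by
    have h4 : cross v w * cross u p = cross p w * cross u v := by
      simp only [cross] at h2 ⊢
      linear_combination (u 0 * w 1 - u 1 * w 0) * h2
    have h5 : 0 < cross v w * cross u p := by
      rw [h4]
      exact mul_pos h1 huv
    exact (pos_iff_pos_of_mul_pos h5).mp hvw
  filter_upwards [(c1.tendsto p).eventually_const_lt h1, (c2.tendsto p).eventually_const_lt h3]
    with q hq1 hq2
  rcases le_total 0 (cross v q) with hq | hq
  · exact Or.inr ⟨hq1.le, hq⟩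
  · refine Or.inl ⟨?_, hq2.le⟩
    rw [cross_swap]
    linarith

lemma cone_union_mem_nhds' {u v w p : Plane} (huv : 0 < cross u v) (hvw : 0 < cross v w)
    (h1 : 0 < cross u p) (h2 : cross p v = 0) : cone u v ∪ cone v w ∈ nhds p := by
  refine cone_union_mem_nhds huv hvw ?_ (by rw [cross_swap, h2, neg_zero])
  have h4 : cross u v * cross p w = cross u p * cross v w := by
    simp only [cross] at h2 ⊢
    linear_combination (u 0 * w 1 - u 1 * w 0) * h2
  have h5 : 0 < cross u v * cross p w := by
    rw [h4]
    exact mul_pos h1 hvw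
  exact (pos_iff_pos_of_mul_pos h5).mp huv

/-- A fan of triangles that closes up surrounds its center: the union of the cones is closed
and open in the punctured plane, which is connected. -/
lemma mem_of_closed (hΩ : IsPolygonalLipschitzDomain Ω) (hz : z ∈ T.vertices)
    (hcl : e.point z (T.N z) = e.point z 0) : z ∈ Ω := by
  have hN := e.N_pos hz
  set c : ℕ → Set Plane := fun i => cone (e.point z i - z) (e.point z (i + 1) - z) with hc
  set C : Set Plane := ⋃ i ∈ Finset.range (T.N z), c i with hC
  have hX : ∀ i < T.N z, 0 < cross (e.point z i - z) (e.point z (i + 1) - z) :=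
    fun i hi => (e.isCcw hz hi).pos
  have hCcl : IsClosed C :=
    (Finset.range (T.N z)).finite_toSet.isClosed_biUnion fun i _ => isClosed_cone _ _
  have hsub : ∀ i < T.N z, c i ⊆ C := fun i hi =>
    subset_biUnion_of_mem (u := fun i => c i) (Finset.mem_range.mpr hi)
  have hpair : ∀ i j, i < T.N z → j < T.N z → ∀ p, c i ∪ c j ∈ nhds p → p ∈ interior C := by
    intro i j hi hj p hp
    rw [mem_interior_iff_mem_nhds]
    exact Filter.mem_of_superset hp (union_subset (hsub i hi) (hsub j hj))
  have hopen : ∀ p ∈ C, p ≠ 0 → p ∈ interior C := by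
    intro p hp hp0
    obtain ⟨i, hi, hpi⟩ := mem_iUnion₂.mp hp
    rw [Finset.mem_range] at hi
    obtain ⟨hS, hT⟩ := hpi
    rcases hT.eq_or_lt with hT0 | hT0
    · have hS0 : 0 < cross p (e.point z (i + 1) - z) := by
        refine lt_of_le_of_ne hS fun hS0 => hp0 ?_
        have := cross_smul_eq (e.point z i - z) (e.point z (i + 1) - z) p
        rw [← hS0, ← hT0, zero_smul, zero_smul, add_zero] at this
        exact (smul_eq_zero.mp this).resolve_left (hX i hi).ne'
      rcases Nat.eq_zero_or_pos i with rfl | hi0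
      · refine hpair (T.N z - 1) 0 (by omega) hN p ?_
        have h1 := hX (T.N z - 1) (by omega)
        have h2 : T.N z - 1 + 1 = T.N z := by omega
        simp only [hc, h2, hcl] at h1 ⊢
        exact cone_union_mem_nhds h1 (hX 0 hN) hS0 hT0.symm
      · obtain ⟨j, rfl⟩ : ∃ j, i = j + 1 := ⟨i - 1, by omega⟩
        exact hpair j (j + 1) (by omega) hi p
          (cone_union_mem_nhds (hX j (by omega)) (hX _ hi) hS0 hT0.symm)
    · rcases hS.eq_or_lt with hS0 | hS0
      · rcases Nat.lt_or_ge (i + 1) (T.N z) with hi1 | hi1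
        · exact hpair i (i + 1) hi hi1 p
            (cone_union_mem_nhds' (hX i hi) (hX _ hi1) hT0 hS0.symm)
        · refine hpair i 0 hi hN p ?_
          have h2 : i + 1 = T.N z := by omega
          have h1 := hX i hi
          simp only [hc, h2, hcl] at h1 hS0 ⊢
          exact cone_union_mem_nhds' h1 (hX 0 hN) hT0 hS0.symm
      · rw [mem_interior_iff_mem_nhds]
        refine Filter.mem_of_superset ?_ (hsub i hi)
        have c1 : Continuous fun q : Plane => cross q (e.point z (i + 1) - z) :=
          continuous_cross continuous_id continuous_const
        have c2 : Continuous fun q : Plane => cross (e.point z i - z) q :=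
          continuous_cross continuous_const continuous_id
        filter_upwards [(c1.tendsto p).eventually_const_lt hS0,
          (c2.tendsto p).eventually_const_lt hT0] with q hq1 hq2
        exact ⟨hq1.le, hq2.le⟩
  have hall : ∀ p : Plane, p ≠ 0 → p ∈ C := by
    have hconn : IsPreconnected ({0}ᶜ : Set Plane) := by
      refine (isConnected_compl_singleton_of_one_lt_rank ?_ 0).isPreconnected
      rw [← Module.finrank_eq_rank, finrank_euclideanSpace_fin]
      norm_num
    by_contra! hex
    obtain ⟨p, hp0, hpC⟩ := hex
    have ha : e.point z 0 - z ≠ 0 := by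
      intro h
      have := hX 0 hN
      rw [h] at this
      simp [cross] at this
    have haC : e.point z 0 - z ∈ C := by
      refine hsub 0 hN ⟨(hX 0 hN).le, ?_⟩
      rw [cross_self]
    obtain ⟨q, -, hq1, hq2⟩ := hconn (interior C) Cᶜ isOpen_interior hCcl.isOpen_compl
      (fun q hq => by
        by_cases hqC : q ∈ C
        · exact Or.inl (hopen q hqC hq)
        · exact Or.inr hqC)
      ⟨_, ha, hopen _ haC ha⟩ ⟨p, hp0, hpC⟩
    exact hq2 (interior_subset hq1)
  rw [← interior_closure_eq hΩ, mem_interior_iff_mem_nhds]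
  have hev : ∀ᶠ p in nhds z, ∀ i ∈ Finset.range (T.N z),
      cross (p - z) (e.point z (i + 1) - z) + cross (e.point z i - z) (p - z) ≤
        cross (e.point z i - z) (e.point z (i + 1) - z) := by
    rw [Filter.eventually_all_finset]
    intro i hi
    have hcont : Continuous fun p : Plane =>
        cross (p - z) (e.point z (i + 1) - z) + cross (e.point z i - z) (p - z) :=
      (continuous_cross (by fun_prop) (by fun_prop)).add
        (continuous_cross (by fun_prop) (by fun_prop))
    have h0 := hcont.tendsto z
    have : cross (z - z) (e.point z (i + 1) - z) + cross (e.point z i - z) (z - z) = 0 := by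
      simp [cross]
    rw [this] at h0
    filter_upwards [h0.eventually_lt_const (hX i (Finset.mem_range.mp hi))] with p hp
    exact hp.le
  filter_upwards [hev] with p hp
  by_cases hpz : p = z
  · rw [hpz]
    refine T.tri_subset_closure (e.cell_mem hz hN) ?_
    rw [(e.isCcw hz hN).mem_tri]
    simpa [cross] using (e.isCcw hz hN).pos.le
  · obtain ⟨i, hi, hpi⟩ := mem_iUnion₂.mp (hall (p - z) (sub_ne_zero.mpr hpz))
    have hi' := Finset.mem_range.mp hi
    refine T.tri_subset_closure (e.cell_mem hz hi') ?_
    rw [(e.isCcw hz hi').mem_tri]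
    exact ⟨hpi.1, hpi.2, hp i hi⟩

end Numbering

/-! ### Bounds from shape regularity -/

/-- A lower bound for the sines of the angles of triangles with `h_K / ρ_K ≤ γ`. -/
def sinBound (γ : ℝ) : ℝ := 1 / (4 * (γ ^ 2 + 1))

lemma sinBound_pos (γ : ℝ) : 0 < sinBound γ := by
  unfold sinBound
  positivity

lemma plane_norm_sq (v : Plane) : ‖v‖ ^ 2 = v 0 ^ 2 + v 1 ^ 2 := by
  rw [EuclideanSpace.norm_sq_eq]
  simp [Fin.sum_univ_two]

lemma plane_inner (v w : Plane) : inner ℝ v w = v 0 * w 0 + v 1 * w 1 := by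
  simp [PiLp.inner_apply, Fin.sum_univ_two, mul_comm]

lemma closedBall_subset_volume_le {K : Finset Plane} {c : Plane} {r : ℝ} (hr : 0 ≤ r)
    (h : Metric.closedBall c r ⊆ tri K) : Real.pi * r ^ 2 ≤ volume.real (tri K) := by
  have h1 : volume.real (Metric.closedBall c r) ≤ volume.real (tri K) :=
    measureReal_mono h (isCompact_tri K).measure_lt_top.ne
  rw [measureReal_def, EuclideanSpace.volume_closedBall_fin_two] at h1
  simp only [ENNReal.toReal_mul, ENNReal.toReal_pow, ENNReal.toReal_ofReal hr,
    ENNReal.toReal_ofReal Real.pi_pos.le] at h1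
  linarith

namespace IsCcw

variable {K : Finset Plane} {z y w : Plane}

lemma ne_left (h : IsCcw K z y w) : y ≠ z := by
  rintro rfl
  have := h.pos
  simp [cross] at this

lemma norm_sub_le_hK (h : IsCcw K z y w) : ‖y - z‖ ≤ hK K := by
  rw [← dist_eq_norm]
  refine Metric.dist_le_diam_of_mem (isCompact_tri K).isBounded ?_ ?_
  · refine subset_convexHull ℝ _ ?_
    rw [h.coe_eq]
    simp
  · refine subset_convexHull ℝ _ ?_
    rw [h.coe_eq]
    simp

end IsCcw

/-- The area of a triangle is at least that of its inscribed disc. -/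
lemma Triangulation.sinBound_mul_le {T : Triangulation Ω} {γ : ℝ} (hγ : T.shapeRegularity ≤ γ)
    {K : Finset Plane} (hK : K ∈ T.cells) {z y w : Plane} (h : IsCcw K z y w) :
    sinBound γ * (‖y - z‖ * ‖w - z‖) ≤ cross (y - z) (w - z) := by
  have hratio : Stokes.hK K / rhoK K ≤ γ := by
    refine le_trans ?_ hγ
    exact le_ciSup (f := fun K : {K // K ∈ T.cells} => Stokes.hK K.1 / rhoK K.1)
      (Set.finite_range _).bddAbove ⟨K, hK⟩
  have hd1 := h.norm_sub_le_hK
  have hd2 : ‖w - z‖ ≤ Stokes.hK K := by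
    rw [norm_sub_rev]
    exact h.rotate.rotate.norm_sub_le_hK
  have hpos : 0 < ‖y - z‖ := norm_pos_iff.mpr (sub_ne_zero.mpr h.ne_left)
  have hh : 0 < Stokes.hK K := hpos.trans_le hd1
  have hvol := h.volume_real_tri
  set S := {d : ℝ | 0 ≤ d ∧ ∃ c : Plane, Metric.closedBall c (d / 2) ⊆ tri K} with hS
  have harea : ∀ d ∈ S, Real.pi * (d / 2) ^ 2 ≤ volume.real (tri K) := by
    rintro d ⟨hd, c, hc⟩
    exact closedBall_subset_volume_le (by positivity) hc
  have hpi := Real.pi_gt_three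
  have hbdd : BddAbove S := by
    refine ⟨volume.real (tri K) + 1, fun d hd => ?_⟩
    have h1 := harea d hd
    nlinarith [sq_nonneg (d - 2), hd.1, sq_nonneg d]
  have hrho : 0 < rhoK K := by
    obtain ⟨c, hc⟩ := h.interior_nonempty
    rw [mem_interior_iff_mem_nhds, Metric.mem_nhds_iff] at hc
    obtain ⟨ε, hε, hball⟩ := hc
    refine lt_of_lt_of_le hε (le_csSup hbdd ⟨hε.le, c, ?_⟩)
    exact (Metric.closedBall_subset_ball (by linarith)).trans hball
  have hle : Stokes.hK K ≤ γ * rhoK K := (div_le_iff₀ hrho).mp hratio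
  have hγ0 : 0 < γ := lt_of_lt_of_le (div_pos hh hrho) hratio
  have hne : S.Nonempty := by
    by_contra hne
    rw [not_nonempty_iff_eq_empty] at hne
    have : rhoK K = sSup S := rfl
    rw [this, hne, Real.sSup_empty] at hrho
    exact lt_irrefl _ hrho
  obtain ⟨d, hdS, hd⟩ := exists_lt_of_lt_csSup hne
    (show rhoK K / 2 < sSup S from half_lt_self hrho)
  have h1 := harea d hdS
  rw [hvol] at h1
  have h2 : Stokes.hK K ≤ γ * (2 * d) := hle.trans (by nlinarith)
  have h3 : ‖y - z‖ * ‖w - z‖ ≤ (γ * (2 * d)) * (γ * (2 * d)) :=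
    mul_le_mul (hd1.trans h2) (hd2.trans h2) (norm_nonneg _) (hh.le.trans h2)
  rw [sinBound, div_mul_eq_mul_div, one_mul, div_le_iff₀ (by positivity)]
  nlinarith [mul_nonneg (sq_nonneg γ) (sq_nonneg d), sq_nonneg d, h.pos]

lemma mem_convexHull_triple_of_le {z a b : Plane} {α β : ℝ} (hα0 : 0 ≤ α) (hα : α ≤ 1)
    (hβ0 : 0 ≤ β) (hβ : β ≤ 1) :
    convexHull ℝ {z, z + α • a, z + β • b} ⊆ convexHull ℝ {z, z + a, z + b} := by
  refine convexHull_min ?_ (convex_convexHull ℝ _)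
  have hz : z ∈ convexHull ℝ ({z, z + a, z + b} : Set Plane) := subset_convexHull ℝ _ (by simp)
  have ha : z + a ∈ convexHull ℝ ({z, z + a, z + b} : Set Plane) :=
    subset_convexHull ℝ _ (by simp)
  have hb : z + b ∈ convexHull ℝ ({z, z + a, z + b} : Set Plane) :=
    subset_convexHull ℝ _ (by simp)
  have hc := convex_convexHull ℝ ({z, z + a, z + b} : Set Plane)
  rintro x (rfl | rfl | hx)
  · exact hz
  · have := hc hz ha (sub_nonneg.mpr hα) hα0 (by ring)
    convert this using 1
    module
  · rw [mem_singleton_iff.mp hx]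
    have := hc hz hb (sub_nonneg.mpr hβ) hβ0 (by ring)
    convert this using 1
    module

namespace Numbering

variable {T : Triangulation Ω} (e : Numbering T) {z : Plane}

/-- The edge vectors at the vertex `z`. -/
def edge (z : Plane) (i : ℕ) : Plane := e.point z i - z

lemma cross_edge_pos (hz : z ∈ T.vertices) {i : ℕ} (hi : i < T.N z) :
    0 < cross (e.edge z i) (e.edge z (i + 1)) := (e.isCcw hz hi).pos

lemma edge_norm_pos (hz : z ∈ T.vertices) {i : ℕ} (hi : i ≤ T.N z) : 0 < ‖e.edge z i‖ := by
  rw [norm_pos_iff]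
  intro h
  rcases hi.lt_or_eq with hi | hi
  · have := e.cross_edge_pos hz hi
    rw [h] at this
    simp [cross] at this
  · have hN := e.N_pos hz
    have := e.cross_edge_pos hz (show i - 1 < T.N z by omega)
    rw [show i - 1 + 1 = i by omega, h] at this
    simp [cross] at this

include e in
/-- The number of triangles at a vertex is bounded in terms of the shape regularity: equally small
copies of them at the vertex are disjoint sectors of a disc. -/
lemma N_mul_sinBound_le {γ : ℝ} (hγ : T.shapeRegularity ≤ γ) (hz : z ∈ T.vertices) :
    (T.N z : ℝ) * sinBound γ ≤ 2 * Real.pi := by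
  classical
  have hN := e.N_pos hz
  obtain ⟨m, hm, hmin⟩ := Finset.exists_min_image (Finset.range (T.N z + 1))
    (fun i => ‖e.edge z i‖) ⟨0, by simp⟩
  set ε := ‖e.edge z m‖ with hε
  have hε0 : 0 < ε := e.edge_norm_pos hz (Nat.lt_succ_iff.mp (Finset.mem_range.mp hm))
  have hεle : ∀ i ≤ T.N z, ε ≤ ‖e.edge z i‖ := fun i hi =>
    hmin i (Finset.mem_range.mpr (by omega))
  set v : ℕ → Plane := fun i => (ε / ‖e.edge z i‖) • e.edge z i with hv
  set S : ℕ → Finset Plane := fun i => {z, z + v i, z + v (i + 1)} with hS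
  have hfac : ∀ i ≤ T.N z, 0 < ε / ‖e.edge z i‖ ∧ ε / ‖e.edge z i‖ ≤ 1 := fun i hi =>
    ⟨div_pos hε0 (e.edge_norm_pos hz hi), (div_le_one (e.edge_norm_pos hz hi)).mpr (hεle i hi)⟩
  have hcross : ∀ i < T.N z, ε ^ 2 * sinBound γ ≤ cross (v i) (v (i + 1)) := by
    intro i hi
    have h1 := T.sinBound_mul_le hγ (e.cell_mem hz hi) (e.isCcw hz hi)
    have h2 : cross (v i) (v (i + 1)) = ε ^ 2 * (cross (e.edge z i) (e.edge z (i + 1)) /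
        (‖e.edge z i‖ * ‖e.edge z (i + 1)‖)) := by
      simp only [hv, cross, PiLp.smul_apply, smul_eq_mul]
      ring
    rw [h2]
    refine mul_le_mul_of_nonneg_left ?_ (sq_nonneg ε)
    rw [le_div_iff₀ (mul_pos (e.edge_norm_pos hz hi.le) (e.edge_norm_pos hz hi))]
    exact h1
  have hccw : ∀ i < T.N z, IsCcw (S i) z (z + v i) (z + v (i + 1)) := by
    intro i hi
    refine ⟨by simp [hS], ?_⟩
    rw [add_sub_cancel_left, add_sub_cancel_left]
    exact lt_of_lt_of_le (by have := sinBound_pos γ; positivity) (hcross i hi)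
  have hsub : ∀ i < T.N z, tri (S i) ⊆ tri (e.cell z i) := by
    intro i hi
    rw [tri, (hccw i hi).coe_eq, tri, (e.isCcw hz hi).coe_eq]
    have := mem_convexHull_triple_of_le (z := z) (a := e.edge z i) (b := e.edge z (i + 1))
      (hfac i hi.le).1.le (hfac i hi.le).2 (hfac (i + 1) hi).1.le (hfac (i + 1) hi).2
    rw [show z + e.edge z i = e.point z i from add_sub_cancel _ _,
      show z + e.edge z (i + 1) = e.point z (i + 1) from add_sub_cancel _ _] at this
    exact this
  have hball : ∀ i < T.N z, tri (S i) ⊆ Metric.closedBall z ε := by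
    intro i hi
    rw [tri, (hccw i hi).coe_eq]
    have hnv : ∀ j ≤ T.N z, z + v j ∈ Metric.closedBall z ε := by
      intro j hj
      rw [mem_closedBall_iff_norm, add_sub_cancel_left, hv, norm_smul,
        Real.norm_of_nonneg (hfac j hj).1.le, div_mul_cancel₀ _ (e.edge_norm_pos hz hj).ne']
    refine convexHull_min ?_ (convex_closedBall z ε)
    rintro x (rfl | rfl | hx)
    · exact Metric.mem_closedBall_self hε0.le
    · exact hnv i hi.le
    · rw [mem_singleton_iff.mp hx]
      exact hnv (i + 1) hi
  have hdisj : Set.Pairwise (↑(Finset.range (T.N z)))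
      (Function.onFun (AEDisjoint volume) fun i => tri (S i)) := by
    intro i hi j hj hij
    have hi' : i < T.N z := by simpa using hi
    have hj' : j < T.N z := by simpa using hj
    exact measure_mono_null (inter_subset_inter (hsub i hi') (hsub j hj'))
      (T.volume_tri_inter_tri (e.cell_mem hz hi') (e.cell_mem hz hj')
        fun h => hij (e.cell_inj hz hi' hj' h))
  have hsum := measure_biUnion_finset₀ hdisj
    fun i _ => (measurableSet_tri (S i)).nullMeasurableSet
  have hle : volume (⋃ i ∈ Finset.range (T.N z), tri (S i)) ≤
      volume (Metric.closedBall z ε) :=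
    measure_mono (iUnion₂_subset fun i hi => hball i (Finset.mem_range.mp hi))
  rw [hsum] at hle
  have h1 := ENNReal.toReal_mono measure_closedBall_lt_top.ne hle
  rw [ENNReal.toReal_sum fun i _ => (isCompact_tri _).measure_lt_top.ne,
    EuclideanSpace.volume_closedBall_fin_two] at h1
  simp only [ENNReal.toReal_mul, ENNReal.toReal_pow, ENNReal.toReal_ofReal hε0.le,
    ENNReal.toReal_ofReal Real.pi_pos.le] at h1
  have h2 : ∑ i ∈ Finset.range (T.N z), ε ^ 2 * sinBound γ / 2 ≤
      ∑ i ∈ Finset.range (T.N z), (volume (tri (S i))).toReal := by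
    refine Finset.sum_le_sum fun i hi => ?_
    have hi' := Finset.mem_range.mp hi
    have := (hccw i hi').volume_real_tri
    rw [measureReal_def, add_sub_cancel_left, add_sub_cancel_left] at this
    rw [this]
    linarith [hcross i hi']
  rw [Finset.sum_const, Finset.card_range, nsmul_eq_mul] at h2
  have h3 := h2.trans h1
  have h4 : 0 < ε ^ 2 := by positivity
  nlinarith

/-! ### The angles at a vertex -/

lemma cos_angle_mul (z : Plane) (i : ℕ) :
    Real.cos (e.angle z i) * (‖e.edge z i‖ * ‖e.edge z (i + 1)‖) =
      inner ℝ (e.edge z i) (e.edge z (i + 1)) :=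
  InnerProductGeometry.cos_angle_mul_norm_mul_norm _ _

lemma sin_angle_mul (hz : z ∈ T.vertices) {i : ℕ} (hi : i < T.N z) :
    Real.sin (e.angle z i) * (‖e.edge z i‖ * ‖e.edge z (i + 1)‖) =
      cross (e.edge z i) (e.edge z (i + 1)) := by
  have h := InnerProductGeometry.sin_angle_mul_norm_mul_norm (e.edge z i) (e.edge z (i + 1))
  refine Eq.trans h ?_
  rw [Real.sqrt_eq_iff_mul_self_eq_of_pos (e.cross_edge_pos hz hi), plane_inner, plane_inner,
    plane_inner, cross]
  ring

lemma sinBound_le_sin {γ : ℝ} (hγ : T.shapeRegularity ≤ γ) (hz : z ∈ T.vertices) {i : ℕ}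
    (hi : i < T.N z) : sinBound γ ≤ Real.sin (e.angle z i) := by
  have h1 := T.sinBound_mul_le hγ (e.cell_mem hz hi) (e.isCcw hz hi)
  have h2 := e.sin_angle_mul hz hi
  have h3 : 0 < ‖e.edge z i‖ * ‖e.edge z (i + 1)‖ :=
    mul_pos (e.edge_norm_pos hz hi.le) (e.edge_norm_pos hz hi)
  refine le_of_mul_le_mul_right ?_ h3
  rw [h2]
  exact h1

lemma rotation_coords {v w : Plane} {c s : ℝ} (hv : 0 < ‖v‖) (hw : 0 < ‖w‖)
    (hc : c * (‖v‖ * ‖w‖) = v 0 * w 0 + v 1 * w 1) (hs : s * (‖v‖ * ‖w‖) = cross v w) :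
    w 0 / ‖w‖ = c * (v 0 / ‖v‖) - s * (v 1 / ‖v‖) ∧
      w 1 / ‖w‖ = c * (v 1 / ‖v‖) + s * (v 0 / ‖v‖) := by
  have hsq := plane_norm_sq v
  rw [cross] at hs
  obtain rfl : c = (v 0 * w 0 + v 1 * w 1) / (‖v‖ * ‖w‖) := by
    rw [eq_div_iff (by positivity), hc]
  obtain rfl : s = (v 0 * w 1 - v 1 * w 0) / (‖v‖ * ‖w‖) := by
    rw [eq_div_iff (by positivity), hs]
  constructor
  · field_simp
    linear_combination (w 0) * hsq
  · field_simp
    linear_combination (w 1) * hsq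

/-- The unit edge vectors as complex numbers. -/
def unitEdge (z : Plane) (i : ℕ) : ℂ :=
  ⟨e.edge z i 0 / ‖e.edge z i‖, e.edge z i 1 / ‖e.edge z i‖⟩

lemma unitEdge_succ (hz : z ∈ T.vertices) {i : ℕ} (hi : i < T.N z) :
    e.unitEdge z (i + 1) = Complex.exp (e.angle z i * Complex.I) * e.unitEdge z i := by
  obtain ⟨h1, h2⟩ := rotation_coords (e.edge_norm_pos hz hi.le)
    (e.edge_norm_pos hz (show i + 1 ≤ T.N z from hi))
    ((e.cos_angle_mul z i).trans (plane_inner _ _)) (e.sin_angle_mul hz hi)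
  rw [Complex.exp_mul_I]
  apply Complex.ext
  · simpa only [unitEdge, Complex.mul_re, Complex.add_re, Complex.add_im, Complex.mul_im,
      Complex.I_re, Complex.I_im, Complex.cos_ofReal_re, Complex.sin_ofReal_re,
      Complex.cos_ofReal_im, Complex.sin_ofReal_im, mul_zero, mul_one, zero_mul, sub_zero,
      add_zero, zero_add, sub_self] using h1
  · simpa only [unitEdge, Complex.mul_re, Complex.add_re, Complex.add_im, Complex.mul_im,
      Complex.I_re, Complex.I_im, Complex.cos_ofReal_re, Complex.sin_ofReal_re,
      Complex.cos_ofReal_im, Complex.sin_ofReal_im, mul_zero, mul_one, zero_mul, sub_zero,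
      add_zero, zero_add, sub_self] using h2

lemma prod_exp_angle (hz : z ∈ T.vertices) (hcl : e.point z (T.N z) = e.point z 0) :
    ∏ i ∈ Finset.range (T.N z), Complex.exp (e.angle z i * Complex.I) = 1 := by
  have h : ∀ n ≤ T.N z, e.unitEdge z n =
      (∏ i ∈ Finset.range n, Complex.exp (e.angle z i * Complex.I)) * e.unitEdge z 0 := by
    intro n
    induction n with
    | zero => simp
    | succ n ih =>
      intro hn
      rw [e.unitEdge_succ hz hn, ih (by omega), Finset.prod_range_succ]
      ring
  have h1 := h _ le_rfl
  have h0 : e.unitEdge z (T.N z) = e.unitEdge z 0 := by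
    rw [unitEdge, unitEdge, edge, edge, hcl]
  have hne : e.unitEdge z 0 ≠ 0 := by
    intro h2
    have hn := e.edge_norm_pos hz (Nat.zero_le _)
    have hre := congrArg Complex.re h2
    have him := congrArg Complex.im h2
    simp only [unitEdge, Complex.zero_re, Complex.zero_im, div_eq_zero_iff, hn.ne', or_false]
      at hre him
    exact norm_pos_iff.mp hn (plane_ext hre him)
  rw [h0] at h1
  exact (mul_eq_right₀ hne).mp h1.symm

end Numbering

lemma norm_prod_sub_neg_one_pow_le {δ : ℝ} (ξ : ℕ → ℂ) (n : ℕ) (h1 : ∀ i < n, ‖ξ i‖ = 1)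
    (h2 : ∀ i < n, ‖ξ i + 1‖ ≤ δ) :
    ‖∏ i ∈ Finset.range n, ξ i - (-1) ^ n‖ ≤ n * δ := by
  induction n with
  | zero => simp
  | succ n ih =>
    have e : ∏ i ∈ Finset.range (n + 1), ξ i - (-1) ^ (n + 1) =
        (∏ i ∈ Finset.range n, ξ i - (-1) ^ n) * ξ n + (-1) ^ n * (ξ n + 1) := by
      rw [Finset.prod_range_succ]
      ring
    rw [e]
    refine (norm_add_le _ _).trans ?_
    rw [norm_mul, norm_mul, h1 n (by omega), mul_one, norm_pow, norm_neg, norm_one, one_pow,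
      one_mul]
    have := ih (fun i hi => h1 i (by omega)) fun i hi => h2 i (by omega)
    have := h2 n (by omega)
    push_cast
    linarith

/-- If the sum of two angles, neither of which is flat, has a small sine, then it is close to
`π`. -/
lemma norm_exp_add_one_le {s η θ θ' : ℝ} (hs : 0 < s) (hη : 0 ≤ η) (h1 : s ≤ Real.sin θ)
    (h2 : s ≤ Real.sin θ') (h : |Real.sin (θ + θ')| ≤ η) :
    ‖Complex.exp (θ * Complex.I) * Complex.exp (θ' * Complex.I) + 1‖ ≤ η / s := by
  have e1 : Complex.exp (θ * Complex.I) * Complex.exp (θ' * Complex.I) =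
      Complex.exp ((θ + θ' : ℝ) * Complex.I) := by
    rw [← Complex.exp_add]
    push_cast
    ring_nf
  set φ := θ + θ' with hφ
  have hcos : Real.cos φ ≤ 1 - 2 * s ^ 2 := by
    rw [hφ, Real.cos_add]
    nlinarith [Real.sin_sq_add_cos_sq θ, Real.sin_sq_add_cos_sq θ',
      sq_nonneg (Real.cos θ - Real.cos θ'), mul_le_mul h1 h2 hs.le (hs.le.trans h1)]
  have hsin : Real.sin φ ^ 2 ≤ η ^ 2 := by
    rw [← sq_abs]
    exact pow_le_pow_left₀ (abs_nonneg _) h 2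
  have hn : ‖Complex.exp ((φ : ℝ) * Complex.I) + 1‖ ^ 2 = 2 + 2 * Real.cos φ := by
    rw [Complex.sq_norm, Complex.normSq_apply, Complex.exp_mul_I]
    simp only [Complex.mul_re, Complex.add_re, Complex.add_im, Complex.mul_im,
      Complex.I_re, Complex.I_im, Complex.cos_ofReal_re, Complex.sin_ofReal_re,
      Complex.cos_ofReal_im, Complex.sin_ofReal_im, Complex.one_re, Complex.one_im]
    nlinarith [Real.sin_sq_add_cos_sq φ]
  rw [e1]
  refine (pow_le_pow_iff_left₀ (norm_nonneg _) (by positivity) two_ne_zero).mp ?_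
  rw [hn, div_pow, le_div_iff₀ (by positivity)]
  have hge := Real.neg_one_le_cos φ
  nlinarith [Real.sin_sq_add_cos_sq φ, mul_nonneg (show 0 ≤ 1 + Real.cos φ by linarith)
    (show 0 ≤ 1 - 2 * s ^ 2 - Real.cos φ by linarith)]

namespace Numbering

variable {T : Triangulation Ω} (e : Numbering T) {z : Plane}

/-- At a nearly singular interior vertex the number of triangles is even: otherwise the product of
the rotations by the angles `θᵢ + θᵢ₊₁ ≈ π` would be close to `-1`, but it is a full rotation. -/
lemma even_N {γ η : ℝ} (hγ : T.shapeRegularity ≤ γ) (hz : z ∈ T.vertices)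
    (hcl : e.point z (T.N z) = e.point z 0) (hη : 0 ≤ η) (hη' : η < sinBound γ ^ 2 / 4)
    (h : ∀ i < T.N z, |Real.sin (e.angle z i + e.angle z ((i + 1) % T.N z))| ≤ η) :
    Even (T.N z) := by
  have hN := e.N_pos hz
  by_contra hodd
  rw [Nat.not_even_iff_odd] at hodd
  have hs := sinBound_pos γ
  set ζ : ℕ → ℂ := fun i => Complex.exp (e.angle z i * Complex.I) with hζ
  have h1 := norm_prod_sub_neg_one_pow_le (fun i => ζ i * ζ ((i + 1) % T.N z)) (T.N z)
    (δ := η / sinBound γ) (fun i _ => by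
      rw [norm_mul, hζ, Complex.norm_exp_ofReal_mul_I, Complex.norm_exp_ofReal_mul_I, one_mul])
    (fun i hi => norm_exp_add_one_le hs hη (e.sinBound_le_sin hγ hz hi)
      (e.sinBound_le_sin hγ hz (Nat.mod_lt _ hN)) (h i hi))
  have h2 : ∏ i ∈ Finset.range (T.N z), ζ i = 1 := e.prod_exp_angle hz hcl
  have h3 : ∏ i ∈ Finset.range (T.N z), ζ ((i + 1) % T.N z) = 1 := by
    rw [← h2]
    obtain ⟨n, hn⟩ : ∃ n, T.N z = n + 1 := ⟨T.N z - 1, by omega⟩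
    rw [hn, Finset.prod_range_succ, Finset.prod_range_succ', Nat.mod_self]
    congr 1
    refine Finset.prod_congr rfl fun i hi => ?_
    rw [Nat.mod_eq_of_lt (by have := Finset.mem_range.mp hi; omega)]
  rw [Finset.prod_mul_distrib, h2, h3, one_mul, hodd.neg_one_pow] at h1
  have h4 : ‖(1 : ℂ) - -1‖ = 2 := by norm_num
  rw [h4, ← mul_div_assoc, le_div_iff₀ hs] at h1
  have h5 := e.N_mul_sinBound_le hγ hz
  have h6 := Real.pi_lt_four
  have h7 : (0 : ℝ) < T.N z := by exact_mod_cast hN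
  nlinarith [mul_lt_mul_of_pos_left hη' h7]

end Numbering

/-! ### The alternating sum of the divergences at a vertex -/

/-- The product of a matrix and a vector of the plane. -/
def matVec (G : Fin 2 → Fin 2 → ℝ) (v : Plane) : Plane := !₂[∑ j, G 0 j * v j, ∑ j, G 1 j * v j]

lemma matVec_zero (G : Fin 2 → Fin 2 → ℝ) (v : Plane) : matVec G v 0 = ∑ j, G 0 j * v j := rfl

lemma matVec_one (G : Fin 2 → Fin 2 → ℝ) (v : Plane) : matVec G v 1 = ∑ j, G 1 j * v j := rfl

/-- The Frobenius norm. -/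
def gradSize (G : Fin 2 → Fin 2 → ℝ) : ℝ := Real.sqrt (∑ i, ∑ j, G i j ^ 2)

lemma gradSize_nonneg (G : Fin 2 → Fin 2 → ℝ) : 0 ≤ gradSize G := Real.sqrt_nonneg _

lemma gradSize_sq (G : Fin 2 → Fin 2 → ℝ) : gradSize G ^ 2 = ∑ i, ∑ j, G i j ^ 2 :=
  Real.sq_sqrt (by positivity)

/-- The contribution to the alternating sum of the derivative along the edge `v` between the
triangles with the edges `u`, `v` and `v`, `w`. -/
def jumpTerm (G : Fin 2 → Fin 2 → ℝ) (u v w : Plane) : ℝ :=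
  cross (matVec G v) w / cross v w + cross (matVec G v) u / cross u v

/-- The trace of a matrix in terms of its values on two vectors. -/
lemma trace_eq {v w : Plane} (h : cross v w ≠ 0) (G : Fin 2 → Fin 2 → ℝ) :
    G 0 0 + G 1 1 =
      cross (matVec G v) w / cross v w - cross (matVec G w) v / cross v w := by
  rw [← sub_div, eq_div_iff h]
  simp only [cross, matVec_zero, matVec_one, Fin.sum_univ_two]
  ring

lemma abs_cross_matVec_le (G : Fin 2 → Fin 2 → ℝ) (v : Plane) :
    |cross (matVec G v) v| ≤ gradSize G * ‖v‖ ^ 2 := by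
  refine abs_le_of_sq_le_sq ?_ (mul_nonneg (gradSize_nonneg G) (sq_nonneg _))
  rw [mul_pow, gradSize_sq, plane_norm_sq]
  simp only [cross, matVec_zero, matVec_one, Fin.sum_univ_two]
  have h1 : (G 0 0 * v 0 + G 0 1 * v 1) ^ 2 ≤
      (G 0 0 ^ 2 + G 0 1 ^ 2) * (v 0 ^ 2 + v 1 ^ 2) := by
    nlinarith [sq_nonneg (G 0 0 * v 1 - G 0 1 * v 0)]
  have h2 : (G 1 0 * v 0 + G 1 1 * v 1) ^ 2 ≤
      (G 1 0 ^ 2 + G 1 1 ^ 2) * (v 0 ^ 2 + v 1 ^ 2) := by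
    nlinarith [sq_nonneg (G 1 0 * v 1 - G 1 1 * v 0)]
  set p := G 0 0 * v 0 + G 0 1 * v 1
  set q := G 1 0 * v 0 + G 1 1 * v 1
  calc (p * v 1 - q * v 0) ^ 2 ≤ (p ^ 2 + q ^ 2) * (v 0 ^ 2 + v 1 ^ 2) := by
        nlinarith [sq_nonneg (p * v 0 + q * v 1)]
    _ ≤ ((G 0 0 ^ 2 + G 0 1 ^ 2) * (v 0 ^ 2 + v 1 ^ 2) +
          (G 1 0 ^ 2 + G 1 1 ^ 2) * (v 0 ^ 2 + v 1 ^ 2)) * (v 0 ^ 2 + v 1 ^ 2) :=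
        mul_le_mul_of_nonneg_right (add_le_add h1 h2) (by positivity)
    _ = _ := by ring

lemma jumpTerm_eq {u v w : Plane} (h1 : cross u v ≠ 0) (h2 : cross v w ≠ 0)
    (G : Fin 2 → Fin 2 → ℝ) :
    jumpTerm G u v w = cross u w / (cross u v * cross v w) * cross (matVec G v) v := by
  rw [jumpTerm, div_add_div _ _ h2 h1, div_mul_eq_mul_div, mul_comm (cross u v) (cross v w)]
  congr 1
  simp only [cross]
  ring

/-- Summation by parts: the alternating sum of the traces in terms of the derivatives along the
edges. -/
lemma sum_neg_one_pow_trace (a : ℕ → Plane) (G : ℕ → Fin 2 → Fin 2 → ℝ) (n : ℕ)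
    (hX : ∀ i ≤ n, cross (a i) (a (i + 1)) ≠ 0)
    (hG : ∀ i < n, matVec (G (i + 1)) (a (i + 1)) = matVec (G i) (a (i + 1))) :
    ∑ i ∈ Finset.range (n + 1), (-1 : ℝ) ^ i * (G i 0 0 + G i 1 1) =
      cross (matVec (G 0) (a 0)) (a 1) / cross (a 0) (a 1)
      + ∑ i ∈ Finset.range n,
          (-1 : ℝ) ^ (i + 1) * jumpTerm (G (i + 1)) (a i) (a (i + 1)) (a (i + 2))
      - (-1) ^ n * (cross (matVec (G n) (a (n + 1))) (a n) / cross (a n) (a (n + 1))) := by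
  induction n with
  | zero =>
    simp only [zero_add, Finset.sum_range_one, Finset.range_zero, Finset.sum_empty, pow_zero,
      one_mul, add_zero]
    exact trace_eq (hX 0 le_rfl) _
  | succ n ih =>
    rw [Finset.sum_range_succ, ih (fun i hi => hX i (by omega)) fun i hi => hG i (by omega),
      Finset.sum_range_succ, trace_eq (hX (n + 1) le_rfl), jumpTerm, hG n (by omega)]
    ring

namespace Numbering

variable {T : Triangulation Ω} (e : Numbering T) {z : Plane}

lemma abs_jumpTerm_le {γ η : ℝ} (hγ : T.shapeRegularity ≤ γ) (hz : z ∈ T.vertices) {i j : ℕ}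
    (hi : i < T.N z) (hj : j < T.N z) (hij : e.point z (i + 1) = e.point z j)
    (h : |Real.sin (e.angle z i + e.angle z j)| ≤ η) (G : Fin 2 → Fin 2 → ℝ) :
    |jumpTerm G (e.edge z i) (e.edge z j) (e.edge z (j + 1))| ≤
      η / sinBound γ ^ 2 * gradSize G := by
  have hedge : e.edge z (i + 1) = e.edge z j := by rw [edge, edge, hij]
  have hs := sinBound_pos γ
  have hu := e.edge_norm_pos hz hi.le
  have hv := e.edge_norm_pos hz hj.le
  have hw := e.edge_norm_pos hz (show j + 1 ≤ T.N z from hj)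
  have c1 := e.cos_angle_mul z i
  have c2 := e.cos_angle_mul z j
  have s1 := e.sin_angle_mul hz hi
  have s2 := e.sin_angle_mul hz hj
  have b1 := T.sinBound_mul_le hγ (e.cell_mem hz hi) (e.isCcw hz hi)
  have b2 := T.sinBound_mul_le hγ (e.cell_mem hz hj) (e.isCcw hz hj)
  have x1 := e.cross_edge_pos hz hi
  have x2 := e.cross_edge_pos hz hj
  change sinBound γ * (‖e.edge z i‖ * ‖e.edge z (i + 1)‖) ≤
    cross (e.edge z i) (e.edge z (i + 1)) at b1
  change sinBound γ * (‖e.edge z j‖ * ‖e.edge z (j + 1)‖) ≤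
    cross (e.edge z j) (e.edge z (j + 1)) at b2
  rw [hedge] at c1 s1 b1 x1
  generalize e.edge z i = u at *
  generalize e.edge z j = v at *
  generalize e.edge z (j + 1) = w at *
  have key : cross u w = ‖u‖ * ‖w‖ * Real.sin (e.angle z i + e.angle z j) := by
    have h1 : ‖v‖ ^ 2 * cross u w = ‖v‖ ^ 2 *
        (‖u‖ * ‖w‖ * Real.sin (e.angle z i + e.angle z j)) := by
      rw [Real.sin_add]
      calc ‖v‖ ^ 2 * cross u w = cross u v * inner ℝ v w + inner ℝ u v * cross v w := by
            rw [plane_norm_sq, plane_inner, plane_inner]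
            simp only [cross]
            ring
        _ = _ := by
            rw [← s1, ← s2, ← c1, ← c2]
            ring
    exact mul_left_cancel₀ (by positivity) h1
  rw [jumpTerm_eq x1.ne' x2.ne', abs_mul, abs_div, abs_of_pos (mul_pos x1 x2)]
  have k1 : |cross u w| ≤ ‖u‖ * ‖w‖ * η := by
    rw [key, abs_mul, abs_of_pos (mul_pos hu hw)]
    exact mul_le_mul_of_nonneg_left h (by positivity)
  have k2 : (sinBound γ * (‖u‖ * ‖v‖)) * (sinBound γ * (‖v‖ * ‖w‖)) ≤ cross u v * cross v w :=
    mul_le_mul b1 b2 (by positivity) x1.le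
  have hη : 0 ≤ η := (abs_nonneg _).trans h
  calc |cross u w| / (cross u v * cross v w) * |cross (matVec G v) v|
      ≤ (‖u‖ * ‖w‖ * η) / ((sinBound γ * (‖u‖ * ‖v‖)) * (sinBound γ * (‖v‖ * ‖w‖))) *
          (gradSize G * ‖v‖ ^ 2) := by
        refine mul_le_mul (div_le_div₀ (by positivity) k1 (by positivity) k2)
          (abs_cross_matVec_le G v) (abs_nonneg _) (by positivity)
    _ = η / sinBound γ ^ 2 * gradSize G := by
        field_simp

lemma abs_sum_jumpTerm_le {γ η : ℝ} (hγ : T.shapeRegularity ≤ γ) (hz : z ∈ T.vertices) {n : ℕ}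
    (hn : n + 1 ≤ T.N z) (G : ℕ → Fin 2 → Fin 2 → ℝ)
    (hsin : ∀ i < n, |Real.sin (e.angle z i + e.angle z (i + 1))| ≤ η) :
    |∑ i ∈ Finset.range n, (-1 : ℝ) ^ (i + 1) *
      jumpTerm (G (i + 1)) (e.edge z i) (e.edge z (i + 1)) (e.edge z (i + 2))| ≤
      ∑ i ∈ Finset.range n, η / sinBound γ ^ 2 * gradSize (G (i + 1)) := by
  refine (Finset.abs_sum_le_sum_abs _ _).trans (Finset.sum_le_sum fun i hi => ?_)
  have hi' := Finset.mem_range.mp hi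
  rw [abs_mul, abs_pow, abs_neg, abs_one, one_pow, one_mul]
  exact e.abs_jumpTerm_le hγ hz (by omega) (by omega) rfl (hsin i hi') _

/-- The alternating sum of the traces at a vertex whose first and last edge lie on the boundary. -/
lemma abs_alternating_trace_le_of_open {γ η : ℝ} (hγ : T.shapeRegularity ≤ γ)
    (hz : z ∈ T.vertices) (hη : 0 ≤ η) (G : ℕ → Fin 2 → Fin 2 → ℝ)
    (hG : ∀ i, i + 1 < T.N z →
      matVec (G (i + 1)) (e.edge z (i + 1)) = matVec (G i) (e.edge z (i + 1)))
    (h0 : matVec (G 0) (e.edge z 0) = 0)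
    (h1 : ∀ i, i + 1 = T.N z → matVec (G i) (e.edge z (i + 1)) = 0)
    (hsin : ∀ i, i + 1 < T.N z → |Real.sin (e.angle z i + e.angle z (i + 1))| ≤ η) :
    |∑ i ∈ Finset.range (T.N z), (-1 : ℝ) ^ i * (G i 0 0 + G i 1 1)| ≤
      η / sinBound γ ^ 2 * ∑ i ∈ Finset.range (T.N z), gradSize (G i) := by
  have hN := e.N_pos hz
  obtain ⟨n, hn⟩ : ∃ n, T.N z = n + 1 := ⟨T.N z - 1, by omega⟩
  rw [hn, sum_neg_one_pow_trace (e.edge z) G n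
    (fun i hi => (e.cross_edge_pos hz (by omega)).ne') (fun i hi => hG i (by omega)), h0,
    h1 n hn.symm]
  have hz0 : ∀ v : Plane, cross 0 v = 0 := fun v => by simp [cross]
  rw [hz0, hz0, zero_div, zero_div, mul_zero, zero_add, sub_zero, Finset.sum_range_succ', mul_add,
    Finset.mul_sum]
  have hs := sinBound_pos γ
  have := e.abs_sum_jumpTerm_le hγ hz hn.ge G (η := η) fun i hi => hsin i (by omega)
  have h3 : 0 ≤ η / sinBound γ ^ 2 * gradSize (G 0) :=
    mul_nonneg (by positivity) (gradSize_nonneg _)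
  linarith

/-- The alternating sum of the traces at a vertex that is surrounded by an even number of
triangles. -/
lemma abs_alternating_trace_le_of_closed {γ η : ℝ} (hγ : T.shapeRegularity ≤ γ)
    (hz : z ∈ T.vertices) (G : ℕ → Fin 2 → Fin 2 → ℝ)
    (hcl : e.point z (T.N z) = e.point z 0) (heven : Even (T.N z))
    (hG : ∀ i, i + 1 < T.N z →
      matVec (G (i + 1)) (e.edge z (i + 1)) = matVec (G i) (e.edge z (i + 1)))
    (h1 : ∀ i, i + 1 = T.N z → matVec (G i) (e.edge z 0) = matVec (G 0) (e.edge z 0))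
    (hsin : ∀ i < T.N z, |Real.sin (e.angle z i + e.angle z ((i + 1) % T.N z))| ≤ η) :
    |∑ i ∈ Finset.range (T.N z), (-1 : ℝ) ^ i * (G i 0 0 + G i 1 1)| ≤
      η / sinBound γ ^ 2 * ∑ i ∈ Finset.range (T.N z), gradSize (G i) := by
  have hN := e.N_pos hz
  obtain ⟨n, hn⟩ : ∃ n, T.N z = n + 1 := ⟨T.N z - 1, by omega⟩
  have hedge : e.edge z (n + 1) = e.edge z 0 := by rw [edge, edge, ← hn, hcl]
  rw [hn, sum_neg_one_pow_trace (e.edge z) G n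
    (fun i hi => (e.cross_edge_pos hz (by omega)).ne') (fun i hi => hG i (by omega))]
  have hodd : (-1 : ℝ) ^ n = -1 := by
    rw [hn, Nat.even_add_one, Nat.not_even_iff_odd] at heven
    exact heven.neg_one_pow
  rw [hodd, hedge, h1 n hn.symm]
  have h2 := e.abs_jumpTerm_le (η := η) hγ hz (i := n) (j := 0) (by omega) hN (by rw [← hn, hcl])
    (by
      have := hsin n (by omega)
      rwa [hn, Nat.mod_self] at this) (G 0)
  have h3 := e.abs_sum_jumpTerm_le hγ hz hn.ge G (η := η) fun i hi => by
    have := hsin i (by omega)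
    rwa [Nat.mod_eq_of_lt (by omega)] at this
  rw [jumpTerm] at h2
  rw [Finset.sum_range_succ', mul_add, Finset.mul_sum]
  simp only [zero_add] at h2 ⊢
  set A := ∑ i ∈ Finset.range n, (-1 : ℝ) ^ (i + 1) *
    jumpTerm (G (i + 1)) (e.edge z i) (e.edge z (i + 1)) (e.edge z (i + 2))
  set B := cross (matVec (G 0) (e.edge z 0)) (e.edge z 1) / cross (e.edge z 0) (e.edge z 1)
  set D := cross (matVec (G 0) (e.edge z 0)) (e.edge z n) / cross (e.edge z n) (e.edge z 0)
  have h4 : B + A - -1 * D = A + (B + D) := by ring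
  rw [h4]
  exact (abs_add_le _ _).trans (add_le_add h3 h2)

end Numbering

/-! ### Piecewise polynomial velocities at a vertex -/

lemma isPolyOn_iff {q : L2 Ω} {K : Finset Plane} {P : MvPolynomial (Fin 2) ℝ} :
    IsPolyOn q K P ↔ ∀ᵐ x ∂((volume : Measure Plane).restrict (interior (tri K))),
      q x = polyEval P x := Iff.rfl

lemma indicator_eq_of_isPolyOn {T : Triangulation Ω} (hΩ : IsPolygonalLipschitzDomain Ω)
    {q : L2 Ω} {K : Finset Plane} (hK : K ∈ T.cells) {P : MvPolynomial (Fin 2) ℝ}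
    (h : IsPolyOn q K P) :
    ∀ᵐ x ∂(volume : Measure Plane), x ∈ interior (tri K) → Ω.indicator q x = polyEval P x := by
  filter_upwards [(ae_restrict_iff' isOpen_interior.measurableSet).mp (isPolyOn_iff.mp h)]
    with x hx hxK
  rw [indicator_of_mem (T.interior_tri_subset hΩ hK hxK), hx hxK]

lemma isPolyOn_weakDeriv {T : Triangulation Ω} (hΩ : IsPolygonalLipschitzDomain Ω)
    {U : L2 Ω × (Fin 2 → L2 Ω)} (hU : U ∈ H10 Ω) {K : Finset Plane} (hK : K ∈ T.cells)
    {P : MvPolynomial (Fin 2) ℝ} (h : IsPolyOn U.1 K P) (j : Fin 2) :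
    IsPolyOn (U.2 j) K (MvPolynomial.pderiv j P) :=
  weakDeriv_eq_pderiv hU isOpen_interior (T.interior_tri_subset hΩ hK) h j

section Edge

variable {T : Triangulation Ω} {U : L2 Ω × (Fin 2 → L2 Ω)} {K L : Finset Plane}
  {z y w w' : Plane} {P Q : MvPolynomial (Fin 2) ℝ}

lemma eventually_side (hΩ : IsPolygonalLipschitzDomain Ω) (hU : U ∈ H10 Ω) (hK : K ∈ T.cells)
    (hP : IsPolyOn U.1 K P) {p : Plane → Prop} {x : Plane}
    (h : ∀ᶠ q in nhds x, p q → q ∈ interior (tri K)) :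
    ∃ B ∈ nhds x, ∀ᵐ q ∂(volume : Measure Plane), q ∈ B → p q →
      Ω.indicator U.1 q = polyEval P q ∧
        ∀ j, Ω.indicator (U.2 j) q = polyEval (MvPolynomial.pderiv j P) q := by
  refine ⟨_, h, ?_⟩
  filter_upwards [indicator_eq_of_isPolyOn hΩ hK hP,
    ae_all_iff.mpr fun j => indicator_eq_of_isPolyOn hΩ hK (isPolyOn_weakDeriv hΩ hU hK hP j)]
    with q h1 h2 hqB hq
  exact ⟨h1 (hqB hq), fun j => h2 j (hqB hq)⟩

lemma eventually_outside {p : Plane → Prop} {x : Plane}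
    (h : ∀ᶠ q in nhds x, p q → q ∉ closure Ω) :
    ∃ B ∈ nhds x, ∀ᵐ q ∂(volume : Measure Plane), q ∈ B → p q →
      Ω.indicator U.1 q = polyEval 0 q ∧
        ∀ j, Ω.indicator (U.2 j) q = polyEval (MvPolynomial.pderiv j 0) q := by
  refine ⟨_, h, Filter.Eventually.of_forall fun q hqB hq => ?_⟩
  have hqΩ : q ∉ Ω := fun h => hqB hq (subset_closure h)
  simp [hqΩ]

lemma polyEval_eq_of_eventually (hΩ : IsPolygonalLipschitzDomain Ω) (hU : U ∈ H10 Ω)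
    {v u x : Plane} (hvu : 0 < cross v u)
    (h1 : ∃ B ∈ nhds x, ∀ᵐ q ∂(volume : Measure Plane), q ∈ B → 0 < cross v (q - x) →
      Ω.indicator U.1 q = polyEval P q ∧
        ∀ j, Ω.indicator (U.2 j) q = polyEval (MvPolynomial.pderiv j P) q)
    (h2 : ∃ B ∈ nhds x, ∀ᵐ q ∂(volume : Measure Plane), q ∈ B → cross v (q - x) < 0 →
      Ω.indicator U.1 q = polyEval Q q ∧
        ∀ j, Ω.indicator (U.2 j) q = polyEval (MvPolynomial.pderiv j Q) q) :
    polyEval P x = polyEval Q x := by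
  obtain ⟨B, hB, hBP⟩ := h1
  obtain ⟨B', hB', hBQ⟩ := h2
  refine polyEval_eq_of_sides hU hΩ.isOpen.measurableSet hvu (Filter.inter_mem hB hB') ?_ ?_
  · filter_upwards [hBP] with q hq hqB hpos
    exact hq hqB.1 hpos
  · filter_upwards [hBQ] with q hq hqB hneg
    exact hq hqB.2 hneg

/-- Across an edge the tangential derivatives agree. -/
lemma tangential_eq (hΩ : IsPolygonalLipschitzDomain Ω) (hU : U ∈ H10 Ω) (hK : K ∈ T.cells)
    (hL : L ∈ T.cells) (hP : IsPolyOn U.1 K P) (hQ : IsPolyOn U.1 L Q) (h : IsCcw K z y w)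
    (h' : IsCcw L z w' y) :
    ∑ j, polyEval (MvPolynomial.pderiv j P) z * (y - z) j =
      ∑ j, polyEval (MvPolynomial.pderiv j Q) z * (y - z) j := by
  have := sum_pderiv_eq_zero_of_segment (P - Q) z (y - z) fun t ht => by
    rw [polyEval_sub, sub_eq_zero]
    exact polyEval_eq_of_eventually hΩ hU h.pos
      (eventually_side hΩ hU hK hP (h.eventually_mem_interior_tri ht))
      (eventually_side hΩ hU hL hQ (h'.eventually_mem_interior_tri_right ht))
  simp only [map_sub, polyEval_sub, sub_mul, Finset.sum_sub_distrib] at this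
  exact sub_eq_zero.mp this

/-- Along an edge with `Ω` on the left only the tangential derivative vanishes. -/
lemma tangential_eq_zero_left (hΩ : IsPolygonalLipschitzDomain Ω) (hU : U ∈ H10 Ω)
    (hK : K ∈ T.cells) (hP : IsPolyOn U.1 K P) (h : IsCcw K z y w)
    (hout : ∀ s ∈ Ioo (0 : ℝ) 1, ∀ᶠ p in nhds (z + s • (y - z)),
      cross (y - z) (p - (z + s • (y - z))) < 0 → p ∉ closure Ω) :
    ∑ j, polyEval (MvPolynomial.pderiv j P) z * (y - z) j = 0 := by
  refine sum_pderiv_eq_zero_of_segment P z (y - z) fun t ht => ?_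
  rw [← polyEval_zero (z + t • (y - z))]
  exact polyEval_eq_of_eventually hΩ hU h.pos
    (eventually_side hΩ hU hK hP (h.eventually_mem_interior_tri ht))
    (eventually_outside (hout t ht))

lemma tangential_eq_zero_right (hΩ : IsPolygonalLipschitzDomain Ω) (hU : U ∈ H10 Ω)
    (hK : K ∈ T.cells) (hP : IsPolyOn U.1 K P) (h : IsCcw K z w y)
    (hout : ∀ s ∈ Ioo (0 : ℝ) 1, ∀ᶠ p in nhds (z + s • (y - z)),
      0 < cross (y - z) (p - (z + s • (y - z))) → p ∉ closure Ω) :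
    ∑ j, polyEval (MvPolynomial.pderiv j P) z * (y - z) j = 0 := by
  refine sum_pderiv_eq_zero_of_segment P z (y - z) fun t ht => ?_
  rw [← polyEval_zero (z + t • (y - z))]
  have hpos : 0 < cross (y - z) (-(w - z)) := by
    have := h.pos
    simp only [cross, PiLp.neg_apply] at this ⊢
    linarith
  exact (polyEval_eq_of_eventually hΩ hU hpos (eventually_outside (hout t ht))
    (eventually_side hΩ hU hK hP (h.eventually_mem_interior_tri_right ht))).symm

end Edge

/-- The matrix of the first derivatives at `z` of a pair of polynomials. -/
def jacobian (P : Fin 2 → MvPolynomial (Fin 2) ℝ) (z : Plane) (c j : Fin 2) : ℝ :=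
  polyEval (MvPolynomial.pderiv j (P c)) z

lemma matVec_jacobian_eq {P Q : Fin 2 → MvPolynomial (Fin 2) ℝ} {z v : Plane}
    (h : ∀ c, ∑ j, polyEval (MvPolynomial.pderiv j (P c)) z * v j =
      ∑ j, polyEval (MvPolynomial.pderiv j (Q c)) z * v j) :
    matVec (jacobian P z) v = matVec (jacobian Q z) v :=
  plane_ext (h 0) (h 1)

lemma matVec_jacobian_eq_zero {P : Fin 2 → MvPolynomial (Fin 2) ℝ} {z v : Plane}
    (h : ∀ c, ∑ j, polyEval (MvPolynomial.pderiv j (P c)) z * v j = 0) :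
    matVec (jacobian P z) v = 0 :=
  plane_ext (h 0) (h 1)

namespace Numbering

variable {T : Triangulation Ω} (e : Numbering T) {z : Plane}

/-- At an `η`-critical vertex the alternating sum of the divergences of a discrete velocity is of
the order `η`. -/
lemma abs_alternating_div_le (hΩ : IsPolygonalLipschitzDomain Ω) {γ η : ℝ}
    (hγ : T.shapeRegularity ≤ γ) (hη : 0 ≤ η) (hη' : η < sinBound γ ^ 2 / 4)
    (hz : z ∈ e.critical η) {v : Vel Ω} {P : Finset Plane → Fin 2 → MvPolynomial (Fin 2) ℝ}
    (hP : ∀ K ∈ T.cells, ∀ c, IsPolyOn (comp v c) K (P K c)) :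
    |∑ i ∈ Finset.range (T.N z), (-1 : ℝ) ^ i *
        (jacobian (P (e.cell z i)) z 0 0 + jacobian (P (e.cell z i)) z 1 1)| ≤
      η / sinBound γ ^ 2 *
        ∑ i ∈ Finset.range (T.N z), gradSize (jacobian (P (e.cell z i)) z) := by
  obtain ⟨hzv, hΘ⟩ := hz
  have hN := e.N_pos hzv
  have hmatch : ∀ i, i + 1 < T.N z →
      matVec (jacobian (P (e.cell z (i + 1))) z) (e.edge z (i + 1)) =
        matVec (jacobian (P (e.cell z i)) z) (e.edge z (i + 1)) := fun i hi =>
    matVec_jacobian_eq fun c => tangential_eq hΩ (v c).2 (e.cell_mem hzv hi)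
      (e.cell_mem hzv (by omega)) (hP _ (e.cell_mem hzv hi) c)
      (hP _ (e.cell_mem hzv (by omega)) c) (e.isCcw hzv hi) (e.isCcw hzv (by omega))
  by_cases hcl : e.point z (T.N z) = e.point z 0
  · have hzΩ := e.mem_of_closed hΩ hzv hcl
    have hsin : ∀ i < T.N z, |Real.sin (e.angle z i + e.angle z ((i + 1) % T.N z))| ≤ η := by
      intro i hi
      refine le_trans ?_ hΘ
      rw [Theta, if_pos hzΩ]
      exact le_ciSup (f := fun i : Fin (T.N z) =>
        |Real.sin (e.angle z i + e.angle z ((i + 1) % T.N z))|)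
        (Set.finite_range _).bddAbove ⟨i, hi⟩
    refine e.abs_alternating_trace_le_of_closed hγ hzv (fun i => jacobian (P (e.cell z i)) z) hcl
      (e.even_N hγ hzv hcl hη hη' hsin) hmatch (fun i hi => ?_) hsin
    have hiN : i < T.N z := by omega
    have h1 := e.isCcw hzv hiN
    rw [hi, hcl] at h1
    exact (matVec_jacobian_eq fun c => tangential_eq hΩ (v c).2 (e.cell_mem hzv hN)
      (e.cell_mem hzv hiN) (hP _ (e.cell_mem hzv hN) c) (hP _ (e.cell_mem hzv hiN) c)
      (e.isCcw hzv hN) h1).symm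
  · have hzΩ := e.notMem_of_open hΩ hzv hcl
    have hsin : ∀ i, i + 1 < T.N z → |Real.sin (e.angle z i + e.angle z (i + 1))| ≤ η := by
      intro i hi
      refine le_trans ?_ hΘ
      rw [Theta, if_neg hzΩ, if_pos (by omega)]
      exact le_ciSup (f := fun i : Fin (T.N z - 1) =>
        |Real.sin (e.angle z i + e.angle z (i + 1))|)
        (Set.finite_range _).bddAbove ⟨i, by omega⟩
    refine e.abs_alternating_trace_le_of_open hγ hzv hη (fun i => jacobian (P (e.cell z i)) z)
      hmatch ?_ (fun i hi => ?_) hsin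
    · exact matVec_jacobian_eq_zero fun c => tangential_eq_zero_left hΩ (v c).2
        (e.cell_mem hzv hN) (hP _ (e.cell_mem hzv hN) c) (e.isCcw hzv hN)
        fun s hs => e.eventually_notMem_first hzv hcl hs
    · have hiN : i < T.N z := by omega
      have h1 := e.isCcw hzv hiN
      refine matVec_jacobian_eq_zero fun c => tangential_eq_zero_right hΩ (v c).2
        (e.cell_mem hzv hiN) (hP _ (e.cell_mem hzv hiN) c) h1 fun s hs => ?_
      have := e.eventually_notMem_last hzv hcl hs
      rwa [← hi] at this

end Numbering

/-! ### Piecewise polynomials as square integrable functions -/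

section IsPolyOn

variable {q q' : L2 Ω} {K : Finset Plane} {P P' : MvPolynomial (Fin 2) ℝ}

lemma IsPolyOn.add (hsub : interior (tri K) ⊆ Ω) (h : IsPolyOn q K P) (h' : IsPolyOn q' K P') :
    IsPolyOn (q + q') K (P + P') := by
  rw [isPolyOn_iff] at *
  filter_upwards [h, h', ae_restrict_of_ae_restrict_of_subset hsub (Lp.coeFn_add q q')]
    with x h1 h2 h3
  rw [h3, Pi.add_apply, h1, h2, polyEval_add]

lemma IsPolyOn.smul (hsub : interior (tri K) ⊆ Ω) (c : ℝ) (h : IsPolyOn q K P) :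
    IsPolyOn (c • q) K (c • P) := by
  rw [isPolyOn_iff] at *
  filter_upwards [h, ae_restrict_of_ae_restrict_of_subset hsub (Lp.coeFn_smul c q)]
    with x h1 h2
  rw [h2, Pi.smul_apply, h1, polyEval_smul, smul_eq_mul]

lemma IsPolyOn.zero (hsub : interior (tri K) ⊆ Ω) : IsPolyOn (0 : L2 Ω) K 0 := by
  rw [isPolyOn_iff]
  filter_upwards [ae_restrict_of_ae_restrict_of_subset hsub
    (Lp.coeFn_zero ℝ 2 ((volume : Measure Plane).restrict Ω))] with x h1
  rw [h1, Pi.zero_apply, polyEval_zero]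

lemma IsPolyOn.unique (hne : (interior (tri K)).Nonempty) (h : IsPolyOn q K P)
    (h' : IsPolyOn q K P') : P = P' := by
  refine polyEval_eq_of_ae_eq isOpen_interior hne ?_
  filter_upwards [h, h'] with x h1 h2
  exact h1.symm.trans h2

lemma polyOn_eq (hne : (interior (tri K)).Nonempty) (h : IsPolyOn q K P) : polyOn q K = P := by
  have hex : ∃ P, IsPolyOn q K P := ⟨P, h⟩
  rw [polyOn, dif_pos hex]
  exact IsPolyOn.unique hne hex.choose_spec h

end IsPolyOn

namespace Numbering

variable {T : Triangulation Ω} (e : Numbering T)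

include e in
lemma exists_isCcw {K : Finset Plane} (hK : K ∈ T.cells) {z : Plane} (hz : z ∈ K) :
    ∃ y w, IsCcw K z y w := by
  have hzv : z ∈ T.vertices := ⟨K, hK, hz⟩
  obtain ⟨i, hi, rfl⟩ := e.exists_cell_eq hzv hK hz
  exact ⟨_, _, e.isCcw hzv hi⟩

include e in
lemma interior_tri_nonempty {K : Finset Plane} (hK : K ∈ T.cells) :
    (interior (tri K)).Nonempty := by
  have hcard := T.card_eq K hK
  obtain ⟨z, hz⟩ := Finset.card_pos.mp (by omega : 0 < K.card)
  obtain ⟨y, w, h⟩ := e.exists_isCcw hK hz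
  exact h.interior_nonempty

end Numbering

namespace Triangulation

variable (T : Triangulation Ω)

lemma disjoint_interior_tri {K L : Finset Plane} (hK : K ∈ T.cells) (hL : L ∈ T.cells)
    (hne : K ≠ L) : Disjoint (interior (tri K)) (interior (tri L)) := by
  rw [Set.disjoint_iff_inter_eq_empty, ← interior_inter]
  exact Measure.interior_eq_empty_of_null (T.volume_tri_inter_tri hK hL hne)

lemma ae_eq_iUnion_interior (hΩ : IsPolygonalLipschitzDomain Ω) :
    Ω =ᵐ[(volume : Measure Plane)] ⋃ K ∈ T.cells, interior (tri K) := by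
  have hsub : ⋃ K ∈ T.cells, interior (tri K) ⊆ Ω :=
    iUnion₂_subset fun K hK => T.interior_tri_subset hΩ hK
  suffices h : (volume : Measure Plane) (Ω \ ⋃ K ∈ T.cells, interior (tri K)) = 0 from
    (ae_eq_set (s := Ω)).mpr ⟨h, by rw [sdiff_eq_empty.mpr hsub, measure_empty]⟩
  refine measure_mono_null (t := ⋃ K ∈ T.cells, frontier (tri K)) ?_ ?_
  · rintro x ⟨hx, hx'⟩
    have hxc := subset_closure hx
    rw [← T.cover] at hxc
    obtain ⟨K, hK, hxK⟩ := mem_iUnion₂.mp hxc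
    refine mem_iUnion₂.mpr ⟨K, hK, subset_closure hxK, fun h => hx' ?_⟩
    exact mem_iUnion₂.mpr ⟨K, hK, h⟩
  · refine (measure_biUnion_null_iff T.cells.countable_toSet).mpr fun K _ => ?_
    exact (convex_convexHull ℝ _).addHaar_frontier volume

lemma setIntegral_eq_sum (hΩ : IsPolygonalLipschitzDomain Ω) {f : Plane → ℝ}
    (hf : IntegrableOn f Ω) {g : Finset Plane → Plane → ℝ}
    (hfg : ∀ K ∈ T.cells, ∀ᵐ x ∂((volume : Measure Plane).restrict (interior (tri K))),
      f x = g K x) :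
    ∫ x in Ω, f x = ∑ K ∈ T.cells, ∫ x in tri K, g K x := by
  rw [setIntegral_congr_set (T.ae_eq_iUnion_interior hΩ), integral_biUnion_finset]
  · refine Finset.sum_congr rfl fun K hK => ?_
    rw [integral_congr_ae (hfg K hK), restrict_interior_tri]
  · exact fun K _ => isOpen_interior.measurableSet
  · exact fun K hK L hL hne => T.disjoint_interior_tri hK hL hne
  · exact fun K hK => hf.mono_set (T.interior_tri_subset hΩ hK)

lemma setIntegral_eq_sum_poly (hΩ : IsPolygonalLipschitzDomain Ω) {q : L2 Ω}
    {P : Finset Plane → MvPolynomial (Fin 2) ℝ} (hq : ∀ K ∈ T.cells, IsPolyOn q K (P K)) :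
    ∫ x in Ω, q x = ∑ K ∈ T.cells, ∫ x in tri K, polyEval (P K) x := by
  have hfin : volume Ω ≠ ⊤ := hΩ.isBounded.measure_lt_top.ne
  have : IsFiniteMeasure ((volume : Measure Plane).restrict Ω) := ⟨by simpa using hfin.lt_top⟩
  exact T.setIntegral_eq_sum hΩ ((Lp.memLp q).integrable (by norm_num)) hq

lemma norm_sq_eq_sum_poly (hΩ : IsPolygonalLipschitzDomain Ω) {q : L2 Ω}
    {P : Finset Plane → MvPolynomial (Fin 2) ℝ} (hq : ∀ K ∈ T.cells, IsPolyOn q K (P K)) :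
    ‖q‖ ^ 2 = ∑ K ∈ T.cells, ∫ x in tri K, polyEval (P K) x ^ 2 := by
  rw [← real_inner_self_eq_norm_sq, L2_inner_eq]
  refine T.setIntegral_eq_sum hΩ (integrable_mul_L2 q q) fun K hK => ?_
  filter_upwards [hq K hK] with x hx
  rw [hx, ← pow_two]
  rfl

lemma exists_isPolyOn (hΩ : IsPolygonalLipschitzDomain Ω)
    (P : Finset Plane → MvPolynomial (Fin 2) ℝ) :
    ∃ q : L2 Ω, ∀ K ∈ T.cells, IsPolyOn q K (P K) := by
  set f : Plane → ℝ := fun x => ∑ K ∈ T.cells, (interior (tri K)).indicator (polyEval (P K)) x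
    with hf
  have hmem : MemLp f 2 ((volume : Measure Plane).restrict Ω) := by
    refine memLp_finsetSum T.cells fun K _ => MemLp.restrict Ω ?_
    rw [memLp_indicator_iff_restrict isOpen_interior.measurableSet, restrict_interior_tri]
    obtain ⟨C, hC⟩ := (isCompact_tri K).exists_bound_of_continuousOn
      (continuous_polyEval (P K)).continuousOn
    have : IsFiniteMeasure ((volume : Measure Plane).restrict (tri K)) :=
      ⟨by simpa using (isCompact_tri K).measure_lt_top⟩
    refine MemLp.of_bound (continuous_polyEval (P K)).aestronglyMeasurable C ?_
    exact (ae_restrict_iff' (measurableSet_tri K)).mpr (Filter.Eventually.of_forall hC)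
  refine ⟨hmem.toLp, fun K hK => ?_⟩
  rw [isPolyOn_iff]
  filter_upwards [ae_restrict_of_ae_restrict_of_subset (T.interior_tri_subset hΩ hK)
    hmem.coeFn_toLp, ae_restrict_mem isOpen_interior.measurableSet] with x hx hxK
  rw [hx, hf]
  simp only
  rw [Finset.sum_eq_single K, indicator_of_mem hxK]
  · intro L hL hne
    exact indicator_of_notMem (fun hxL =>
      (T.disjoint_interior_tri hL hK hne).le_bot ⟨hxL, hxK⟩) _
  · exact fun h => absurd hK h

end Triangulation

/-! ### The discrete spaces and best approximations -/

section Spaces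

variable {T : Triangulation Ω}

/-- `Pk T k` as a linear subspace. -/
def polySubmodule (hΩ : IsPolygonalLipschitzDomain Ω) (T : Triangulation Ω) (k : ℕ) :
    Submodule ℝ (L2 Ω) where
  carrier := Pk T k
  zero_mem' K hK := ⟨0, by simp, IsPolyOn.zero (T.interior_tri_subset hΩ hK)⟩
  add_mem' {q q'} hq hq' K hK := by
    obtain ⟨P, hP, h⟩ := hq K hK
    obtain ⟨P', hP', h'⟩ := hq' K hK
    exact ⟨P + P', (MvPolynomial.totalDegree_add _ _).trans (max_le hP hP'),
      h.add (T.interior_tri_subset hΩ hK) h'⟩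
  smul_mem' c q hq K hK := by
    obtain ⟨P, hP, h⟩ := hq K hK
    exact ⟨c • P, (MvPolynomial.totalDegree_smul_le _ _).trans hP,
      h.smul (T.interior_tri_subset hΩ hK) c⟩

lemma eq_zero_of_isPolyOn_zero (hΩ : IsPolygonalLipschitzDomain Ω) {q : L2 Ω}
    (h : ∀ K ∈ T.cells, IsPolyOn q K 0) : q = 0 := by
  have := T.norm_sq_eq_sum_poly hΩ (P := fun _ => 0) h
  simpa using this

/-- The polynomial pieces, as a linear map. -/
def pieces (hΩ : IsPolygonalLipschitzDomain Ω) (e : Numbering T) (k : ℕ) :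
    polySubmodule hΩ T k →ₗ[ℝ]
      ({K // K ∈ T.cells} → MvPolynomial.restrictTotalDegree (Fin 2) ℝ k) where
  toFun q K := ⟨polyOn q.1 K.1, by
    obtain ⟨P, hP, h⟩ := q.2 K.1 K.2
    rw [polyOn_eq (e.interior_tri_nonempty K.2) h]
    exact (MvPolynomial.mem_restrictTotalDegree _ _ _).mpr hP⟩
  map_add' q q' := by
    funext K
    obtain ⟨P, -, h⟩ := q.2 K.1 K.2
    obtain ⟨P', -, h'⟩ := q'.2 K.1 K.2
    have hne := e.interior_tri_nonempty K.2
    refine Subtype.ext ?_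
    change polyOn (q.1 + q'.1) K.1 = polyOn q.1 K.1 + polyOn q'.1 K.1
    rw [polyOn_eq hne h, polyOn_eq hne h',
      polyOn_eq hne (h.add (T.interior_tri_subset hΩ K.2) h')]
  map_smul' c q := by
    funext K
    obtain ⟨P, -, h⟩ := q.2 K.1 K.2
    have hne := e.interior_tri_nonempty K.2
    refine Subtype.ext ?_
    change polyOn (c • q.1) K.1 = c • polyOn q.1 K.1
    rw [polyOn_eq hne h, polyOn_eq hne (h.smul (T.interior_tri_subset hΩ K.2) c)]

lemma finiteDimensional_polySubmodule (hΩ : IsPolygonalLipschitzDomain Ω) (e : Numbering T)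
    (k : ℕ) : FiniteDimensional ℝ (polySubmodule hΩ T k) := by
  refine FiniteDimensional.of_injective (pieces hΩ e k) ?_
  rw [injective_iff_map_eq_zero]
  intro q hq
  refine Subtype.ext (eq_zero_of_isPolyOn_zero (T := T) hΩ fun K hK => ?_)
  obtain ⟨P, -, h⟩ := q.2 K hK
  have h0 : polyOn q.1 K = 0 := congrArg Subtype.val (congrFun hq ⟨K, hK⟩)
  rw [polyOn_eq (e.interior_tri_nonempty hK) h] at h0
  exact h0 ▸ h

lemma altSum_eq (e : Numbering T) {z : Plane} (hz : z ∈ T.vertices) {q : L2 Ω}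
    {P : Finset Plane → MvPolynomial (Fin 2) ℝ} (hq : ∀ K ∈ T.cells, IsPolyOn q K (P K)) :
    altSum e z q =
      ∑ i ∈ Finset.range (T.N z), (-1 : ℝ) ^ (i + 1) * polyEval (P (e.cell z i)) z := by
  refine Finset.sum_congr rfl fun i hi => ?_
  have hK := e.cell_mem hz (Finset.mem_range.mp hi)
  rw [polyOn_eq (e.interior_tri_nonempty hK) (hq _ hK)]
  rfl

lemma altSum_add (hΩ : IsPolygonalLipschitzDomain Ω) (e : Numbering T) {z : Plane}
    (hz : z ∈ T.vertices) {k : ℕ} {q q' : L2 Ω} (hq : q ∈ Pk T k) (hq' : q' ∈ Pk T k) :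
    altSum e z (q + q') = altSum e z q + altSum e z q' := by
  choose! P _ hP using hq
  choose! P' _ hP' using hq'
  rw [altSum_eq e hz hP, altSum_eq e hz hP', altSum_eq e hz (P := fun K => P K + P' K)
    fun K hK => (hP K hK).add (T.interior_tri_subset hΩ hK) (hP' K hK), ← Finset.sum_add_distrib]
  exact Finset.sum_congr rfl fun i _ => by rw [polyEval_add, mul_add]

lemma altSum_smul (hΩ : IsPolygonalLipschitzDomain Ω) (e : Numbering T) {z : Plane}
    (hz : z ∈ T.vertices) {k : ℕ} (c : ℝ) {q : L2 Ω} (hq : q ∈ Pk T k) :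
    altSum e z (c • q) = c * altSum e z q := by
  choose! P _ hP using hq
  rw [altSum_eq e hz hP, altSum_eq e hz (P := fun K => c • P K)
    fun K hK => (hP K hK).smul (T.interior_tri_subset hΩ hK) c, Finset.mul_sum]
  exact Finset.sum_congr rfl fun i _ => by rw [polyEval_smul]; ring

lemma integrable_L2 (hΩ : IsPolygonalLipschitzDomain Ω) (q : L2 Ω) : IntegrableOn q Ω := by
  have hfin : volume Ω ≠ ⊤ := hΩ.isBounded.measure_lt_top.ne
  have : IsFiniteMeasure ((volume : Measure Plane).restrict Ω) := ⟨by simpa using hfin.lt_top⟩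
  exact (Lp.memLp q).integrable (by norm_num)

/-- `L20 Ω` as a linear subspace. -/
def meanZeroSubmodule (hΩ : IsPolygonalLipschitzDomain Ω) : Submodule ℝ (L2 Ω) where
  carrier := L20 Ω
  zero_mem' := by
    rw [L20, mem_ofPred_eq, integral_congr_ae (Lp.coeFn_zero _ _ _)]
    simp
  add_mem' {q q'} hq hq' := by
    rw [L20, mem_ofPred_eq] at *
    rw [integral_congr_ae (Lp.coeFn_add q q')]
    simp only [Pi.add_apply]
    rw [integral_add (integrable_L2 hΩ q) (integrable_L2 hΩ q'), hq, hq', add_zero]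
  smul_mem' c q hq := by
    rw [L20, mem_ofPred_eq] at *
    rw [integral_congr_ae (Lp.coeFn_smul c q)]
    simp only [Pi.smul_apply]
    rw [integral_smul, hq, smul_zero]

/-- The pressure space as a linear subspace. -/
def pressureSubmodule (hΩ : IsPolygonalLipschitzDomain Ω) (e : Numbering T) (η : ℝ) (k : ℕ) :
    Submodule ℝ (L2 Ω) where
  carrier := pressureSpace e η k
  zero_mem' := ⟨(polySubmodule hΩ T k).zero_mem, (meanZeroSubmodule hΩ).zero_mem, fun z hz => by
    have := altSum_smul hΩ e hz.1 0 (polySubmodule hΩ T k).zero_mem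
    simpa using this⟩
  add_mem' {q q'} hq hq' := ⟨(polySubmodule hΩ T k).add_mem hq.1 hq'.1,
    (meanZeroSubmodule hΩ).add_mem hq.2.1 hq'.2.1, fun z hz => by
      rw [altSum_add hΩ e hz.1 hq.1 hq'.1, hq.2.2 z hz, hq'.2.2 z hz, add_zero]⟩
  smul_mem' c q hq := ⟨(polySubmodule hΩ T k).smul_mem c hq.1,
    (meanZeroSubmodule hΩ).smul_mem c hq.2.1, fun z hz => by
      rw [altSum_smul hΩ e hz.1 c hq.1, hq.2.2 z hz, mul_zero]⟩

lemma exists_best_approximation {E : Type*} [NormedAddCommGroup E] [InnerProductSpace ℝ E]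
    (K : Submodule ℝ E) [FiniteDimensional ℝ K] (u : E) :
    ∃ v ∈ K, ∀ w ∈ K, ‖u - v‖ ≤ ‖u - w‖ := by
  obtain ⟨v, hv, h⟩ := K.exists_norm_eq_iInf_of_complete_subspace
    (completeSpace_coe_iff_isComplete.mp inferInstance) u
  refine ⟨v, hv, fun w hw => ?_⟩
  rw [h]
  exact ciInf_le (f := fun w : (K : Set E) => ‖u - w‖)
    ⟨0, by rintro _ ⟨w, rfl⟩; exact norm_nonneg _⟩ ⟨w, hw⟩

lemma exists_isLeast_presErrors (hΩ : IsPolygonalLipschitzDomain Ω) (e : Numbering T) (η : ℝ)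
    (k : ℕ) (p : L2 Ω) : ∃ d, IsLeast (presErrors e η k p) d := by
  have := finiteDimensional_polySubmodule hΩ e k
  have hle : pressureSubmodule hΩ e η k ≤ polySubmodule hΩ T k := fun q hq => hq.1
  have : FiniteDimensional ℝ (pressureSubmodule hΩ e η k) :=
    Submodule.finiteDimensional_of_le hle
  obtain ⟨q, hq, h⟩ := exists_best_approximation (pressureSubmodule hΩ e η k) p
  refine ⟨‖p - q‖, ⟨q, hq, rfl⟩, ?_⟩
  rintro _ ⟨q', hq', rfl⟩
  exact h q' hq'

/-- The gradient, as a linear map into the Hilbert space `L²(Ω)⁴`. -/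
def gradMap (Ω : Set Plane) : Vel Ω →ₗ[ℝ] PiLp 2 (fun _ : Fin 2 × Fin 2 => L2 Ω) where
  toFun v := WithLp.toLp 2 fun p => partialDeriv v p.1 p.2
  map_add' _ _ := rfl
  map_smul' _ _ := rfl

lemma inner_gradMap (u v : Vel Ω) : inner ℝ (gradMap Ω u) (gradMap Ω v) = a u v := by
  rw [PiLp.inner_apply, Fintype.sum_prod_type]
  rfl

lemma norm_gradMap (v : Vel Ω) : ‖gradMap Ω v‖ = gradNorm v := by
  rw [gradNorm, ← inner_gradMap, real_inner_self_eq_norm_sq, Real.sqrt_sq (norm_nonneg _)]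

lemma gradNorm_sq (v : Vel Ω) : gradNorm v ^ 2 = a v v := by
  rw [← norm_gradMap, ← inner_gradMap, real_inner_self_eq_norm_sq]

/-- The divergence, as a linear map. -/
def divMap (Ω : Set Plane) : Vel Ω →ₗ[ℝ] L2 Ω where
  toFun := div
  map_add' u v := by
    change ∑ i, partialDeriv (u + v) i i = ∑ i, partialDeriv u i i + ∑ i, partialDeriv v i i
    rw [← Finset.sum_add_distrib]
    rfl
  map_smul' c v := by
    change ∑ i, partialDeriv (c • v) i i = c • ∑ i, partialDeriv v i i
    rw [Finset.smul_sum]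
    rfl

/-- The discrete velocities as a linear subspace. -/
def velocitySubmodule (hΩ : IsPolygonalLipschitzDomain Ω) (T : Triangulation Ω) (k : ℕ) :
    Submodule ℝ (Vel Ω) where
  carrier := Sk0 T k
  zero_mem' _ := (polySubmodule hΩ T k).zero_mem
  add_mem' hu hv i := (polySubmodule hΩ T k).add_mem (hu i) (hv i)
  smul_mem' c _ hv i := (polySubmodule hΩ T k).smul_mem c (hv i)

lemma finiteDimensional_velocitySubmodule (hΩ : IsPolygonalLipschitzDomain Ω) (e : Numbering T)
    (k : ℕ) : FiniteDimensional ℝ (velocitySubmodule hΩ T k) := by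
  have := finiteDimensional_polySubmodule hΩ e k
  let f : velocitySubmodule hΩ T k →ₗ[ℝ] (Fin 2 → polySubmodule hΩ T k) :=
    { toFun := fun v i => ⟨comp v.1 i, v.2 i⟩
      map_add' := fun _ _ => rfl
      map_smul' := fun _ _ => rfl }
  refine FiniteDimensional.of_injective f ?_
  rw [injective_iff_map_eq_zero]
  intro v hv
  have h0 : ∀ i, comp v.1 i = 0 := fun i => congrArg Subtype.val (congrFun hv i)
  refine Subtype.ext (funext fun i => Subtype.ext (Prod.ext (h0 i) (funext fun j => ?_)))
  refine eq_zero_of_isPolyOn_zero (T := T) hΩ fun K hK => ?_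
  have h1 : IsPolyOn (comp v.1 i) K 0 := by
    rw [h0 i]
    exact IsPolyOn.zero (T.interior_tri_subset hΩ hK)
  simpa using isPolyOn_weakDeriv hΩ (v.1 i).2 hK h1 j

lemma exists_isLeast_velErrors (hΩ : IsPolygonalLipschitzDomain Ω) (e : Numbering T)
    (k : ℕ) (u : Vel Ω) : ∃ d, IsLeast (velErrors T k u) d := by
  have := finiteDimensional_velocitySubmodule hΩ e k
  set V := velocitySubmodule hΩ T k ⊓ LinearMap.ker (divMap Ω) with hV
  have : FiniteDimensional ℝ V := Submodule.finiteDimensional_of_le inf_le_left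
  obtain ⟨_, ⟨v, hv, rfl⟩, h⟩ := exists_best_approximation (V.map (gradMap Ω)) (gradMap Ω u)
  refine ⟨gradNorm (u - v), ⟨v, hv.1, hv.2, rfl⟩, ?_⟩
  rintro _ ⟨w, hw, hdw, rfl⟩
  have := h (gradMap Ω w) ⟨w, ⟨hw, hdw⟩, rfl⟩
  rwa [← map_sub, ← map_sub, norm_gradMap, norm_gradMap] at this

end Spaces

/-! ### Correcting the divergence of a discrete velocity field -/

/-- The squared `L²` norm over the triangle `K` of the gradient of the polynomial vector
field `P`. -/
def energyOn (P : Fin 2 → MvPolynomial (Fin 2) ℝ) (K : Finset Plane) : ℝ :=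
  ∑ c, ∑ j, ∫ x in tri K, polyEval (MvPolynomial.pderiv j (P c)) x ^ 2

lemma energyOn_nonneg (P : Fin 2 → MvPolynomial (Fin 2) ℝ) (K : Finset Plane) :
    0 ≤ energyOn P K :=
  Finset.sum_nonneg fun _ _ => Finset.sum_nonneg fun _ _ => integral_nonneg fun _ => sq_nonneg _

/-- The divergence of the polynomial vector field `P`. -/
def polyDiv (P : Fin 2 → MvPolynomial (Fin 2) ℝ) : MvPolynomial (Fin 2) ℝ :=
  MvPolynomial.pderiv 0 (P 0) + MvPolynomial.pderiv 1 (P 1)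

lemma IsCcw.sq_gradSize_le {K : Finset Plane} {z y w : Plane} (h : IsCcw K z y w) {k : ℕ}
    {P : Fin 2 → MvPolynomial (Fin 2) ℝ} (hP : ∀ c, (P c).totalDegree ≤ k) :
    cross (y - z) (w - z) * gradSize (jacobian P z) ^ 2 ≤
      (pointKernel (k - 1)).eval 0 * energyOn P K := by
  rw [gradSize_sq, energyOn, Finset.mul_sum, Finset.mul_sum]
  refine Finset.sum_le_sum fun c _ => ?_
  rw [Finset.mul_sum, Finset.mul_sum]
  exact Finset.sum_le_sum fun j _ => h.sq_polyEval_le (totalDegree_pderiv_le (hP c) j)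

lemma IsCcw.mem_left {K : Finset Plane} {z y w : Plane} (h : IsCcw K z y w) : z ∈ K := by
  rw [← Finset.mem_coe, h.coe_eq]
  exact mem_insert z _

lemma integrableOn_tri {f : Plane → ℝ} (hf : Continuous f) (K : Finset Plane) :
    IntegrableOn f (tri K) := hf.continuousOn.integrableOn_compact (isCompact_tri K)

lemma sinBound_le_one (γ : ℝ) : sinBound γ ≤ 1 := by
  unfold sinBound
  rw [div_le_one (by positivity)]
  nlinarith [sq_nonneg γ]

lemma eval_zero_pointKernel_le {k : ℕ} (hk : 4 ≤ k) :
    (pointKernel (k - 1)).eval 0 ≤ 4 * (pointKernel (k - 2)).eval 0 := by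
  obtain ⟨m, rfl⟩ := Nat.exists_eq_add_of_le' hk
  rw [eval_zero_pointKernel, eval_zero_pointKernel, show m + 4 - 1 = m + 3 by omega,
    show m + 4 - 2 = m + 2 by omega]
  push_cast
  have h : ((m : ℝ) + 3 + 2) * (m + 3 + 1) ≤ 2 * ((m + 2 + 1) * (m + 2 + 2)) := by
    have : (0 : ℝ) ≤ m := m.cast_nonneg
    nlinarith
  have h2 := pow_le_pow_left₀ (by positivity) h 2
  nlinarith

namespace Numbering

variable {T : Triangulation Ω} (e : Numbering T)

/-- The squared norm of the bubble at `z` on the smallest triangle of the patch, scaled by the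
alternating sum of the divergence. The degree `k` cancels between the inverse inequality for the
gradients and the size of the bubble. -/
lemma sq_alternating_div_mul_le (hΩ : IsPolygonalLipschitzDomain Ω) {γ η : ℝ}
    (hγ : T.shapeRegularity ≤ γ) (hη : 0 ≤ η) (hη' : η < sinBound γ ^ 2 / 4) {k : ℕ} (hk : 4 ≤ k)
    {z : Plane} (hz : z ∈ e.critical η) {v : Vel Ω}
    {P : Finset Plane → Fin 2 → MvPolynomial (Fin 2) ℝ}
    (hdeg : ∀ K ∈ T.cells, ∀ c, (P K c).totalDegree ≤ k)
    (hP : ∀ K ∈ T.cells, ∀ c, IsPolyOn (comp v c) K (P K c)) {i₀ : ℕ} (hi₀ : i₀ < T.N z)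
    (hmin : ∀ i < T.N z, volume.real (tri (e.cell z i₀)) ≤ volume.real (tri (e.cell z i))) :
    (∑ i ∈ Finset.range (T.N z), (-1 : ℝ) ^ (i + 1) * polyEval (polyDiv (P (e.cell z i))) z) ^ 2 *
        ∫ x in tri (e.cell z i₀),
          polyEval (vertexBubble (k - 2) z (e.point z i₀) (e.point z (i₀ + 1))) x ^ 2 ≤
      1216 * η ^ 2 / sinBound γ ^ 5 *
        ∑ i ∈ Finset.range (T.N z), energyOn (P (e.cell z i)) (e.cell z i) := by
  have hs := sinBound_pos γ
  set s := sinBound γ with hs_def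
  set κ := (pointKernel (k - 2)).eval 0 with hκ
  have hκ0 : 0 < κ := eval_zero_pointKernel_pos _
  set X := cross (e.point z i₀ - z) (e.point z (i₀ + 1) - z) with hX
  have hccw := e.isCcw hz.1 hi₀
  have hX0 : 0 < X := hccw.pos
  set g : ℕ → ℝ := fun i => gradSize (jacobian (P (e.cell z i)) z) with hg
  set A := ∑ i ∈ Finset.range (T.N z), (-1 : ℝ) ^ (i + 1) * polyEval (polyDiv (P (e.cell z i))) z
    with hA
  set S := ∑ i ∈ Finset.range (T.N z), energyOn (P (e.cell z i)) (e.cell z i) with hS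
  have hS0 : 0 ≤ S := Finset.sum_nonneg fun i _ => energyOn_nonneg _ _
  have hA1 : |A| ≤ η / s ^ 2 * ∑ i ∈ Finset.range (T.N z), g i := by
    refine le_trans (le_of_eq ?_) (e.abs_alternating_div_le hΩ hγ hη hη' hz hP)
    rw [← abs_neg, hA, ← Finset.sum_neg_distrib]
    congr 1
    refine Finset.sum_congr rfl fun i _ => ?_
    simp only [polyDiv, jacobian, polyEval_add, pow_succ]
    ring
  have hA2 : A ^ 2 ≤ (η / s ^ 2) ^ 2 * (T.N z * ∑ i ∈ Finset.range (T.N z), g i ^ 2) := by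
    have h1 : A ^ 2 ≤ (η / s ^ 2 * ∑ i ∈ Finset.range (T.N z), g i) ^ 2 := by
      rw [← sq_abs]
      exact pow_le_pow_left₀ (abs_nonneg _) hA1 2
    refine h1.trans ?_
    rw [mul_pow]
    have := sq_sum_le_card_mul_sum_sq (s := Finset.range (T.N z)) (f := g)
    rw [Finset.card_range] at this
    gcongr
  have hXg : X * ∑ i ∈ Finset.range (T.N z), g i ^ 2 ≤ 4 * κ * S := by
    rw [Finset.mul_sum, hS, Finset.mul_sum]
    refine Finset.sum_le_sum fun i hi => ?_
    have hi' := Finset.mem_range.mp hi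
    have hc := e.isCcw hz.1 hi'
    have h1 := hmin i hi'
    rw [hccw.volume_real_tri, hc.volume_real_tri] at h1
    have h2 := hc.sq_gradSize_le (hdeg _ (e.cell_mem hz.1 hi'))
    have h3 := mul_le_mul_of_nonneg_right (eval_zero_pointKernel_le hk)
      (energyOn_nonneg (P (e.cell z i)) (e.cell z i))
    have h4 : X * g i ^ 2 ≤ cross (e.point z i - z) (e.point z (i + 1) - z) * g i ^ 2 :=
      mul_le_mul_of_nonneg_right (by linarith) (sq_nonneg _)
    exact h4.trans (h2.trans h3)
  have hN : (T.N z : ℝ) ≤ 8 / s := by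
    rw [le_div_iff₀ hs]
    linarith [e.N_mul_sinBound_le hγ hz.1, Real.pi_lt_four]
  calc A ^ 2 * ∫ x in tri (e.cell z i₀),
          polyEval (vertexBubble (k - 2) z (e.point z i₀) (e.point z (i₀ + 1))) x ^ 2
      ≤ A ^ 2 * (X * (38 / κ)) :=
        mul_le_mul_of_nonneg_left (hccw.setIntegral_sq_vertexBubble_le (k - 2)) (sq_nonneg _)
    _ ≤ ((η / s ^ 2) ^ 2 * (T.N z * ∑ i ∈ Finset.range (T.N z), g i ^ 2)) * (X * (38 / κ)) := by
        gcongr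
    _ = (η / s ^ 2) ^ 2 * T.N z * (38 / κ) * (X * ∑ i ∈ Finset.range (T.N z), g i ^ 2) := by ring
    _ ≤ (η / s ^ 2) ^ 2 * (8 / s) * (38 / κ) * (4 * κ * S) := by gcongr
    _ = 1216 * η ^ 2 / s ^ 5 * S := by
        field_simp
        ring

lemma sum_patch {z : Plane} (hz : z ∈ T.vertices) [DecidableEq Plane]
    (f : Finset Plane → ℝ) :
    ∑ i ∈ Finset.range (T.N z), f (e.cell z i) = ∑ K ∈ T.cells with z ∈ K, f K := by
  refine Finset.sum_bij (fun i _ => e.cell z i) ?_ ?_ ?_ fun _ _ => rfl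
  · intro i hi
    have hi' := Finset.mem_range.mp hi
    exact Finset.mem_filter.mpr ⟨e.cell_mem hz hi', (e.isCcw hz hi').mem_left⟩
  · exact fun i hi j hj h => e.cell_inj hz (Finset.mem_range.mp hi) (Finset.mem_range.mp hj) h
  · intro K hK
    obtain ⟨hK1, hK2⟩ := Finset.mem_filter.mp hK
    obtain ⟨i, hi, h⟩ := e.exists_cell_eq hz hK1 hK2
    exact ⟨i, Finset.mem_range.mpr hi, h⟩

end Numbering

lemma isPolyOn_div {T : Triangulation Ω} (hΩ : IsPolygonalLipschitzDomain Ω) {v : Vel Ω}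
    {K : Finset Plane} (hK : K ∈ T.cells) {P : Fin 2 → MvPolynomial (Fin 2) ℝ}
    (hP : ∀ c, IsPolyOn (comp v c) K (P c)) : IsPolyOn (div v) K (polyDiv P) := by
  rw [div, Fin.sum_univ_two]
  exact (isPolyOn_weakDeriv hΩ (v 0).2 hK (hP 0) 0).add (T.interior_tri_subset hΩ hK)
    (isPolyOn_weakDeriv hΩ (v 1).2 hK (hP 1) 1)

lemma sq_gradNorm_eq_sum_energyOn {T : Triangulation Ω} (hΩ : IsPolygonalLipschitzDomain Ω)
    {v : Vel Ω} {P : Finset Plane → Fin 2 → MvPolynomial (Fin 2) ℝ}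
    (hP : ∀ K ∈ T.cells, ∀ c, IsPolyOn (comp v c) K (P K c)) :
    gradNorm v ^ 2 = ∑ K ∈ T.cells, energyOn (P K) K := by
  have h : ∀ i j, inner ℝ (partialDeriv v i j) (partialDeriv v i j) =
      ∑ K ∈ T.cells, ∫ x in tri K, polyEval (MvPolynomial.pderiv j (P K i)) x ^ 2 := by
    intro i j
    rw [real_inner_self_eq_norm_sq]
    exact T.norm_sq_eq_sum_poly hΩ fun K hK => isPolyOn_weakDeriv hΩ (v i).2 hK (hP K hK i) j
  simp only [gradNorm_sq, a, h, energyOn, Fin.sum_univ_two, Finset.sum_add_distrib]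

lemma setIntegral_div (hΩ : IsPolygonalLipschitzDomain Ω) (v : Vel Ω) :
    ∫ x in Ω, div v x = 0 := by
  have h := (meanZeroSubmodule hΩ).sum_mem (t := Finset.univ)
    (f := fun i : Fin 2 => partialDeriv v i i) fun i _ =>
      integral_weakDeriv_eq_zero hΩ.isBounded hΩ.isOpen.measurableSet (v i).2 i
  exact h

/-- The divergence of a discrete velocity field `v` is close to the pressure space: it suffices to
subtract, at every critical vertex, a multiple of the bubble on the smallest adjacent triangle. -/
lemma exists_div_sub_mem_pressureSpace {T : Triangulation Ω} (hΩ : IsPolygonalLipschitzDomain Ω)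
    (e : Numbering T) {γ η : ℝ} (hγ : T.shapeRegularity ≤ γ) (hη : 0 ≤ η)
    (hη' : η < sinBound γ ^ 2 / 4) {k : ℕ} (hk : 4 ≤ k) {v : Vel Ω} (hv : v ∈ Sk0 T k) :
    ∃ r : L2 Ω, div v - r ∈ pressureSpace e η (k - 1) ∧
      ‖r‖ ≤ 105 / sinBound γ ^ 3 * η * gradNorm v := by
  classical
  have hs := sinBound_pos γ
  have hs1 := sinBound_le_one γ
  have hv' : ∀ K ∈ T.cells, ∃ P : Fin 2 → MvPolynomial (Fin 2) ℝ,
      (∀ c, (P c).totalDegree ≤ k) ∧ ∀ c, IsPolyOn (comp v c) K (P c) := by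
    intro K hK
    choose P hP using fun c => hv c K hK
    exact ⟨P, fun c => (hP c).1, fun c => (hP c).2⟩
  choose! P hdeg hP using hv'
  have hmin : ∀ z ∈ T.vertices, ∃ i < T.N z, ∀ j < T.N z,
      volume.real (tri (e.cell z i)) ≤ volume.real (tri (e.cell z j)) := by
    intro z hz
    obtain ⟨i, hi, h⟩ := (Finset.range (T.N z)).exists_min_image
      (fun i => volume.real (tri (e.cell z i))) ⟨0, Finset.mem_range.mpr (e.N_pos hz)⟩
    exact ⟨i, Finset.mem_range.mp hi, fun j hj => h j (Finset.mem_range.mpr hj)⟩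
  choose! idx hidx hmin using hmin
  set B : Plane → MvPolynomial (Fin 2) ℝ := fun z =>
    vertexBubble (k - 2) z (e.point z (idx z)) (e.point z (idx z + 1)) with hB
  set A : Plane → ℝ := fun z => ∑ i ∈ Finset.range (T.N z),
    (-1 : ℝ) ^ (i + 1) * polyEval (polyDiv (P (e.cell z i))) z with hA
  -- the coefficient of the bubble at `z` on the triangle `K`
  set coef : Finset Plane → Plane → ℝ := fun K z =>
    if z ∈ e.critical η ∧ e.cell z (idx z) = K then (-1) ^ (idx z + 1) * A z else 0 with hcoef
  have hcoef0 : ∀ K z, coef K z ≠ 0 → z ∈ e.critical η ∧ e.cell z (idx z) = K :=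
    fun K z h => by_contra fun h' => h (if_neg h')
  have hBccw : ∀ K z, coef K z ≠ 0 →
      IsCcw K z (e.point z (idx z)) (e.point z (idx z + 1)) := by
    intro K z h
    obtain ⟨h1, h2⟩ := hcoef0 K z h
    exact h2 ▸ e.isCcw h1.1 (hidx z h1.1)
  set R : Finset Plane → MvPolynomial (Fin 2) ℝ := fun K =>
    ∑ z ∈ K, coef K z • B z with hR
  have hRx : ∀ K x, polyEval (R K) x = ∑ z ∈ K, coef K z * polyEval (B z) x := by
    intro K x
    simp only [hR, polyEval_sum, polyEval_smul]
  have hRdeg : ∀ K, (R K).totalDegree ≤ k - 1 := by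
    intro K
    refine MvPolynomial.totalDegree_finsetSum_le fun z _ =>
      (MvPolynomial.totalDegree_smul_le _ _).trans ?_
    have := totalDegree_vertexBubble_le (n := k - 2) (by omega) z (e.point z (idx z))
      (e.point z (idx z + 1))
    exact this.trans (by omega)
  -- at a vertex of `K` only its own bubble contributes
  have hRz : ∀ K, ∀ z ∈ K, polyEval (R K) z = coef K z := by
    intro K z hz
    rw [hRx, Finset.sum_eq_single z]
    · rcases eq_or_ne (coef K z) 0 with h | h
      · rw [h, zero_mul]
      · rw [(hBccw K z h).vertexBubble_self, mul_one]
    · intro y hy hyz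
      rcases eq_or_ne (coef K y) 0 with h | h
      · rw [h, zero_mul]
      · rw [(hBccw K y h).vertexBubble_of_ne _ hz hyz.symm, mul_zero]
    · exact fun h => absurd hz h
  have hRint : ∀ K, ∫ x in tri K, polyEval (R K) x = 0 := by
    intro K
    simp only [hRx]
    rw [integral_finsetSum]
    · refine Finset.sum_eq_zero fun z _ => ?_
      rw [integral_const_mul]
      rcases eq_or_ne (coef K z) 0 with h | h
      · rw [h, zero_mul]
      · rw [(hBccw K z h).setIntegral_vertexBubble (by omega), mul_zero]
    · exact fun z _ => integrableOn_tri (continuous_const.mul (continuous_polyEval _)) K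
  obtain ⟨r, hr⟩ := T.exists_isPolyOn hΩ R
  have hdiv : ∀ K ∈ T.cells, IsPolyOn (div v) K (polyDiv (P K)) :=
    fun K hK => isPolyOn_div hΩ hK (hP K hK)
  have hdivk : div v ∈ polySubmodule hΩ T (k - 1) := fun K hK =>
    ⟨_, (MvPolynomial.totalDegree_add _ _).trans (max_le (totalDegree_pderiv_le (hdeg K hK 0) 0)
      (totalDegree_pderiv_le (hdeg K hK 1) 1)), hdiv K hK⟩
  have hrk : r ∈ polySubmodule hΩ T (k - 1) := fun K hK => ⟨_, hRdeg K, hr K hK⟩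
  have hr0 : r ∈ meanZeroSubmodule hΩ := by
    change ∫ x in Ω, r x = 0
    rw [T.setIntegral_eq_sum_poly hΩ hr]
    exact Finset.sum_eq_zero fun K _ => hRint K
  have hralt : ∀ z ∈ e.critical η, altSum e z r = A z := by
    intro z hz
    have hi := hidx z hz.1
    rw [altSum_eq e hz.1 hr, Finset.sum_eq_single (idx z)]
    · rw [hRz _ z (e.isCcw hz.1 hi).mem_left, hcoef]
      simp only [hz, true_and, if_true]
      rw [← mul_assoc, ← pow_add, Even.neg_one_pow ⟨_, rfl⟩, one_mul]
    · intro i hi' hne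
      have hi'' := Finset.mem_range.mp hi'
      rw [hRz _ z (e.isCcw hz.1 hi'').mem_left, hcoef]
      simp only
      rw [if_neg fun h => hne (e.cell_inj hz.1 hi'' hi h.2.symm), mul_zero]
    · exact fun h => absurd (Finset.mem_range.mpr hi) h
  refine ⟨r, ⟨(polySubmodule hΩ T (k - 1)).sub_mem hdivk hrk,
    (meanZeroSubmodule hΩ).sub_mem (setIntegral_div hΩ v) hr0, fun z hz => ?_⟩, ?_⟩
  · rw [sub_eq_add_neg, ← neg_one_smul ℝ r, altSum_add hΩ e hz.1 hdivk
      ((polySubmodule hΩ T (k - 1)).smul_mem _ hrk), altSum_smul hΩ e hz.1 _ hrk, hralt z hz,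
      altSum_eq e hz.1 hdiv]
    ring
  set D := 1216 * η ^ 2 / sinBound γ ^ 5 with hD
  have hD0 : 0 ≤ D := by positivity
  -- the contribution of one bubble
  have hterm : ∀ K ∈ T.cells, ∀ z ∈ K, coef K z ^ 2 * ∫ x in tri K, polyEval (B z) x ^ 2 ≤
      if e.cell z (idx z) = K then D * ∑ L ∈ T.cells with z ∈ L, energyOn (P L) L else 0 := by
    intro K hK z hz
    have hzv : z ∈ T.vertices := ⟨K, hK, hz⟩
    have hE : 0 ≤ D * ∑ L ∈ T.cells with z ∈ L, energyOn (P L) L :=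
      mul_nonneg hD0 (Finset.sum_nonneg fun _ _ => energyOn_nonneg _ _)
    by_cases h : z ∈ e.critical η ∧ e.cell z (idx z) = K
    · have h1 := e.sq_alternating_div_mul_le hΩ hγ hη hη' hk h.1 hdeg hP (hidx z hzv) (hmin z hzv)
      rw [e.sum_patch hzv fun L => energyOn (P L) L] at h1
      rw [if_pos h.2, hcoef]
      simp only
      rw [if_pos h, mul_pow, ← pow_mul, mul_comm _ 2, pow_mul, neg_one_sq, one_pow, one_mul]
      rw [h.2] at h1
      exact h1
    · rw [hcoef]
      simp only
      rw [if_neg h]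
      rw [zero_pow two_ne_zero, zero_mul]
      split_ifs
      · exact hE
      · exact le_rfl
  have hnorm : ‖r‖ ^ 2 ≤ 9 * D * gradNorm v ^ 2 := by
    calc ‖r‖ ^ 2 = ∑ K ∈ T.cells, ∫ x in tri K, polyEval (R K) x ^ 2 :=
          T.norm_sq_eq_sum_poly hΩ hr
      _ ≤ ∑ K ∈ T.cells, 3 * ∑ z ∈ K, coef K z ^ 2 * ∫ x in tri K, polyEval (B z) x ^ 2 := by
          refine Finset.sum_le_sum fun K hK => ?_
          have hint : ∀ z, IntegrableOn (fun x => coef K z ^ 2 * polyEval (B z) x ^ 2) (tri K) :=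
            fun z => integrableOn_tri (continuous_const.mul ((continuous_polyEval _).pow 2)) K
          simp only [← integral_const_mul]
          rw [← integral_finsetSum _ fun z _ => hint z, ← integral_const_mul]
          refine integral_mono (integrableOn_tri ((continuous_polyEval _).pow 2) K)
            ((integrable_finsetSum _ fun z _ => hint z).const_mul _) fun x => ?_
          have := sq_sum_le_card_mul_sum_sq (s := K) (f := fun z => coef K z * polyEval (B z) x)
          rw [T.card_eq K hK] at this
          simpa only [hRx, mul_pow, Nat.cast_ofNat] using this
      _ ≤ ∑ K ∈ T.cells, 3 * ∑ z ∈ K, if e.cell z (idx z) = K then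
            D * ∑ L ∈ T.cells with z ∈ L, energyOn (P L) L else 0 := by
          gcongr with K hK z hz
          exact hterm K hK z hz
      _ = 3 * ∑ z ∈ T.cells.biUnion id, ∑ K ∈ T.cells with z ∈ K, if e.cell z (idx z) = K then
            D * ∑ L ∈ T.cells with z ∈ L, energyOn (P L) L else 0 := by
          rw [← Finset.mul_sum]
          congr 1
          refine Finset.sum_comm' fun K z => ?_
          simp only [Finset.mem_biUnion, Finset.mem_filter, id]
          exact ⟨fun h => ⟨h, K, h⟩, fun h => h.1⟩
      _ ≤ 3 * ∑ z ∈ T.cells.biUnion id, D * ∑ L ∈ T.cells with z ∈ L, energyOn (P L) L := by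
          gcongr with z hz
          rw [Finset.sum_ite_eq]
          split_ifs
          · exact le_rfl
          · exact mul_nonneg hD0 (Finset.sum_nonneg fun _ _ => energyOn_nonneg _ _)
      _ = 3 * (D * ∑ L ∈ T.cells, ∑ z ∈ L, energyOn (P L) L) := by
          rw [← Finset.mul_sum]
          congr 2
          refine Finset.sum_comm' fun z K => ?_
          simp only [Finset.mem_biUnion, Finset.mem_filter, id]
          exact ⟨fun h => ⟨h.2.2, h.2.1⟩, fun h => ⟨⟨K, h.2, h.1⟩, h.2, h.1⟩⟩
      _ = 9 * D * gradNorm v ^ 2 := by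
          rw [sq_gradNorm_eq_sum_energyOn hΩ hP]
          have : ∀ L ∈ T.cells, ∑ z ∈ L, energyOn (P L) L = 3 * energyOn (P L) L := by
            intro L hL
            rw [Finset.sum_const, T.card_eq L hL, nsmul_eq_mul, Nat.cast_ofNat]
          rw [Finset.sum_congr rfl this, ← Finset.mul_sum]
          ring
  refine le_of_sq_le_sq ?_ (by have := Real.sqrt_nonneg (a v v); unfold gradNorm; positivity)
  refine hnorm.trans ?_
  rw [mul_pow]
  gcongr
  rw [hD, mul_pow, div_pow, ← pow_mul]
  have h6 : sinBound γ ^ 6 ≤ sinBound γ ^ 5 := pow_le_pow_of_le_one hs.le hs1 (by norm_num)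
  calc 9 * (1216 * η ^ 2 / sinBound γ ^ 5) = 10944 * η ^ 2 / sinBound γ ^ 5 := by ring
    _ ≤ 10944 * η ^ 2 / sinBound γ ^ 6 := by gcongr
    _ ≤ 11025 * η ^ 2 / sinBound γ ^ 6 := by gcongr; norm_num
    _ = 105 ^ 2 / sinBound γ ^ (3 * 2) * η ^ 2 := by norm_num; ring

/-! ### The error estimate -/

lemma gradNorm_nonneg (v : Vel Ω) : 0 ≤ gradNorm v := Real.sqrt_nonneg _

lemma gradNorm_add_le (u v : Vel Ω) : gradNorm (u + v) ≤ gradNorm u + gradNorm v := by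
  simp only [← norm_gradMap, map_add]
  exact norm_add_le _ _

lemma gradNorm_neg (v : Vel Ω) : gradNorm (-v) = gradNorm v := by
  simp only [← norm_gradMap, map_neg, norm_neg]

lemma a_le (u v : Vel Ω) : a u v ≤ gradNorm u * gradNorm v := by
  simp only [← norm_gradMap, ← inner_gradMap]
  exact real_inner_le_norm _ _

lemma a_sub_left (u u' v : Vel Ω) : a (u - u') v = a u v - a u' v := by
  simp only [← inner_gradMap, map_sub, inner_sub_left]

lemma div_sub (u v : Vel Ω) : div (u - v) = div u - div v := map_sub (divMap Ω) u v

lemma le_of_sq_le_mul {x y : ℝ} (hx : 0 ≤ x) (hy : 0 ≤ y) (h : x ^ 2 ≤ y * x) : x ≤ y := by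
  rcases hx.eq_or_lt with rfl | hx
  · exact hy
  · exact le_of_mul_le_mul_right (by rwa [← pow_two]) hx

/-- If the divergence of every discrete field `v` is within `c ‖∇v‖` of the discrete pressures,
then the velocity error of a Galerkin solution is bounded by the best approximation with
divergence-free fields plus `c` times a pressure approximation error. -/
lemma galerkin_error_le {S : Submodule ℝ (Vel Ω)} {M : Submodule ℝ (L2 Ω)}
    {c : ℝ} (hc : 0 ≤ c) (hdiv : ∀ v ∈ S, ∃ r : L2 Ω, div v - r ∈ M ∧ ‖r‖ ≤ c * gradNorm v)
    {F : Vel Ω →L[ℝ] ℝ} {u uS : Vel Ω} {p pM : L2 Ω} (hu : IsStokesSolution F u p)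
    (huS : IsDiscreteSolution S M F uS pM) {vS : Vel Ω} (hvS : vS ∈ S) (hvS0 : div vS = 0)
    {qM : L2 Ω} (hqM : qM ∈ M) :
    gradNorm (u - uS) ≤ 2 * gradNorm (u - vS) + c * ‖p - qM‖ ∧
      ‖div uS‖ ≤ c * (gradNorm (u - vS) + c * ‖p - qM‖) := by
  obtain ⟨-, hu1, -⟩ := hu
  obtain ⟨hS, hpM, hS1, hS2⟩ := huS
  have hwS : uS - vS ∈ S := S.sub_mem hS hvS
  have hdw : div (uS - vS) = div uS := by rw [div_sub, hvS0, sub_zero]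
  set w := uS - vS with hw
  have hd : ‖div uS‖ ≤ c * gradNorm w := by
    obtain ⟨r, hr, hrn⟩ := hdiv w hwS
    refine le_trans ?_ hrn
    rw [hdw] at hr
    -- `div uS - r` is a discrete pressure, so `div uS` is orthogonal to it
    have h0 : inner ℝ (div uS) (div uS - r) = 0 := hS2 _ hr
    rw [inner_sub_right, real_inner_self_eq_norm_sq] at h0
    have h1 := real_inner_le_norm (div uS) r
    exact le_of_sq_le_mul (norm_nonneg _) (norm_nonneg _) (by linarith)
  have hwn : gradNorm w ≤ gradNorm (u - vS) + c * ‖p - qM‖ := by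
    refine le_of_sq_le_mul (gradNorm_nonneg _)
      (add_nonneg (gradNorm_nonneg _) (mul_nonneg hc (norm_nonneg _))) ?_
    have h1 : a w w = a (u - vS) w - b w (p - qM) := by
      have e1 := hu1 w
      have e2 := hS1 w hwS
      have e3 : b w pM = 0 := by rw [b, hdw]; exact hS2 _ hpM
      have e4 : b w qM = 0 := by rw [b, hdw]; exact hS2 _ hqM
      have e5 : b w (p - qM) = b w p - b w qM := inner_sub_right _ _ _
      have e6 : a w w = a uS w - a vS w := a_sub_left _ _ _
      have e7 : a (u - vS) w = a u w - a vS w := a_sub_left _ _ _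
      linarith
    have h2 := a_le (u - vS) w
    have h3 : |b w (p - qM)| ≤ ‖div uS‖ * ‖p - qM‖ := by
      rw [b, hdw]
      exact abs_real_inner_le_norm _ _
    have h4 := neg_abs_le (b w (p - qM))
    have h5 := mul_le_mul_of_nonneg_right hd (norm_nonneg (p - qM))
    rw [gradNorm_sq, h1]
    nlinarith
  refine ⟨?_, hd.trans (mul_le_mul_of_nonneg_left hwn hc)⟩
  have h1 : u - uS = (u - vS) + -w := by rw [hw]; abel
  have h2 := gradNorm_add_le (u - vS) (-w)
  rw [← h1, gradNorm_neg] at h2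
  linarith

end Stokes

end

theorem theorem2 :
    ∃ η₀ : ℝ → ℝ → ℝ, (∀ γ α : ℝ, 0 < α → 0 < η₀ γ α) ∧
      ∀ Ω : Set Stokes.Plane, Stokes.IsPolygonalLipschitzDomain Ω →
      ∀ γ : ℝ, ∃ C : ℝ, 0 < C ∧
        ∀ α : ℝ, 0 < α →
        ∀ (T : Stokes.Triangulation Ω) (e : Stokes.Numbering T),
          T.shapeRegularity ≤ γ → α ≤ e.minOuterAngle →
        ∀ k : ℕ, 4 ≤ k → ∀ η : ℝ, 0 ≤ η → η < η₀ γ α →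
        ∀ (F : Stokes.Vel Ω →L[ℝ] ℝ) (u : Stokes.Vel Ω) (p : Stokes.L2 Ω),
          Stokes.IsStokesSolution F u p →
        ∀ (uS : Stokes.Vel Ω) (pM : Stokes.L2 Ω),
          Stokes.IsDiscreteSolution (Stokes.Sk0 T k) (Stokes.pressureSpace e η (k - 1)) F uS pM →
        ∃ dV dP : ℝ,
          IsLeast (Stokes.velErrors T k u) dV ∧
          IsLeast (Stokes.presErrors e η (k - 1) p) dP ∧
          Stokes.gradNorm (u - uS) ≤ C * (dV + η * dP) ∧
          ‖Stokes.div uS‖ ≤ C * (η * dV + η ^ 2 * dP) := by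
  refine ⟨fun γ _ => Stokes.sinBound γ ^ 2 / 4, fun γ _ _ => ?_, fun Ω hΩ γ => ?_⟩
  · have := Stokes.sinBound_pos γ
    positivity
  have hs := Stokes.sinBound_pos γ
  set c := 105 / Stokes.sinBound γ ^ 3 with hc
  have hc0 : 0 < c := by positivity
  refine ⟨2 + c + c ^ 2, by positivity, ?_⟩
  intro α _ T e hγ _ k hk η hη hη' F u p hup uS pM hdisc
  obtain ⟨dV, hdV⟩ := Stokes.exists_isLeast_velErrors hΩ e k u
  obtain ⟨dP, hdP⟩ := Stokes.exists_isLeast_presErrors hΩ e η (k - 1) p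
  refine ⟨dV, dP, hdV, hdP, ?_⟩
  obtain ⟨vS, hvS, hvS0, hV⟩ := hdV.1
  obtain ⟨qM, hqM, hP⟩ := hdP.1
  obtain ⟨h1, h2⟩ := Stokes.galerkin_error_le (S := Stokes.velocitySubmodule hΩ T k)
    (M := Stokes.pressureSubmodule hΩ e η (k - 1)) (mul_nonneg hc0.le hη)
    (fun v hv => Stokes.exists_div_sub_mem_pressureSpace hΩ e hγ hη hη' hk hv) hup hdisc hvS hvS0
    hqM
  rw [← hV, ← hP] at h1 h2
  have hdV0 : 0 ≤ dV := hV ▸ Real.sqrt_nonneg _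
  have hdP0 : 0 ≤ dP := hP ▸ norm_nonneg _
  have hx : 0 ≤ η * dP := mul_nonneg hη hdP0
  have hy : 0 ≤ η * dV := mul_nonneg hη hdV0
  have hz : 0 ≤ η ^ 2 * dP := mul_nonneg (sq_nonneg _) hdP0
  constructor
  · refine h1.trans ?_
    nlinarith [mul_nonneg hc0.le hdV0, mul_nonneg (sq_nonneg c) hdV0,
      mul_nonneg (sq_nonneg c) hx]
  · refine h2.trans ?_
    nlinarith [mul_nonneg hc0.le hz, mul_nonneg (sq_nonneg c) hy]
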